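/- Fix $\ell\in\mathbb{N}$. The set of positive integers $n$ with $n^\ell \mid \binom{2n}{n}$ has a positive asymptotic density $c_\ell$; that is, the limit \[ c_\ell=\lim_{N\to\infty}\frac1N\,\#\Big\{1\le n\le N:\ n^\ell\,\Big|\,\binom{2n}{n}\Big\} \] exists and is positive. The density may be computed as follows. Let $U_1,U_2,\ldots$ be independent random variables, each uniformly distributed on $[0,1]$, and for $j\ge 1$ let \[ g_j=\left\lfloor\frac{1}{(1-U_1)\cdots(1-U_{j-1})\,U_j}\right\rfloor-1 , \] so that $g_1=\lfloor 1/U_1\rfloor-1$ (almost surely every $g_j$ is a well-defined non-negative integer). Then the infinite product below converges almost surely, is integrable, and \[ c_\ell=\mathbb{E}\prod_{j=1}^{\infty}\left(1-2^{-g_j}\sum_{h=0}^{\ell-1}\binom{g_j}{h}\right). \] -/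

import Mathlib

open MeasureTheory ProbabilityTheory Filter Topology

namespace CentralBinomDensity

/-- The set `A` of natural numbers has asymptotic density `d`, i.e.
`#(A ∩ {1, …, N}) / N → d` as `N → ∞`. -/
def HasAsymptoticDensity (A : Set ℕ) (d : ℝ) : Prop :=
  Tendsto (fun N : ℕ => ((A ∩ Set.Icc 1 N).ncard : ℝ) / (N : ℝ)) atTop (𝓝 d)

/-- Stick breaking: `(1 - u 0) ⋯ (1 - u (j - 1)) * u j` (indices start at `0`). -/
noncomputable def stick (u : ℕ → ℝ) (j : ℕ) : ℝ :=
  (∏ i ∈ Finset.range j, (1 - u i)) * u j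

/-- `⌊1 / stick u j⌋ - 1`. If all `u i` lie in the open interval `(0, 1)`, then `stick u j` is
in `(0, 1)`, the floor is at least `1`, and the subtraction is the genuine one. -/
noncomputable def gIndex (u : ℕ → ℝ) (j : ℕ) : ℕ :=
  ⌊1 / stick u j⌋₊ - 1

/-- `1 - 2 ^ (-b) * ∑_{h < ℓ} (b choose h)`. -/
noncomputable def carryFactor (ℓ b : ℕ) : ℝ :=
  1 - ((2 : ℝ) ^ b)⁻¹ * ∑ h ∈ Finset.range ℓ, (b.choose h : ℝ)

end CentralBinomDensity

namespace CentralBinomDensity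

/-! By Kummer, the exponent of a prime p in binom(2n, n) is the number of exponents e ≥ 1 for which
n/p^e has fractional part at least 1/2. Hence n^ℓ divides binom(2n, n) exactly when each prime p
dividing n has at least ℓ·v_p(n) such e (`pow_dvd_centralBinom_iff`). If p = x^v divides a typical n
≤ x, then e = 1 fails because p divides n, and e > 1/v fails because p^e exceeds 2n. This leaves g =
⌊1/v⌋ - 1 exponents. If they behave like independent fair coins, p passes with probability
`carryFactor ℓ g`.

Sizes of the primes: the sum of log p over p dividing n is close to log x on average, so a uniform n
≤ x may be replaced by n = pm, with p of weight log p/(p log x) and m uniform up to x/p. By Mertens,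
log p/log x is then uniform on [0,1]. Repeating this k times is stick breaking
(`avg_sub_sizeBiased`, `tendsto_sizeBiased_uCoord`).

Fairness of the coins: write n = Pm with P = p_1⋯p_k fixed. By Weyl's criterion the numbers mP/p_i^e
equidistribute jointly for m ≤ x/P, unless some nontrivial integer combination of the frequencies
P/p_i^e lies within O(P/x) of an integer (`exists_phases`). Such resonant tuples are negligible: as
a function of the prime giving the dominant term, the combination has a difference of suitable order
that is small but not tiny, and differencing saves a power of x (`card_nearSet_of_fwdDiff`,
`card_resonant_line`, `tendsto_sizeBiased_isResonant`).

The cofactor m: requiring carries at only k primes gives an upper bound for the density, for every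
k. For the converse, m is usually below x^η once k is large, and primes up to x^η obstruct only a
set of small density (`avg_smallPrimeObstruction_le`). So the proportion of good n converges to the
limit of `meanProd ℓ k` (`exists_tendsto_meanProd`). A lower bound uniform in k makes the limit
positive (`exists_pos_le_meanProd`), and dominated convergence identifies it with the expectation of
the infinite product. -/

/-! ### Mertens' first theorem. -/

open Finset in
lemma sum_log_div_mul_pred_bounded :
    ∃ C : ℝ, 0 ≤ C ∧ ∀ N : ℕ, ∑ p ∈ N.primesLE, Real.log p / (p * (p - 1)) ≤ C := by
  have hs : Summable (fun n : ℕ => 4 * ((n : ℝ) ^ (-(3 / 2) : ℝ))) :=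
    (Real.summable_nat_rpow.mpr (by norm_num)).mul_left 4
  refine ⟨∑' n : ℕ, 4 * ((n : ℝ) ^ (-(3 / 2) : ℝ)), tsum_nonneg fun n => by positivity, ?_⟩
  intro N
  refine le_trans (sum_le_sum fun p hp => ?_) (hs.sum_le_tsum _ fun n _ => by positivity)
  have h2 : (2 : ℝ) ≤ p := by exact_mod_cast Nat.two_le_of_mem_primesLE hp
  have hp0 : (0 : ℝ) < p := by linarith
  -- log p ≤ 2√p and p(p-1) ≥ p²/2 give the majorant 4p^(-3/2).
  have hl := Real.log_le_rpow_div hp0.le (ε := 1 / 2) (by norm_num)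
  have e1 : (p : ℝ) ^ (-(3 / 2) : ℝ) = (p : ℝ) ^ (1 / 2 : ℝ) / p ^ 2 := by
    rw [← Real.rpow_natCast, ← Real.rpow_sub hp0]; norm_num
  rw [e1, div_le_iff₀ (by nlinarith)]
  have h3 : 0 < (p : ℝ) ^ (1 / 2 : ℝ) := by positivity
  calc Real.log p ≤ 2 * (p : ℝ) ^ (1 / 2 : ℝ) := by linarith
    _ ≤ 4 * (((p : ℝ) ^ (1 / 2 : ℝ) / p ^ 2) * (p * (p - 1))) := by
      rw [div_mul_eq_mul_div, ← mul_div_assoc, le_div_iff₀ (by positivity)]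
      nlinarith [mul_pos h3 hp0, mul_nonneg (mul_pos h3 hp0).le (by linarith : (0 : ℝ) ≤ p - 2)]
    _ = _ := by ring

/-- One term N^N/N! of the exponential series at N already gives this weak Stirling bound. -/
lemma mul_log_sub_le_log_factorial (N : ℕ) :
    N * Real.log N - N ≤ Real.log (N.factorial) := by
  rcases Nat.eq_zero_or_pos N with rfl | hN
  · simp
  have hN' : (0 : ℝ) < N := by exact_mod_cast hN
  have h := Real.pow_div_factorial_le_exp (N : ℝ) hN'.le N
  have hf : (0 : ℝ) < N.factorial := by exact_mod_cast N.factorial_pos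
  have h2 := Real.log_le_log (by positivity) h
  rw [Real.log_div (by positivity) hf.ne', Real.log_pow, Real.log_exp] at h2
  linarith

lemma log_eq_sum_factorization {n N : ℕ} (hn : n ≠ 0) (h : n.primeFactors ⊆ N.primesLE) :
    Real.log n = ∑ p ∈ N.primesLE, n.factorization p * Real.log p := by
  conv_lhs => rw [← Nat.prod_factorization_pow_eq_self hn]
  rw [Finsupp.prod, Nat.cast_prod, Real.log_prod]
  · rw [Nat.support_factorization]
    simp only [Nat.cast_pow, Real.log_pow]
    refine Finset.sum_subset h fun p _ hp => ?_
    rw [← Nat.support_factorization, Finsupp.notMem_support_iff] at hp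
    simp [hp]
  · intro p hp
    rw [Nat.support_factorization] at hp
    have := (Nat.prime_of_mem_primeFactors hp).pos
    positivity

lemma sum_log_primeFactors_le_log {n : ℕ} (hn : n ≠ 0) :
    ∑ p ∈ n.primeFactors, Real.log p ≤ Real.log n := by
  rw [← Real.log_prod, ← Nat.cast_prod]
  · refine Real.log_le_log ?_ ?_
    · exact_mod_cast Finset.prod_pos fun p hp => (Nat.prime_of_mem_primeFactors hp).pos
    · exact_mod_cast Nat.le_of_dvd (Nat.pos_of_ne_zero hn) (Nat.prod_primeFactors_dvd n)
  · intro p hp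
    have := (Nat.prime_of_mem_primeFactors hp).pos
    positivity

lemma card_multiples_Icc (N d : ℕ) :
    ((Finset.Icc 1 N).filter (d ∣ ·)).card = N / d := by
  have : (Finset.Icc 1 N) = Finset.Ioc 0 N := by ext; simp; omega
  rw [this, Nat.Ioc_filter_dvd_card_eq_div]

/-- Interchanging a sum over `n ≤ N` and the prime divisors of `n`. -/
lemma sum_Icc_sum_primeFactors (N : ℕ) (F : ℕ → ℕ → ℝ) :
    ∑ n ∈ Finset.Icc 1 N, ∑ p ∈ n.primeFactors, F p n =
      ∑ p ∈ N.primesLE, ∑ n ∈ (Finset.Icc 1 N).filter (p ∣ ·), F p n := by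
  refine Finset.sum_comm' fun n p => ?_
  simp only [Finset.mem_Icc, Nat.mem_primeFactors, Finset.mem_filter, Nat.mem_primesLE]
  constructor
  · rintro ⟨⟨h1, h2⟩, hp, hd, h0⟩
    exact ⟨⟨⟨h1, h2⟩, hd⟩, (Nat.le_of_dvd h1 hd).trans h2, hp⟩
  · rintro ⟨⟨⟨h1, h2⟩, hd⟩, _, hp⟩
    exact ⟨⟨h1, h2⟩, hp, hd, by omega⟩

lemma sum_log_primesLE_le (N : ℕ) : ∑ p ∈ N.primesLE, Real.log p ≤ Real.log 4 * N := by
  rw [← Chebyshev.theta_eq_sum_primesLE_log]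
  exact Chebyshev.theta_le_log4_mul_x (by positivity)

/-- Mertens' first theorem. -/
lemma mertens_nat : ∃ C : ℝ, 0 ≤ C ∧ ∀ N : ℕ, 1 ≤ N →
    |∑ p ∈ N.primesLE, Real.log p / p - Real.log N| ≤ C := by
  obtain ⟨C, hC0, hC⟩ := sum_log_div_mul_pred_bounded
  have hl4 : 0 ≤ Real.log 4 := Real.log_nonneg (by norm_num)
  refine ⟨Real.log 4 + (1 + C), by linarith, fun N hN => ?_⟩
  have hN' : (0 : ℝ) < N := by exact_mod_cast hN
  rw [abs_le]
  constructor
  -- Lower bound: v_p(N!) ≤ N/(p-1), and 1/(p-1) = 1/p + 1/(p(p-1)), where the last part has a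
  -- bounded sum against log p.
  · have h1 : Real.log N.factorial ≤
        N * ∑ p ∈ N.primesLE, Real.log p / p +
          N * ∑ p ∈ N.primesLE, Real.log p / (p * (p - 1)) := by
      rw [log_eq_sum_factorization (N := N) N.factorial_ne_zero, ← mul_add,
        ← Finset.sum_add_distrib, Finset.mul_sum]
      · refine Finset.sum_le_sum fun p hp => ?_
        have hpp := Nat.prime_of_mem_primesLE hp
        have h2 : (2 : ℝ) ≤ p := by exact_mod_cast hpp.two_le
        have hlog : 0 ≤ Real.log p := Real.log_nonneg (by linarith)
        have h3 : ((N.factorial.factorization p : ℕ) : ℝ) ≤ N / (p - 1) := by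
          have := Nat.factorization_factorial_le_div_pred hpp N
          calc ((N.factorial.factorization p : ℕ) : ℝ) ≤ ((N / (p - 1) : ℕ) : ℝ) := by
                exact_mod_cast this
            _ ≤ (N : ℝ) / ((p - 1 : ℕ) : ℝ) := Nat.cast_div_le
            _ = _ := by rw [Nat.cast_sub hpp.one_lt.le]; simp
        calc _ ≤ (N : ℝ) / (p - 1) * Real.log p := by gcongr
          _ = _ := by
            have : (p : ℝ) - 1 ≠ 0 := by linarith
            field_simp
            ring
      · intro p hp
        rw [Nat.mem_primeFactors] at hp
        exact Nat.mem_primesLE.mpr ⟨(hp.1.dvd_factorial).mp hp.2.1, hp.1⟩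
    have h2 := mul_log_sub_le_log_factorial N
    have h3 := hC N
    have h4 : (N : ℝ) * (Real.log N - 1 - C) ≤ N * ∑ p ∈ N.primesLE, Real.log p / p := by
      nlinarith
    have := le_of_mul_le_mul_left h4 hN'
    linarith
  -- Upper bound: the logarithms of the radicals of all n ≤ N total at most N log N. Replacing the
  -- integer part of N/p by N/p then costs θ(N) ≤ N log 4.
  · have h1 : ∑ p ∈ N.primesLE, Real.log p * ((N / p : ℕ) : ℝ) ≤ N * Real.log N := by
      have h := sum_Icc_sum_primeFactors N (fun p _ => Real.log p)
      simp only [Finset.sum_const, card_multiples_Icc, nsmul_eq_mul] at h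
      simp_rw [mul_comm (Real.log _)]
      rw [← h]
      calc _ ≤ ∑ n ∈ Finset.Icc 1 N, Real.log N := by
            refine Finset.sum_le_sum fun n hn => ?_
            rw [Finset.mem_Icc] at hn
            refine (sum_log_primeFactors_le_log (by omega)).trans ?_
            exact Real.log_le_log (by exact_mod_cast hn.1) (by exact_mod_cast hn.2)
        _ = _ := by simp
    have h2 : N * ∑ p ∈ N.primesLE, Real.log p / p ≤
        ∑ p ∈ N.primesLE, Real.log p * ((N / p : ℕ) : ℝ) + ∑ p ∈ N.primesLE, Real.log p := by
      rw [Finset.mul_sum, ← Finset.sum_add_distrib]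
      refine Finset.sum_le_sum fun p hp => ?_
      have hpp := Nat.prime_of_mem_primesLE hp
      have hlog : 0 ≤ Real.log p := Real.log_nonneg (by exact_mod_cast hpp.one_lt.le)
      have : (N : ℝ) / p ≤ ((N / p : ℕ) : ℝ) + 1 := by
        rw [← Nat.floor_div_eq_div (K := ℝ)]
        exact (Nat.lt_floor_add_one _).le
      calc (N : ℝ) * (Real.log p / p) = Real.log p * (N / p) := by ring
        _ ≤ Real.log p * (((N / p : ℕ) : ℝ) + 1) := by gcongr
        _ = _ := by ring
    have h3 := sum_log_primesLE_le N
    have h4 : N * ∑ p ∈ N.primesLE, Real.log p / p ≤ (N : ℝ) * (Real.log N + Real.log 4) := by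
      nlinarith
    have := le_of_mul_le_mul_left h4 hN'
    linarith

lemma log_sub_log_floor {x : ℝ} (hx : 1 ≤ x) :
    0 ≤ Real.log x - Real.log ⌊x⌋₊ ∧ Real.log x - Real.log ⌊x⌋₊ ≤ Real.log 2 := by
  have h1 : (1 : ℝ) ≤ ⌊x⌋₊ := by exact_mod_cast (Nat.one_le_floor_iff x).mpr hx
  have h2 := Nat.floor_le (by linarith : 0 ≤ x)
  have h3 := Nat.lt_floor_add_one x
  constructor
  · have := Real.log_le_log (by linarith) h2
    linarith
  · rw [sub_le_iff_le_add, ← Real.log_mul (by norm_num) (by linarith)]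
    exact Real.log_le_log (by linarith) (by linarith)

lemma mertens : ∃ C : ℝ, 0 ≤ C ∧ ∀ x : ℝ, 1 ≤ x →
    |∑ p ∈ ⌊x⌋₊.primesLE, Real.log p / p - Real.log x| ≤ C := by
  obtain ⟨C, hC0, hC⟩ := mertens_nat
  refine ⟨C + Real.log 2, by positivity, fun x hx => ?_⟩
  have h1 := abs_le.mp (hC ⌊x⌋₊ ((Nat.one_le_floor_iff x).mpr hx))
  have h2 := log_sub_log_floor hx
  rw [abs_le]
  constructor <;> linarith

/-! ### Size-biased choice of one prime factor. -/

/-- The weight of the prime `p` in the size-biased choice of a prime factor at height `x`. -/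
noncomputable def primeWeight (x : ℝ) (p : ℕ) : ℝ := Real.log p / (p * Real.log x)

lemma primeWeight_nonneg {x : ℝ} (hx : 1 ≤ x) (p : ℕ) : 0 ≤ primeWeight x p := by
  unfold primeWeight
  have := Real.log_natCast_nonneg p
  have := Real.log_nonneg hx
  positivity

lemma sum_primeWeight (x : ℝ) (s : Finset ℕ) :
    ∑ p ∈ s, primeWeight x p = (∑ p ∈ s, Real.log p / p) / Real.log x := by
  rw [Finset.sum_div]
  exact Finset.sum_congr rfl fun p _ => by rw [primeWeight, div_div]

lemma primesLE_floor_eq_empty {x : ℝ} (hx : x < 2) : ⌊x⌋₊.primesLE = ∅ := by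
  have : ⌊x⌋₊ < 2 := (Nat.floor_lt' (by norm_num)).mpr (by exact_mod_cast hx)
  interval_cases ⌊x⌋₊ <;> simp

lemma sum_primeWeight_bounded : ∃ C : ℝ, 1 ≤ C ∧ ∀ x : ℝ, 1 ≤ x →
    ∑ p ∈ ⌊x⌋₊.primesLE, primeWeight x p ≤ C := by
  obtain ⟨C, hC0, hC⟩ := mertens
  have hl2 : 0 < Real.log 2 := Real.log_pos (by norm_num)
  refine ⟨1 + C / Real.log 2, by have : 0 ≤ C / Real.log 2 := by positivity
                                 linarith, fun x hx => ?_⟩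
  rcases lt_or_ge x 2 with h | h
  · rw [primesLE_floor_eq_empty h]; simp; positivity
  rw [sum_primeWeight]
  have hl : Real.log 2 ≤ Real.log x := Real.log_le_log (by norm_num) h
  have hlx : 0 < Real.log x := by linarith
  rw [div_le_iff₀ hlx, add_mul, one_mul]
  have := (abs_le.mp (hC x hx)).2
  have h3 : C ≤ C / Real.log 2 * Real.log x := by
    rw [div_mul_eq_mul_div, le_div_iff₀ hl2]; gcongr
  linarith

lemma primesLE_floor_mem {x : ℝ} {p : ℕ} (hx : 0 ≤ x) :
    p ∈ ⌊x⌋₊.primesLE ↔ (p : ℝ) ≤ x ∧ p.Prime := by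
  rw [Nat.mem_primesLE, Nat.le_floor_iff hx]

/-- A bounded function of `p` that is small when `x / p` is large has small weighted sum. -/
lemma sum_primeWeight_mul_small : ∃ C : ℝ, 1 ≤ C ∧ ∀ (B X₀ ε : ℝ), 0 < B → 1 ≤ X₀ → 0 < ε →
    ∃ X₁ : ℝ, 1 ≤ X₁ ∧ ∀ x : ℝ, X₁ ≤ x → ∀ φ : ℕ → ℝ,
      (∀ p : ℕ, p.Prime → (p : ℝ) ≤ x → |φ p| ≤ B) →
      (∀ p : ℕ, p.Prime → (p : ℝ) ≤ x / X₀ → |φ p| ≤ ε) →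
      |∑ p ∈ ⌊x⌋₊.primesLE, primeWeight x p * φ p| ≤ C * ε := by
  obtain ⟨C, hC0, hC⟩ := mertens
  obtain ⟨C₁, hC₁, hm⟩ := sum_primeWeight_bounded
  refine ⟨C₁ + 1, by linarith, fun B X₀ ε hB hX₀ hε => ?_⟩
  have hlX : 0 ≤ Real.log X₀ := Real.log_nonneg hX₀
  obtain ⟨X₂, hX₂⟩ := (Filter.eventually_atTop).mp
    (Real.tendsto_log_atTop.eventually_ge_atTop (B * (Real.log X₀ + 2 * C) / ε + 1))
  refine ⟨max X₂ X₀, le_max_of_le_right hX₀, fun x hx φ h1 h2 => ?_⟩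
  have hx0 : X₀ ≤ x := (le_max_right _ _).trans hx
  have hx1 : 1 ≤ x := hX₀.trans hx0
  have hlx := hX₂ x ((le_max_left _ _).trans hx)
  have hlx0 : 0 < Real.log x := by
    have : 0 ≤ B * (Real.log X₀ + 2 * C) / ε := by positivity
    linarith
  have hdiv : 1 ≤ x / X₀ := by rw [le_div_iff₀ (by linarith)]; linarith
  have hsub : ⌊x / X₀⌋₊.primesLE ⊆ ⌊x⌋₊.primesLE :=
    Nat.primesLE_mono (Nat.floor_mono (div_le_self (by linarith) hX₀))
  calc |∑ p ∈ ⌊x⌋₊.primesLE, primeWeight x p * φ p|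
      ≤ ∑ p ∈ ⌊x⌋₊.primesLE, primeWeight x p * |φ p| := by
        refine (Finset.abs_sum_le_sum_abs _ _).trans (Finset.sum_le_sum fun p _ => ?_)
        rw [abs_mul, abs_of_nonneg (primeWeight_nonneg hx1 p)]
    _ = ∑ p ∈ ⌊x⌋₊.primesLE \ ⌊x / X₀⌋₊.primesLE, primeWeight x p * |φ p| +
          ∑ p ∈ ⌊x / X₀⌋₊.primesLE, primeWeight x p * |φ p| :=
        (Finset.sum_sdiff hsub).symm
    _ ≤ ∑ p ∈ ⌊x⌋₊.primesLE \ ⌊x / X₀⌋₊.primesLE, primeWeight x p * B +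
          ∑ p ∈ ⌊x / X₀⌋₊.primesLE, primeWeight x p * ε := by
        refine add_le_add (Finset.sum_le_sum fun p hp => ?_) (Finset.sum_le_sum fun p hp => ?_)
        · have hp' := (primesLE_floor_mem (by linarith)).mp (Finset.sdiff_subset hp)
          exact mul_le_mul_of_nonneg_left (h1 p hp'.2 hp'.1) (primeWeight_nonneg hx1 p)
        · have hp' := (primesLE_floor_mem (by linarith)).mp hp
          exact mul_le_mul_of_nonneg_left (h2 p hp'.2 hp'.1) (primeWeight_nonneg hx1 p)
    -- By Mertens at x and at x/X₀, the primes in (x/X₀, x] have total weight at most (log X₀ +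
    -- 2C)/log x.
    _ ≤ ε + C₁ * ε := by
        refine add_le_add ?_ ?_
        · rw [← Finset.sum_mul, sum_primeWeight, Finset.sum_sdiff_eq_sub hsub]
          have e1 := (abs_le.mp (hC x hx1)).2
          have e2 := (abs_le.mp (hC _ hdiv)).1
          rw [Real.log_div (by linarith) (by linarith)] at e2
          rw [div_mul_eq_mul_div, div_le_iff₀ hlx0]
          have e3 : B * (Real.log X₀ + 2 * C) ≤ ε * Real.log x := by
            have : B * (Real.log X₀ + 2 * C) / ε ≤ Real.log x := by linarith
            rw [div_le_iff₀ hε] at this; linarith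
          nlinarith
        · rw [← Finset.sum_mul]
          refine mul_le_mul_of_nonneg_right ?_ hε.le
          refine le_trans ?_ (hm x hx1)
          exact Finset.sum_le_sum_of_subset_of_nonneg hsub fun p _ _ => primeWeight_nonneg hx1 p
    _ = _ := by ring

/-- The average of `f` over the positive integers up to `x`. -/
noncomputable def avg (x : ℝ) (f : ℕ → ℝ) : ℝ := (∑ m ∈ Finset.Icc 1 ⌊x⌋₊, f m) / x

lemma avg_mono {x : ℝ} (hx : 0 ≤ x) {f g : ℕ → ℝ} (h : ∀ m : ℕ, 1 ≤ m → (m : ℝ) ≤ x → f m ≤ g m) :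
    avg x f ≤ avg x g := by
  unfold avg
  gcongr with m hm
  rw [Finset.mem_Icc, Nat.le_floor_iff hx] at hm
  exact h _ hm.1 hm.2

lemma avg_nonneg {x : ℝ} (hx : 0 ≤ x) {f : ℕ → ℝ} (h : ∀ m, 0 ≤ f m) : 0 ≤ avg x f :=
  div_nonneg (Finset.sum_nonneg fun m _ => h m) hx

lemma avg_le_one {x : ℝ} (hx : 0 ≤ x) {f : ℕ → ℝ} (h : ∀ m, f m ≤ 1) : avg x f ≤ 1 := by
  refine div_le_one_of_le₀ ((Finset.sum_le_sum fun m _ => h m).trans ?_) hx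
  simpa using Nat.floor_le hx

lemma avg_add (x : ℝ) (f g : ℕ → ℝ) : avg x (fun m => f m + g m) = avg x f + avg x g := by
  simp [avg, Finset.sum_add_distrib, add_div]

lemma sum_Icc_div_eq_sum_filter_dvd {p : ℕ} (hp : 0 < p) (N : ℕ) (f : ℕ → ℝ) :
    ∑ m ∈ Finset.Icc 1 (N / p), f (p * m) = ∑ n ∈ (Finset.Icc 1 N).filter (p ∣ ·), f n := by
  refine Finset.sum_bij (fun m _ => p * m) ?_ ?_ ?_ fun _ _ => rfl
  · intro m hm
    simp only [Finset.mem_Icc, Finset.mem_filter] at hm ⊢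
    refine ⟨⟨Nat.mul_pos hp hm.1, ?_⟩, dvd_mul_right _ _⟩
    rw [Nat.le_div_iff_mul_le hp] at hm
    linarith [hm.2, mul_comm m p]
  · intro a _ b _ h
    exact Nat.eq_of_mul_eq_mul_left hp h
  · intro n hn
    simp only [Finset.mem_Icc, Finset.mem_filter] at hn
    obtain ⟨⟨h1, h2⟩, m, rfl⟩ := hn
    refine ⟨m, ?_, rfl⟩
    rw [Finset.mem_Icc, Nat.le_div_iff_mul_le hp]
    exact ⟨Nat.pos_of_mul_pos_left h1, by linarith [mul_comm m p]⟩

/-- The weighted sum is the average of f(n) times the sum of log p over p dividing n, divided by log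
x. The deficit of that inner sum from log x is nonnegative and totals O(x) over n ≤ x by Mertens and
Chebyshev, so the error is uniform in f. -/
lemma avg_sub_sum_primeWeight : ∃ C : ℝ, 0 ≤ C ∧ ∀ x : ℝ, 2 ≤ x → ∀ f : ℕ → ℝ,
    (∀ m, 0 ≤ f m) → (∀ m, f m ≤ 1) →
    |avg x f - ∑ p ∈ ⌊x⌋₊.primesLE, primeWeight x p * avg (x / p) (fun m => f (p * m))| ≤
      C / Real.log x := by
  obtain ⟨C, hC0, hC⟩ := mertens
  have hl4 : 0 ≤ Real.log 4 := Real.log_nonneg (by norm_num)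
  refine ⟨C + Real.log 4, by positivity, fun x hx f hf0 hf1 => ?_⟩
  have hx0 : 0 < x := by linarith
  have hlx : 0 < Real.log x := Real.log_pos (by linarith)
  set N := ⌊x⌋₊ with hN
  have hNx : (N : ℝ) ≤ x := Nat.floor_le hx0.le
  have e1 : ∑ p ∈ N.primesLE, primeWeight x p * avg (x / p) (fun m => f (p * m)) =
      (∑ n ∈ Finset.Icc 1 N, f n * ∑ p ∈ n.primeFactors, Real.log p) / (x * Real.log x) := by
    simp_rw [Finset.mul_sum]
    rw [sum_Icc_sum_primeFactors N (fun p n => f n * Real.log p), Finset.sum_div]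
    refine Finset.sum_congr rfl fun p hp => ?_
    have hpp := (Nat.prime_of_mem_primesLE hp).pos
    have hp0 : (p : ℝ) ≠ 0 := by positivity
    rw [avg, Nat.floor_div_natCast, ← hN, sum_Icc_div_eq_sum_filter_dvd hpp, ← Finset.sum_mul,
      primeWeight]
    field_simp
  have e2 : avg x f = (∑ n ∈ Finset.Icc 1 N, f n * Real.log x) / (x * Real.log x) := by
    rw [avg, ← Finset.sum_mul, mul_div_mul_right _ _ hlx.ne']
  have hpos : ∀ n ∈ Finset.Icc 1 N, 0 ≤ Real.log x - ∑ p ∈ n.primeFactors, Real.log p := by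
    intro n hn
    rw [Finset.mem_Icc] at hn
    have h1 := sum_log_primeFactors_le_log (n := n) (by omega)
    have h2 : Real.log n ≤ Real.log x := by
      refine Real.log_le_log (by exact_mod_cast hn.1) (le_trans ?_ hNx)
      exact_mod_cast hn.2
    linarith
  rw [e1, e2, ← sub_div, ← Finset.sum_sub_distrib]
  simp_rw [← mul_sub]
  rw [abs_of_nonneg (div_nonneg (Finset.sum_nonneg fun n hn => mul_nonneg (hf0 n) (hpos n hn))
    (by positivity)), div_le_div_iff₀ (by positivity) hlx]
  have h3 : ∑ n ∈ Finset.Icc 1 N, f n * (Real.log x - ∑ p ∈ n.primeFactors, Real.log p) ≤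
      (C + Real.log 4) * x := by
    calc _ ≤ ∑ n ∈ Finset.Icc 1 N, (Real.log x - ∑ p ∈ n.primeFactors, Real.log p) := by
          refine Finset.sum_le_sum fun n hn => ?_
          have := mul_le_mul_of_nonneg_right (hf1 n) (hpos n hn)
          linarith
      _ = N * Real.log x - ∑ p ∈ N.primesLE, ((N / p : ℕ) : ℝ) * Real.log p := by
          rw [Finset.sum_sub_distrib, sum_Icc_sum_primeFactors N (fun p _ => Real.log p)]
          simp [card_multiples_Icc]
      _ ≤ x * Real.log x - ∑ p ∈ N.primesLE, (x * (Real.log p / p) - Real.log p) := by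
          refine sub_le_sub (by gcongr) (Finset.sum_le_sum fun p hp => ?_)
          have hlog : 0 ≤ Real.log p := Real.log_natCast_nonneg p
          have : x / p ≤ ((N / p : ℕ) : ℝ) + 1 := by
            rw [hN, ← Nat.floor_div_natCast]
            exact (Nat.lt_floor_add_one _).le
          calc x * (Real.log p / p) - Real.log p = (x / p - 1) * Real.log p := by ring
            _ ≤ _ := by gcongr; linarith
      _ ≤ _ := by
          rw [Finset.sum_sub_distrib, ← Finset.mul_sum]
          have h4 := sum_log_primesLE_le N
          have h5 := (abs_le.mp (hC x (by linarith))).1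
          have h6 : Real.log 4 * (N : ℝ) ≤ Real.log 4 * x := by gcongr
          nlinarith
  calc _ ≤ (C + Real.log 4) * x * Real.log x := by gcongr
    _ = _ := by ring

/-! ### Iterated size-biased choice of primes. -/

/-- Expectation of `Φ` over tuples of primes chosen one after the other, size-biased. -/
noncomputable def sizeBiased : (k : ℕ) → ℝ → ((Fin k → ℕ) → ℝ) → ℝ
  | 0, _, Φ => Φ Fin.elim0
  | k + 1, x, Φ => ∑ p ∈ ⌊x⌋₊.primesLE,
      primeWeight x p * sizeBiased k (x / p) (fun q => Φ (Fin.cons p q))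

lemma one_le_div_of_mem_primesLE {x : ℝ} (hx : 0 ≤ x) {p : ℕ} (hp : p ∈ ⌊x⌋₊.primesLE) :
    1 ≤ x / p := by
  rw [primesLE_floor_mem hx] at hp
  rw [le_div_iff₀ (by exact_mod_cast hp.2.pos)]
  linarith [hp.1]

lemma sizeBiased_mono {k : ℕ} : ∀ {x : ℝ}, 1 ≤ x → ∀ {Φ Ψ : (Fin k → ℕ) → ℝ},
    (∀ p : Fin k → ℕ, (∀ i, (p i).Prime) → ((∏ i, p i : ℕ) : ℝ) ≤ x → Φ p ≤ Ψ p) →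
    sizeBiased k x Φ ≤ sizeBiased k x Ψ := by
  induction k with
  | zero => intro x hx Φ Ψ h; exact h _ (fun i => i.elim0) (by simpa using hx)
  | succ k ih =>
    intro x hx Φ Ψ h
    refine Finset.sum_le_sum fun p hp => mul_le_mul_of_nonneg_left ?_ (primeWeight_nonneg hx p)
    have hx0 : 0 ≤ x := by linarith
    refine ih (one_le_div_of_mem_primesLE hx0 hp) fun q hq hqx => h _ ?_ ?_
    · intro i
      refine Fin.cases ?_ (fun i => ?_) i
      · simpa using Nat.prime_of_mem_primesLE hp
      · simpa using hq i
    · have hp0 : (0 : ℝ) < p := by exact_mod_cast (Nat.prime_of_mem_primesLE hp).pos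
      rw [le_div_iff₀ hp0] at hqx
      rw [Fin.prod_univ_succ]
      simp only [Fin.cons_zero, Fin.cons_succ]
      push_cast at hqx ⊢
      linarith

lemma sizeBiased_add {k : ℕ} : ∀ (x : ℝ) (Φ Ψ : (Fin k → ℕ) → ℝ),
    sizeBiased k x (fun p => Φ p + Ψ p) = sizeBiased k x Φ + sizeBiased k x Ψ := by
  induction k with
  | zero => intro x Φ Ψ; rfl
  | succ k ih =>
    intro x Φ Ψ
    simp only [sizeBiased, ih, mul_add, Finset.sum_add_distrib]

lemma sizeBiased_const_mul {k : ℕ} : ∀ (x c : ℝ) (Φ : (Fin k → ℕ) → ℝ),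
    sizeBiased k x (fun p => c * Φ p) = c * sizeBiased k x Φ := by
  induction k with
  | zero => intro x c Φ; rfl
  | succ k ih =>
    intro x c Φ
    simp only [sizeBiased, ih, Finset.mul_sum]
    exact Finset.sum_congr rfl fun _ _ => by ring

lemma sizeBiased_sub {k : ℕ} (x : ℝ) (Φ Ψ : (Fin k → ℕ) → ℝ) :
    sizeBiased k x (fun p => Φ p - Ψ p) = sizeBiased k x Φ - sizeBiased k x Ψ := by
  have h := sizeBiased_add x (fun p => Φ p - Ψ p) Ψ
  simp only [sub_add_cancel] at h
  linarith

lemma sizeBiased_sum {k : ℕ} {ι : Type*} (s : Finset ι) (x : ℝ) (Φ : ι → (Fin k → ℕ) → ℝ) :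
    sizeBiased k x (fun p => ∑ i ∈ s, Φ i p) = ∑ i ∈ s, sizeBiased k x (Φ i) := by
  classical
  induction s using Finset.induction_on with
  | empty =>
    have := sizeBiased_const_mul (k := k) x 0 (fun _ => 0)
    simpa using this
  | insert a s ha ih => simp only [Finset.sum_insert ha, sizeBiased_add, ih]

lemma abs_sizeBiased_le {k : ℕ} {x : ℝ} (hx : 1 ≤ x) {Φ Ψ : (Fin k → ℕ) → ℝ}
    (h : ∀ p : Fin k → ℕ, (∀ i, (p i).Prime) → ((∏ i, p i : ℕ) : ℝ) ≤ x → |Φ p| ≤ Ψ p) :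
    |sizeBiased k x Φ| ≤ sizeBiased k x Ψ := by
  rw [abs_le]
  constructor
  · have h1 := sizeBiased_const_mul x (-1) Ψ
    have h2 := sizeBiased_mono hx (Φ := fun p => -1 * Ψ p) (Ψ := Φ) fun p h1 h2 => by
      linarith [(abs_le.mp (h p h1 h2)).1]
    linarith
  · exact sizeBiased_mono hx fun p h1 h2 => (abs_le.mp (h p h1 h2)).2

lemma sizeBiased_const_bounded (k : ℕ) : ∃ C : ℝ, 1 ≤ C ∧ ∀ x : ℝ, 1 ≤ x → ∀ a : ℝ, 0 ≤ a →
    sizeBiased k x (fun _ => a) ≤ C * a := by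
  obtain ⟨C, hC1, hC⟩ := sum_primeWeight_bounded
  induction k with
  | zero => exact ⟨1, le_rfl, fun x _ a _ => by simp [sizeBiased]⟩
  | succ k ih =>
    obtain ⟨D, hD1, hD⟩ := ih
    refine ⟨C * D, one_le_mul_of_one_le_of_one_le hC1 hD1, fun x hx a ha => ?_⟩
    calc sizeBiased (k + 1) x (fun _ => a)
        ≤ ∑ p ∈ ⌊x⌋₊.primesLE, primeWeight x p * (D * a) :=
          Finset.sum_le_sum fun p hp => mul_le_mul_of_nonneg_left
            (hD _ (one_le_div_of_mem_primesLE (by linarith) hp) a ha) (primeWeight_nonneg hx p)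
      _ ≤ C * (D * a) := by
          rw [← Finset.sum_mul]
          exact mul_le_mul_of_nonneg_right (hC x hx) (by positivity)
      _ = _ := by ring

lemma sizeBiased_le_of_le {k : ℕ} {C : ℝ}
    (hC : ∀ x : ℝ, 1 ≤ x → ∀ a : ℝ, 0 ≤ a → sizeBiased k x (fun _ => a) ≤ C * a)
    {x : ℝ} (hx : 1 ≤ x) {a : ℝ} (ha : 0 ≤ a) {Φ : (Fin k → ℕ) → ℝ}
    (h : ∀ p : Fin k → ℕ, (∀ i, (p i).Prime) → ((∏ i, p i : ℕ) : ℝ) ≤ x → |Φ p| ≤ a) :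
    |sizeBiased k x Φ| ≤ C * a :=
  (abs_sizeBiased_le hx h).trans (hC x hx a ha)

/-- Averages over integers agree asymptotically with size-biased averages over the cofactor. -/
lemma avg_sub_sizeBiased (k : ℕ) : ∀ ε : ℝ, 0 < ε → ∃ X : ℝ, 1 ≤ X ∧ ∀ x : ℝ, X ≤ x →
    ∀ f : ℕ → ℝ, (∀ m, 0 ≤ f m) → (∀ m, f m ≤ 1) →
    |avg x f - sizeBiased k x (fun p => avg (x / (∏ i, p i : ℕ)) (fun m => f ((∏ i, p i) * m)))|
      ≤ ε := by
  induction k with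
  | zero =>
    intro ε hε
    exact ⟨1, le_rfl, fun x _ f _ _ => by simpa [sizeBiased] using hε.le⟩
  | succ k ih =>
    intro ε hε
    obtain ⟨C, hC0, hC⟩ := avg_sub_sum_primeWeight
    obtain ⟨C₂, hC₂, hsm⟩ := sum_primeWeight_mul_small
    obtain ⟨D, hD1, hD⟩ := sizeBiased_const_bounded k
    have hC₂0 : 0 < C₂ := by linarith
    obtain ⟨X₀, hX₀, h0⟩ := ih (ε / (2 * C₂)) (by positivity)
    -- For primes above x/X₀ the height x/p is too low for the inductive estimate. There only the
    -- crude bound 1 + D is available, but these primes have negligible weight.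
    obtain ⟨X₁, hX₁, h1⟩ := hsm (1 + D * 1) X₀ (ε / (2 * C₂)) (by linarith) hX₀ (by positivity)
    obtain ⟨X₂, hX₂⟩ := (Filter.eventually_atTop).mp
      (Real.tendsto_log_atTop.eventually_ge_atTop (2 * C / ε))
    refine ⟨max (max X₁ 2) X₂, le_max_of_le_left (le_max_of_le_left hX₁), fun x hx f hf0 hf1 => ?_⟩
    have hx1 : X₁ ≤ x := (le_max_left _ _).trans ((le_max_left _ _).trans hx)
    have hx2 : 2 ≤ x := (le_max_right _ _).trans ((le_max_left _ _).trans hx)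
    have hlx := hX₂ x ((le_max_right _ _).trans hx)
    have hlx0 : 0 < Real.log x := Real.log_pos (by linarith)
    have hA := hC x hx2 f hf0 hf1
    have hB := h1 x hx1 (fun p => avg (x / p) (fun m => f (p * m)) -
      sizeBiased k (x / p) (fun q => avg (x / p / (∏ i, q i : ℕ))
        (fun m => f (p * ((∏ i, q i) * m))))) ?_ ?_
    · simp_rw [mul_sub] at hB
      rw [Finset.sum_sub_distrib] at hB
      have e : sizeBiased (k + 1) x (fun p => avg (x / (∏ i, p i : ℕ))
          (fun m => f ((∏ i, p i) * m))) = ∑ p ∈ ⌊x⌋₊.primesLE, primeWeight x p *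
            sizeBiased k (x / p) (fun q => avg (x / p / (∏ i, q i : ℕ))
              (fun m => f (p * ((∏ i, q i) * m)))) := by
        rw [sizeBiased]
        simp only [Fin.prod_univ_succ, Fin.cons_zero, Fin.cons_succ, Nat.cast_mul, div_div,
          mul_assoc]
      rw [e]
      have hA' : C / Real.log x ≤ ε / 2 := by
        rw [div_le_iff₀ hlx0]
        rw [div_le_iff₀ hε] at hlx
        linarith
      have hB' : C₂ * (ε / (2 * C₂)) = ε / 2 := by field_simp
      rw [hB'] at hB
      rw [abs_le] at hA hB ⊢
      constructor <;> linarith [hA.1, hA.2, hB.1, hB.2]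
    · intro p hp hpx
      have h1p : 1 ≤ x / p := one_le_div_of_mem_primesLE (by linarith)
        ((primesLE_floor_mem (by linarith)).mpr ⟨hpx, hp⟩)
      refine (abs_sub _ _).trans (add_le_add ?_ ?_)
      · rw [abs_of_nonneg (avg_nonneg (by linarith) fun m => hf0 _)]
        exact avg_le_one (by linarith) fun m => hf1 _
      · refine sizeBiased_le_of_le hD h1p zero_le_one fun q hq _ => ?_
        have : 0 ≤ x / p / ((∏ i, q i : ℕ) : ℝ) := by positivity
        rw [abs_of_nonneg (avg_nonneg this fun m => hf0 _)]
        exact avg_le_one this fun m => hf1 _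
    · intro p hp hpx
      have hp0 : (0 : ℝ) < p := by exact_mod_cast hp.pos
      have : X₀ ≤ x / p := by
        rw [le_div_iff₀ (by linarith)] at hpx
        rw [le_div_iff₀ hp0]
        linarith
      simpa [mul_assoc] using h0 _ this (fun m => f (p * m)) (fun m => hf0 _) (fun m => hf1 _)

/-! ### Equidistribution of the stick-breaking coordinates. -/

/-- The uniform distribution on the unit cube. -/
noncomputable def cubeMeasure (k : ℕ) : Measure (Fin k → ℝ) :=
  Measure.pi fun _ => volume.restrict (Set.Icc (0 : ℝ) 1)

instance : IsProbabilityMeasure (volume.restrict (Set.Icc (0 : ℝ) 1)) :=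
  ⟨by simp⟩

instance (k : ℕ) : IsProbabilityMeasure (cubeMeasure k) := by
  unfold cubeMeasure; infer_instance

lemma ae_mem_cube (k : ℕ) : ∀ᵐ u ∂cubeMeasure k, ∀ i, u i ∈ Set.Icc (0 : ℝ) 1 := by
  rw [ae_all_iff]
  intro i
  have h : ∀ᵐ a ∂(volume.restrict (Set.Icc (0 : ℝ) 1)), a ∈ Set.Icc (0 : ℝ) 1 :=
    ae_restrict_mem measurableSet_Icc
  exact (measurePreserving_eval (fun _ : Fin k => volume.restrict (Set.Icc (0 : ℝ) 1)) i
    ).quasiMeasurePreserving.ae h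

lemma measurePreserving_cons (k : ℕ) :
    MeasurePreserving (fun z : ℝ × (Fin k → ℝ) => (Fin.cons z.1 z.2 : Fin (k + 1) → ℝ))
      ((volume.restrict (Set.Icc (0 : ℝ) 1)).prod (cubeMeasure k)) (cubeMeasure (k + 1)) := by
  have := (measurePreserving_piFinSuccAbove
    (fun _ : Fin (k + 1) => volume.restrict (Set.Icc (0 : ℝ) 1)) 0).symm
  convert this using 1
  · ext z i
    simp [MeasurableEquiv.piFinSuccAbove]
  · rfl
  · rfl

lemma integral_cubeMeasure_succ {k : ℕ} {F : (Fin (k + 1) → ℝ) → ℝ} (hF : Measurable F)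
    {B : ℝ} (hB : ∀ u, |F u| ≤ B) :
    ∫ u, F u ∂cubeMeasure (k + 1) =
      ∫ a in Set.Icc (0 : ℝ) 1, ∫ u, F (Fin.cons a u) ∂cubeMeasure k := by
  have hmp := measurePreserving_cons k
  rw [← hmp.map_eq, integral_map hmp.measurable.aemeasurable hF.aestronglyMeasurable,
    integral_prod]
  exact Integrable.of_bound (hF.comp hmp.measurable).aestronglyMeasurable B
    (Eventually.of_forall fun z => hB _)

/-- `F` is bounded by `1` and varies by at most `ε` on pairs of points of the unit cube at
distance at most `δ`. -/
structure HasModulus {k : ℕ} (F : (Fin k → ℝ) → ℝ) (ε δ : ℝ) : Prop where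
  continuous : Continuous F
  bound : ∀ u, |F u| ≤ 1
  close : ∀ u v : Fin k → ℝ, (∀ i, u i ∈ Set.Icc (0 : ℝ) 1) → (∀ i, v i ∈ Set.Icc (0 : ℝ) 1) →
    (∀ i, |u i - v i| ≤ δ) → |F u - F v| ≤ ε

lemma exists_hasModulus {k : ℕ} {F : (Fin k → ℝ) → ℝ} (hF : Continuous F) (hb : ∀ u, |F u| ≤ 1)
    {ε : ℝ} (hε : 0 < ε) : ∃ δ, 0 < δ ∧ HasModulus F ε δ := by
  have hc : IsCompact (Set.univ.pi fun _ : Fin k => Set.Icc (0 : ℝ) 1) :=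
    isCompact_univ_pi fun _ => isCompact_Icc
  have hu := hc.uniformContinuousOn_of_continuous hF.continuousOn
  rw [Metric.uniformContinuousOn_iff] at hu
  obtain ⟨δ, hδ, h⟩ := hu ε hε
  refine ⟨δ / 2, by positivity, hF, hb, fun u v hu hv huv => ?_⟩
  refine (h u (fun i _ => hu i) v (fun i _ => hv i) ?_).le
  refine lt_of_le_of_lt ((dist_pi_le_iff (by positivity)).mpr fun i => ?_) (half_lt_self hδ)
  exact huv i

/-- Freezing the first coordinate preserves the modulus, so thresholds in the induction on `k` can
be chosen independently of the frozen value. -/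
lemma HasModulus.cons {k : ℕ} {F : (Fin (k + 1) → ℝ) → ℝ} {ε δ : ℝ} (h : HasModulus F ε δ)
    (hδ : 0 ≤ δ) {a : ℝ} (ha : a ∈ Set.Icc (0 : ℝ) 1) :
    HasModulus (fun u : Fin k → ℝ => F (Fin.cons a u)) ε δ where
  continuous := h.continuous.comp (by fun_prop)
  bound _ := h.bound _
  close u v hu hv huv := by
    refine h.close _ _ ?_ ?_ ?_ <;> intro i <;> refine Fin.cases ?_ (fun i => ?_) i
    · exact ha
    · exact hu i
    · exact ha
    · exact hv i
    · simpa using hδ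
    · exact huv i

lemma hasModulus_integral_cons {k : ℕ} {F : (Fin (k + 1) → ℝ) → ℝ} {ε δ : ℝ}
    (h : HasModulus F ε δ) (hδ : 0 ≤ δ) :
    Continuous (fun a : ℝ => ∫ u, F (Fin.cons a u) ∂cubeMeasure k) ∧
    (∀ a, |∫ u, F (Fin.cons a u) ∂cubeMeasure k| ≤ 1) ∧
    ∀ a ∈ Set.Icc (0 : ℝ) 1, ∀ b ∈ Set.Icc (0 : ℝ) 1, |a - b| ≤ δ →
      |∫ u, F (Fin.cons a u) ∂cubeMeasure k - ∫ u, F (Fin.cons b u) ∂cubeMeasure k| ≤ ε := by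
  have hcont : ∀ a : ℝ, Continuous fun u : Fin k → ℝ => F (Fin.cons a u) :=
    fun a => h.continuous.comp (by fun_prop)
  have hint : ∀ a : ℝ, Integrable (fun u : Fin k → ℝ => F (Fin.cons a u)) (cubeMeasure k) :=
    fun a => Integrable.of_bound (hcont a).aestronglyMeasurable 1
      (Eventually.of_forall fun u => h.bound _)
  refine ⟨?_, fun a => ?_, fun a ha b hb hab => ?_⟩
  · refine continuous_of_dominated (bound := fun _ => 1)
      (fun a => (hcont a).aestronglyMeasurable) (fun a => Eventually.of_forall fun u => h.bound _)
      (integrable_const _) (Eventually.of_forall fun u => h.continuous.comp (by fun_prop))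
  · have := norm_integral_le_of_norm_le_const (μ := cubeMeasure k) (C := 1)
      (f := fun u => F (Fin.cons a u)) (Eventually.of_forall fun u => h.bound (Fin.cons a u))
    simpa using this
  · rw [← integral_sub (hint a) (hint b)]
    have := norm_integral_le_of_norm_le_const (μ := cubeMeasure k) (C := ε)
      (f := fun u => F (Fin.cons a u) - F (Fin.cons b u)) (by
        filter_upwards [ae_mem_cube k] with u hu
        refine h.close _ _ ?_ ?_ ?_ <;> intro i <;> refine Fin.cases ?_ (fun i => ?_) i
        · exact ha
        · exact hu i
        · exact hb
        · exact hu i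
        · exact hab
        · simpa using hδ)
    simpa using this

/-- The weights `primeWeight x p`, placed at `log p / log x`, are asymptotically uniform. -/
lemma sum_primeWeight_comp_log : ∃ C : ℝ, 1 ≤ C ∧ ∀ ε δ : ℝ, 0 < ε → 0 < δ →
    ∃ X : ℝ, 1 ≤ X ∧ ∀ x : ℝ, X ≤ x → ∀ G : ℝ → ℝ, Continuous G → (∀ a, |G a| ≤ 1) →
      (∀ a ∈ Set.Icc (0 : ℝ) 1, ∀ b ∈ Set.Icc (0 : ℝ) 1, |a - b| ≤ δ → |G a - G b| ≤ ε) →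
      |∑ p ∈ ⌊x⌋₊.primesLE, primeWeight x p * G (Real.log p / Real.log x) -
        ∫ a in Set.Icc (0 : ℝ) 1, G a| ≤ C * ε := by
  obtain ⟨C, hC0, hC⟩ := mertens
  obtain ⟨C₁, hC₁, hm⟩ := sum_primeWeight_bounded
  refine ⟨C₁ + 2, by linarith, fun ε δ hε hδ => ?_⟩
  obtain ⟨n, hn0, hn⟩ : ∃ n : ℕ, 0 < n ∧ 1 / (n : ℝ) ≤ δ := by
    obtain ⟨n, hn⟩ := exists_nat_one_div_lt hδ
    exact ⟨n + 1, n.succ_pos, by push_cast; exact hn.le⟩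
  have hn' : (0 : ℝ) < n := by exact_mod_cast hn0
  obtain ⟨X₂, hX₂⟩ := (Filter.eventually_atTop).mp
    (Real.tendsto_log_atTop.eventually_ge_atTop (n * (2 * C) / ε + 1))
  refine ⟨max X₂ 2, le_max_of_le_right (by norm_num), fun x hx G hG hb hclose => ?_⟩
  have hx2 : 2 ≤ x := (le_max_right _ _).trans hx
  have hx0 : 0 < x := by linarith
  have hx1 : 1 ≤ x := by linarith
  have hlx0 : 0 < Real.log x := Real.log_pos (by linarith)
  have hlx := hX₂ x ((le_max_left _ _).trans hx)
  -- Riemann sum: the primes in `P (i + 1) \ P i` have log p/log x in the i-th of n equal cells, and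
  -- by Mertens their weight is 1/n + O(1/log x).
  set P : ℕ → Finset ℕ := fun i => ⌊x ^ ((i : ℝ) / n)⌋₊.primesLE with hP
  have hPmono : ∀ i, P i ⊆ P (i + 1) := fun i => by
    refine Nat.primesLE_mono (Nat.floor_mono (Real.rpow_le_rpow_of_exponent_le hx1 ?_))
    gcongr; simp
  have hPn : P n = ⌊x⌋₊.primesLE := by simp [hP, hn'.ne']
  have hP0 : P 0 = ∅ := by simp [hP]
  have hsplit : ∀ φ : ℕ → ℝ, ∑ p ∈ ⌊x⌋₊.primesLE, φ p =
      ∑ i ∈ Finset.range n, ∑ p ∈ P (i + 1) \ P i, φ p := fun φ => by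
    simp_rw [Finset.sum_sdiff_eq_sub (hPmono _)]
    rw [Finset.sum_range_sub (fun i => ∑ p ∈ P i, φ p), hPn, hP0]
    simp
  have hmass : ∀ i, |∑ p ∈ P (i + 1) \ P i, primeWeight x p - 1 / n| ≤ 2 * C / Real.log x := by
    intro i
    rw [sum_primeWeight, Finset.sum_sdiff_eq_sub (hPmono i)]
    have h1 := hC (x ^ (((i + 1 : ℕ) : ℝ) / n)) (Real.one_le_rpow hx1 (by positivity))
    have h2 := hC (x ^ ((i : ℝ) / n)) (Real.one_le_rpow hx1 (by positivity))
    rw [Real.log_rpow hx0] at h1 h2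
    have e : (∑ p ∈ P (i + 1), Real.log p / p - ∑ p ∈ P i, Real.log p / p) / Real.log x - 1 / n =
        ((∑ p ∈ P (i + 1), Real.log p / p - ((i + 1 : ℕ) : ℝ) / n * Real.log x) -
          (∑ p ∈ P i, Real.log p / p - (i : ℝ) / n * Real.log x)) / Real.log x := by
      push_cast
      field_simp
      ring
    rw [e, abs_div, abs_of_pos hlx0]
    gcongr
    refine (abs_sub _ _).trans ?_
    simp only [hP] at *
    linarith
  have hint : ∫ a in Set.Icc (0 : ℝ) 1, G a =
      ∑ i ∈ Finset.range n, ∫ a in ((i : ℝ) / n)..(((i + 1 : ℕ) : ℝ) / n), G a := by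
    rw [intervalIntegral.sum_integral_adjacent_intervals (a := fun i : ℕ => (i : ℝ) / n)
      (fun i _ => hG.intervalIntegrable _ _), integral_Icc_eq_integral_Ioc,
      ← intervalIntegral.integral_of_le zero_le_one]
    simp [hn'.ne']
  have hgrid : ∀ i ∈ Finset.range n, (i : ℝ) / n ∈ Set.Icc (0 : ℝ) 1 ∧
      ((i + 1 : ℕ) : ℝ) / n ≤ 1 := by
    intro i hi
    have : ((i + 1 : ℕ) : ℝ) ≤ n := by exact_mod_cast Finset.mem_range.mp hi
    have h2 : ((i + 1 : ℕ) : ℝ) / n ≤ 1 := div_le_one_of_le₀ this hn'.le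
    refine ⟨⟨by positivity, le_trans ?_ h2⟩, h2⟩
    gcongr; simp
  have hterm : ∀ i ∈ Finset.range n,
      |∑ p ∈ P (i + 1) \ P i, primeWeight x p * G (Real.log p / Real.log x) -
        ∫ a in ((i : ℝ) / n)..(((i + 1 : ℕ) : ℝ) / n), G a| ≤
      (∑ p ∈ P (i + 1) \ P i, primeWeight x p) * ε + 2 * C / Real.log x + 1 / n * ε := by
    intro i hi
    obtain ⟨hi1, hi2⟩ := hgrid i hi
    have hstep : ((i + 1 : ℕ) : ℝ) / n = (i : ℝ) / n + 1 / n := by push_cast; ring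
    have a1 : |∑ p ∈ P (i + 1) \ P i, primeWeight x p * G (Real.log p / Real.log x) -
        (∑ p ∈ P (i + 1) \ P i, primeWeight x p) * G ((i : ℝ) / n)| ≤
        (∑ p ∈ P (i + 1) \ P i, primeWeight x p) * ε := by
      rw [Finset.sum_mul, ← Finset.sum_sub_distrib, Finset.sum_mul]
      refine (Finset.abs_sum_le_sum_abs _ _).trans (Finset.sum_le_sum fun p hp => ?_)
      rw [← mul_sub, abs_mul, abs_of_nonneg (primeWeight_nonneg hx1 p)]
      refine mul_le_mul_of_nonneg_left ?_ (primeWeight_nonneg hx1 p)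
      rw [Finset.mem_sdiff] at hp
      obtain ⟨hp1, hp2⟩ := hp
      rw [primesLE_floor_mem (by positivity)] at hp1 hp2
      have hp0 : (0 : ℝ) < p := by exact_mod_cast hp1.2.pos
      have b1 : Real.log p / Real.log x ≤ ((i + 1 : ℕ) : ℝ) / n := by
        rw [div_le_iff₀ hlx0, ← Real.log_rpow hx0]
        exact Real.log_le_log hp0 hp1.1
      have b2 : (i : ℝ) / n ≤ Real.log p / Real.log x := by
        rw [le_div_iff₀ hlx0, ← Real.log_rpow hx0]
        refine Real.log_le_log (by positivity) ?_
        by_contra hcon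
        exact hp2 ⟨(not_le.mp hcon).le, hp1.2⟩
      refine hclose _ ⟨hi1.1.trans b2, b1.trans hi2⟩ _ hi1 ?_
      rw [abs_of_nonneg (by linarith)]
      linarith
    have a2 : |(∑ p ∈ P (i + 1) \ P i, primeWeight x p) * G ((i : ℝ) / n) -
        1 / n * G ((i : ℝ) / n)| ≤ 2 * C / Real.log x := by
      rw [← sub_mul, abs_mul]
      have := mul_le_mul (hmass i) (hb ((i : ℝ) / n)) (abs_nonneg _) (by positivity)
      linarith
    have a3 : |1 / n * G ((i : ℝ) / n) -
        ∫ a in ((i : ℝ) / n)..(((i + 1 : ℕ) : ℝ) / n), G a| ≤ 1 / n * ε := by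
      have e : 1 / n * G ((i : ℝ) / n) =
          ∫ a in ((i : ℝ) / n)..(((i + 1 : ℕ) : ℝ) / n), G ((i : ℝ) / n) := by
        rw [intervalIntegral.integral_const, hstep]; simp
      rw [e, ← intervalIntegral.integral_sub (by simp) (hG.intervalIntegrable _ _)]
      have := intervalIntegral.norm_integral_le_of_norm_le_const (a := (i : ℝ) / n)
        (b := ((i + 1 : ℕ) : ℝ) / n) (C := ε) (f := fun a => G ((i : ℝ) / n) - G a) ?_
      · rw [hstep] at this ⊢
        rw [Real.norm_eq_abs] at this
        refine this.trans (le_of_eq ?_)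
        rw [add_sub_cancel_left, abs_of_pos (by positivity)]
        ring
      · intro a ha
        rw [Set.uIoc_of_le (by rw [hstep]; simp)] at ha
        refine hclose _ hi1 _ ⟨hi1.1.trans ha.1.le, ha.2.trans hi2⟩ ?_
        have := ha.1
        have := ha.2
        rw [abs_le]; constructor <;> linarith
    rw [abs_le] at a1 a2 a3 ⊢
    constructor <;> linarith [a1.1, a2.1, a3.1, a1.2, a2.2, a3.2]
  rw [hsplit, hint, ← Finset.sum_sub_distrib]
  refine (Finset.abs_sum_le_sum_abs _ _).trans ((Finset.sum_le_sum hterm).trans ?_)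
  rw [Finset.sum_add_distrib, Finset.sum_add_distrib, ← Finset.sum_mul, ← hsplit]
  simp only [Finset.sum_const, Finset.card_range, nsmul_eq_mul]
  have c1 : (∑ p ∈ ⌊x⌋₊.primesLE, primeWeight x p) * ε ≤ C₁ * ε :=
    mul_le_mul_of_nonneg_right (hm x hx1) hε.le
  have c2 : (n : ℝ) * (2 * C / Real.log x) ≤ ε := by
    rw [← mul_div_assoc, div_le_iff₀ hlx0]
    have : n * (2 * C) / ε ≤ Real.log x := by linarith
    rw [div_le_iff₀ hε] at this; linarith
  have c3 : (n : ℝ) * (1 / n * ε) = ε := by field_simp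
  rw [c3]
  linarith

/-- The stick-breaking coordinates of a tuple of primes at height `x`. -/
noncomputable def uCoord : (k : ℕ) → ℝ → (Fin k → ℕ) → Fin k → ℝ
  | 0, _, _ => Fin.elim0
  | k + 1, x, p => Fin.cons (Real.log (p 0) / Real.log x) (uCoord k (x / p 0) (Fin.tail p))

lemma log_div_log_mem_Icc {x : ℝ} {p : ℕ} (hp : 1 ≤ p) (hpx : (p : ℝ) ≤ x) :
    Real.log p / Real.log x ∈ Set.Icc (0 : ℝ) 1 := by
  have h1 : (1 : ℝ) ≤ p := by exact_mod_cast hp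
  have h2 := Real.log_le_log (by linarith) hpx
  have h3 := Real.log_nonneg h1
  exact ⟨div_nonneg h3 (h3.trans h2), div_le_one_of_le₀ h2 (h3.trans h2)⟩

/-- Induction on the first prime p: the tail lives at height x/p and is replaced by an integral,
which is then averaged over log p/log x. The threshold depends on `F` only through its modulus,
because the function seen by the tail changes with p. -/
lemma sizeBiased_uCoord (k : ℕ) : ∃ C : ℝ, 1 ≤ C ∧ ∀ ε δ : ℝ, 0 < ε → 0 < δ →
    ∃ X : ℝ, 1 ≤ X ∧ ∀ x : ℝ, X ≤ x → ∀ F : (Fin k → ℝ) → ℝ, HasModulus F ε δ →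
      |sizeBiased k x (fun p => F (uCoord k x p)) - ∫ u, F u ∂cubeMeasure k| ≤ C * ε := by
  induction k with
  | zero =>
    refine ⟨1, le_rfl, fun ε δ hε hδ => ⟨1, le_rfl, fun x hx F hF => ?_⟩⟩
    have : ∀ u : Fin 0 → ℝ, F u = F Fin.elim0 := fun u => by congr 1; exact Subsingleton.elim _ _
    simp [sizeBiased, this, hε.le]
  | succ k ih =>
    obtain ⟨C, hC, h⟩ := ih
    obtain ⟨C₁, hC₁, h₁⟩ := sum_primeWeight_comp_log
    obtain ⟨C₂, hC₂, h₂⟩ := sum_primeWeight_mul_small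
    obtain ⟨D, hD, hDb⟩ := sizeBiased_const_bounded k
    refine ⟨C₁ + C₂ * C, by nlinarith, fun ε δ hε hδ => ?_⟩
    obtain ⟨X₀, hX₀, h0⟩ := h ε δ hε hδ
    obtain ⟨X₁, hX₁, h1⟩ := h₁ ε δ hε hδ
    obtain ⟨X₂, hX₂, h2⟩ := h₂ (D * 1 + 1) X₀ (C * ε) (by linarith) hX₀ (by nlinarith)
    refine ⟨max X₁ X₂, le_max_of_le_left hX₁, fun x hx F hF => ?_⟩
    have hx1 : 1 ≤ x := hX₁.trans ((le_max_left _ _).trans hx)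
    have hx0 : 0 < x := by linarith
    obtain ⟨i1, i2, i3⟩ := hasModulus_integral_cons hF hδ.le
    have hA := h1 x ((le_max_left _ _).trans hx) _ i1 i2 i3
    have hB := h2 x ((le_max_right _ _).trans hx) (fun p =>
      sizeBiased k (x / p) (fun q => F (Fin.cons (Real.log p / Real.log x) (uCoord k (x / p) q))) -
        ∫ u, F (Fin.cons (Real.log p / Real.log x) u) ∂cubeMeasure k) ?_ ?_
    · rw [integral_cubeMeasure_succ hF.continuous.measurable hF.bound]
      simp only [mul_sub, Finset.sum_sub_distrib] at hB
      simp only [sizeBiased, uCoord, Fin.cons_zero, Fin.tail_cons]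
      rw [abs_le] at *
      constructor <;> nlinarith [hA.1, hA.2, hB.1, hB.2]
    · intro p hp hpx
      have h1p : 1 ≤ x / p := one_le_div_of_mem_primesLE hx0.le
        ((primesLE_floor_mem hx0.le).mpr ⟨hpx, hp⟩)
      exact (abs_sub _ _).trans (add_le_add
        (sizeBiased_le_of_le hDb h1p zero_le_one fun q _ _ => hF.bound _) (i2 _))
    · intro p hp hpx
      have hp0 : (0 : ℝ) < p := by exact_mod_cast hp.pos
      rw [le_div_iff₀ (by linarith)] at hpx
      have hle : X₀ ≤ x / p := by
        rw [le_div_iff₀ hp0]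
        linarith
      refine h0 _ hle _ (hF.cons hδ.le (log_div_log_mem_Icc hp.one_lt.le ?_))
      nlinarith

/-- Size-biased averages of a continuous function of the stick-breaking coordinates. -/
lemma tendsto_sizeBiased_uCoord {k : ℕ} {F : (Fin k → ℝ) → ℝ} (hF : Continuous F)
    (hb : ∀ u, |F u| ≤ 1) :
    Tendsto (fun x => sizeBiased k x (fun p => F (uCoord k x p))) atTop
      (𝓝 (∫ u, F u ∂cubeMeasure k)) := by
  obtain ⟨C, hC, h⟩ := sizeBiased_uCoord k
  rw [Metric.tendsto_atTop]
  intro ε hε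
  obtain ⟨δ, hδ, hm⟩ := exists_hasModulus hF hb (show 0 < ε / (2 * C) by positivity)
  obtain ⟨X, hX, hx⟩ := h (ε / (2 * C)) δ (by positivity) hδ
  refine ⟨X, fun x hxX => ?_⟩
  have := hx x hxX F hm
  rw [Real.dist_eq]
  refine this.trans_lt ?_
  have : C * (ε / (2 * C)) = ε / 2 := by field_simp
  linarith

/-! ### Counting arguments where a function is near an integer, by differencing. -/

/-- `y` is within `δ` of an integer. -/
def NearInt (δ y : ℝ) : Prop := ∃ z : ℤ, |y - z| ≤ δ

lemma NearInt.neg {δ y : ℝ} (h : NearInt δ y) : NearInt δ (-y) := by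
  obtain ⟨z, hz⟩ := h
  refine ⟨-z, ?_⟩
  rw [← abs_neg]
  push_cast
  convert hz using 2
  ring

lemma NearInt.sub {δ y y' : ℝ} (h : NearInt δ y) (h' : NearInt δ y') :
    NearInt (2 * δ) (y - y') := by
  obtain ⟨z, hz⟩ := h
  obtain ⟨z', hz'⟩ := h'
  refine ⟨z - z', ?_⟩
  rw [abs_le] at *
  push_cast
  constructor <;> linarith [hz.1, hz.2, hz'.1, hz'.2]

lemma NearInt.mono {δ δ' y : ℝ} (h : NearInt δ y) (hδ : δ ≤ δ') : NearInt δ' y := by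
  obtain ⟨z, hz⟩ := h
  exact ⟨z, hz.trans hδ⟩

open scoped Classical in
/-- The arguments in `[a, a + n)` where `f` is within `δ` of an integer. -/
noncomputable def nearSet (δ : ℝ) (f : ℕ → ℝ) (a n : ℕ) : Finset ℕ :=
  (Finset.Ico a (a + n)).filter fun t => NearInt δ (f t)

lemma mem_nearSet {δ : ℝ} {f : ℕ → ℝ} {a n t : ℕ} :
    t ∈ nearSet δ f a n ↔ (a ≤ t ∧ t < a + n) ∧ NearInt δ (f t) := by
  simp [nearSet]

lemma nearSet_subset (δ : ℝ) (f : ℕ → ℝ) (a n : ℕ) : nearSet δ f a n ⊆ Finset.Ico a (a + n) :=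
  fun _ ht => Finset.mem_Ico.mpr (mem_nearSet.mp ht).1

lemma card_nearSet_le (δ : ℝ) (f : ℕ → ℝ) (a n : ℕ) : (nearSet δ f a n).card ≤ n := by
  refine (Finset.card_le_card (nearSet_subset δ f a n)).trans ?_
  simp

/-- An integer attracts at most 2δ/l + 1 arguments, since `f` climbs by at least `l` each step, and
at most Λn + 2δ + 1 integers come within reach. -/
lemma card_nearSet_of_increments {f : ℕ → ℝ} {a n : ℕ} {l Λ δ : ℝ} (hl : 0 < l) (hδ : 0 ≤ δ)
    (hlΛ : l ≤ Λ) (hf : ∀ t, a ≤ t → t < a + n → l ≤ f (t + 1) - f t ∧ f (t + 1) - f t ≤ Λ) :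
    ((nearSet δ f a n).card : ℝ) ≤ (Λ * n + 2 * δ + 1) * (2 * δ / l + 1) := by
  have hinc : ∀ d t, a ≤ t → t + d ≤ a + n → d * l ≤ f (t + d) - f t ∧
      f (t + d) - f t ≤ d * Λ := by
    intro d
    induction d with
    | zero => intro t _ _; simp
    | succ d ih =>
      intro t h1 h2
      have i1 := ih t h1 (by omega)
      have i2 := hf (t + d) (by omega) (by omega)
      rw [← add_assoc]
      push_cast
      constructor <;> linarith [i1.1, i1.2, i2.1, i2.2]
  set B := nearSet δ f a n with hB
  have hround : ∀ t ∈ B, |f t - round (f t)| ≤ δ := fun t ht => by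
    obtain ⟨z, hz⟩ := (mem_nearSet.mp ht).2
    exact (round_le (f t) z).trans hz
  have hfib : ∀ z ∈ B.image (fun t => round (f t)),
      (B.filter fun t => round (f t) = z).card ≤ ⌊2 * δ / l⌋₊ + 1 := by
    intro z hz
    rw [Finset.mem_image] at hz
    obtain ⟨t₁, ht₁, hz₁⟩ := hz
    have hne : (B.filter fun t => round (f t) = z).Nonempty :=
      ⟨t₁, by simp [ht₁, hz₁]⟩
    set t₀ := (B.filter fun t => round (f t) = z).min' hne with ht₀
    have hm := Finset.min'_mem _ hne
    rw [← ht₀, Finset.mem_filter] at hm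
    have hsub : (B.filter fun t => round (f t) = z) ⊆ Finset.Icc t₀ (t₀ + ⌊2 * δ / l⌋₊) := by
      intro t ht
      have hle := Finset.min'_le _ t ht
      rw [← ht₀] at hle
      rw [Finset.mem_filter] at ht
      rw [Finset.mem_Icc]
      refine ⟨hle, ?_⟩
      obtain ⟨d, rfl⟩ := Nat.exists_eq_add_of_le hle
      have b1 := (mem_nearSet.mp ht.1).1
      have b2 := (mem_nearSet.mp hm.1).1
      have := (hinc d t₀ b2.1 (by omega)).1
      have r1 := hround _ ht.1
      have r2 := hround _ hm.1
      rw [ht.2] at r1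
      rw [hm.2] at r2
      rw [abs_le] at r1 r2
      have : d ≤ ⌊2 * δ / l⌋₊ := by
        rw [Nat.le_floor_iff (by positivity), le_div_iff₀ hl]
        linarith [r1.1, r1.2, r2.1, r2.2]
      omega
    refine (Finset.card_le_card hsub).trans ?_
    simp
    omega
  have himg : ((B.image (fun t => round (f t))).card : ℝ) ≤ Λ * n + 2 * δ + 1 := by
    have hsub : B.image (fun t => round (f t)) ⊆
        Finset.Icc ⌈f a - δ⌉ ⌊f a + Λ * n + δ⌋ := by
      intro z hz
      rw [Finset.mem_image] at hz
      obtain ⟨t, ht, rfl⟩ := hz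
      have b1 := (mem_nearSet.mp ht).1
      have r1 := abs_le.mp (hround _ ht)
      obtain ⟨d, rfl⟩ := Nat.exists_eq_add_of_le b1.1
      have hi := hinc d a le_rfl (by omega)
      have hd : (d : ℝ) * Λ ≤ Λ * n := by
        rw [mul_comm]
        have : (d : ℝ) ≤ n := by exact_mod_cast (by omega : d ≤ n)
        have : 0 ≤ Λ := by linarith
        gcongr
      have hd' : 0 ≤ (d : ℝ) * l := by positivity
      rw [Finset.mem_Icc, Int.ceil_le, Int.le_floor]
      constructor <;> linarith [r1.1, r1.2, hi.1, hi.2]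
    have h1 : ((B.image (fun t => round (f t))).card : ℝ) ≤
        ((Finset.Icc ⌈f a - δ⌉ ⌊f a + Λ * n + δ⌋).card : ℝ) := by
      exact_mod_cast Finset.card_le_card hsub
    refine h1.trans ?_
    rw [Int.card_Icc]
    have h0 : 0 ≤ Λ * n := by
      have : 0 ≤ Λ := by linarith
      positivity
    rcases le_total 0 (⌊f a + Λ * n + δ⌋ + 1 - ⌈f a - δ⌉) with h | h
    · have : (((⌊f a + Λ * n + δ⌋ + 1 - ⌈f a - δ⌉).toNat : ℕ) : ℝ) =
          ((⌊f a + Λ * n + δ⌋ + 1 - ⌈f a - δ⌉ : ℤ) : ℝ) := by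
        exact_mod_cast Int.toNat_of_nonneg h
      rw [this]
      push_cast
      linarith [Int.floor_le (f a + Λ * n + δ), Int.le_ceil (f a - δ)]
    · rw [Int.toNat_of_nonpos h]
      simp
      positivity
  have hcard := Finset.card_le_mul_card_image B (⌊2 * δ / l⌋₊ + 1) hfib
  have hcard' : (B.card : ℝ) ≤ (⌊2 * δ / l⌋₊ + 1 : ℕ) *
      ((B.image (fun t => round (f t))).card : ℝ) := by exact_mod_cast hcard
  refine hcard'.trans ?_
  rw [mul_comm]
  push_cast
  have h0 : 0 ≤ 2 * δ / l := by positivity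
  have h1 := Nat.floor_le h0
  have h2 : (0 : ℝ) ≤ ((B.image (fun t => round (f t))).card : ℝ) := Nat.cast_nonneg _
  have h3 : (0 : ℝ) ≤ (⌊2 * δ / l⌋₊ : ℝ) := Nat.cast_nonneg _
  exact mul_le_mul himg (by linarith) (by linarith) (by linarith)

/-- Either many pairs at distance at most `H`, or the set is sparse. -/
lemma card_le_sum_card_shift (B : Finset ℕ) (a n H : ℕ) (hB : B ⊆ Finset.Ico a (a + n))
    (hH : 1 ≤ H) :
    B.card ≤ n / H + 1 + ∑ h ∈ Finset.Icc 1 H, (B.filter fun t => t + h ∈ B).card := by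
  classical
  set B₁ := B.filter fun t => ∃ h ∈ Finset.Icc 1 H, t + h ∈ B
  set B₂ := B.filter fun t => ¬ ∃ h ∈ Finset.Icc 1 H, t + h ∈ B
  have h0 : B₁.card + B₂.card = B.card := Finset.card_filter_add_card_filter_not _
  have h1 : B₁.card ≤ ∑ h ∈ Finset.Icc 1 H, (B.filter fun t => t + h ∈ B).card := by
    refine le_trans (Finset.card_le_card ?_) Finset.card_biUnion_le
    intro t ht
    rw [Finset.mem_filter] at ht
    obtain ⟨htB, h, hh, hth⟩ := ht
    rw [Finset.mem_biUnion]
    exact ⟨h, hh, by simp [htB, hth]⟩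
  have h2 : B₂.card ≤ n / H + 1 := by
    rw [← Finset.card_range (n / H + 1)]
    -- Points without a later point of `B` within distance `H` lie in distinct blocks of length `H`.
    refine Finset.card_le_card_of_injOn (fun t => (t - a) / H) ?_ ?_
    · intro t ht
      have := Finset.mem_Ico.mp (hB (Finset.mem_filter.mp ht).1)
      simp only [Finset.coe_range, Set.mem_Iio]
      exact Nat.lt_succ_of_le (Nat.div_le_div_right (by omega))
    · have key : ∀ t ∈ B₂, ∀ t' ∈ B₂, (t - a) / H = (t' - a) / H → t < t' → False := by
        intro t ht t' ht' heq hlt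
        rw [Finset.mem_filter] at ht ht'
        have b := Finset.mem_Ico.mp (hB ht.1)
        have b' := Finset.mem_Ico.mp (hB ht'.1)
        refine ht.2 ⟨t' - t, ?_, ?_⟩
        · rw [Finset.mem_Icc]
          have e1 := Nat.div_add_mod (t - a) H
          have e2 := Nat.div_add_mod (t' - a) H
          have e3 := Nat.mod_lt (t' - a) (by omega : H > 0)
          rw [heq] at e1
          omega
        · have : t + (t' - t) = t' := by omega
          rw [this]; exact ht'.1
      intro t ht t' ht' heq
      rcases lt_trichotomy t t' with h | h | h
      · exact (key t ht t' ht' heq h).elim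
      · exact h
      · exact (key t' ht' t ht heq.symm h).elim
  omega

/-- A step of length `h` telescopes into `h` unit steps. This turns bounds on the difference of
order r + 1 of f into bounds on the difference of order r of `fwdDiff h f`. -/
lemma fwdDiff_iter_fwdDiff (f : ℕ → ℝ) (r h t : ℕ) :
    (fwdDiff 1)^[r] (fwdDiff h f) t = ∑ i ∈ Finset.range h, (fwdDiff 1)^[r + 1] f (t + i) := by
  have e : fwdDiff h f = ∑ i ∈ Finset.range h, fun s => fwdDiff 1 f (s + i) := by
    funext s
    rw [Finset.sum_apply]
    have := Finset.sum_range_sub (fun i => f (s + i)) h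
    simp only [fwdDiff, add_zero, add_assoc] at this ⊢
    exact this.symm
  rw [e, fwdDiff_iter_finsetSum, Finset.sum_apply]
  refine Finset.sum_congr rfl fun i _ => ?_
  rw [fwdDiff_iter_comp_add, Function.iterate_succ_apply]

set_option maxHeartbeats 800000 in
/-- A function whose difference of order `r + 1` is small but not tiny is rarely near an
integer. -/
lemma card_nearSet_of_fwdDiff (r : ℕ) (C : ℝ) (hC : 1 ≤ C) :
    ∃ K γ : ℝ, 0 < K ∧ 0 < γ ∧ ∀ Q Y l δ : ℝ, 1 ≤ Q → 0 < l → C * l ≤ 1 / Q → Q ≤ l * Y →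
      0 ≤ δ → δ ≤ 1 / Q → ∀ (f : ℕ → ℝ) (a n : ℕ), (n : ℝ) ≤ Y →
      (∀ t, a ≤ t → t < a + n → l ≤ (fwdDiff 1)^[r + 1] f t ∧ (fwdDiff 1)^[r + 1] f t ≤ C * l) →
      ((nearSet δ f a n).card : ℝ) ≤ K * Y * Q ^ (-γ) := by
  induction r with
  | zero =>
    refine ⟨8 * C + 4, 1, by linarith, one_pos, ?_⟩
    intro Q Y l δ hQ hl hCl hlY hδ hδQ f a n hnY hf
    have hQ0 : 0 < Q := by linarith
    have hY : 0 < Y := by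
      have : 0 < l * Y := by linarith
      exact pos_of_mul_pos_right this hl.le
    have hlC : l ≤ C * l := by nlinarith
    have h := card_nearSet_of_increments (f := f) (a := a) (n := n) hl hδ hlC (by
      simpa [fwdDiff] using hf)
    refine h.trans ?_
    rw [Real.rpow_neg_one]
    have hQ1 : 1 / Q ≤ 1 := by rw [div_le_one hQ0]; exact hQ
    have h1 : C * l * n + 2 * δ + 1 ≤ 4 * (C * l * Y) := by
      have a1 : C * l * n ≤ C * l * Y := by gcongr
      have a2 : 1 ≤ C * l * Y := by nlinarith
      linarith
    calc (C * l * n + 2 * δ + 1) * (2 * δ / l + 1) ≤ 4 * (C * l * Y) * (2 * δ / l + 1) := by gcongr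
      _ = 8 * C * Y * δ + 4 * Y * (C * l) := by field_simp; ring
      _ ≤ 8 * C * Y * (1 / Q) + 4 * Y * (1 / Q) := by gcongr
      _ = _ := by rw [one_div]; ring
  | succ r ih =>
    obtain ⟨K, γ, hK, hγ, h⟩ := ih
    -- If t and t + b are both near integers, so is the b-step difference at t, to which the
    -- inductive estimate applies with √Q in place of Q. With shifts up to H ≈ Q^σ, isolated points
    -- cost Y·Q^(-σ) and pairs cost about Q^σ·Q^(-γ/2), at most Q^(-σ) since σ ≤ γ/4. The condition
    -- σ ≤ 1/4 keeps H ≤ √Q.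
    set σ := min γ 1 / 4 with hσ
    have hm0 : 0 < min γ 1 := lt_min hγ one_pos
    have hσ0 : 0 < σ := by positivity
    have hσ1 : σ ≤ 1 / 4 := by rw [hσ]; linarith [min_le_right γ 1]
    have hσγ : σ ≤ γ / 4 := by rw [hσ]; linarith [min_le_left γ 1]
    refine ⟨2 + 2 * K + 16, σ, by linarith, hσ0, ?_⟩
    intro Q Y l δ hQ hl hCl hlY hδ hδQ f a n hnY hf
    have hQ0 : 0 < Q := by linarith
    have hY : 0 < Y := by
      have : 0 < l * Y := by linarith
      exact pos_of_mul_pos_right this hl.le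
    -- For Q < 16 the trivial count suffices, as Q^(-σ) ≥ 1/16; this is the summand 16 in the
    -- constant. For larger Q the factor Q^(1/4) ≥ 2 absorbs the rounding of H.
    rcases lt_or_ge Q 16 with hQ16 | hQ16
    · have h1 : ((nearSet δ f a n).card : ℝ) ≤ Y :=
        le_trans (by exact_mod_cast card_nearSet_le δ f a n) hnY
      have h2 : (1 : ℝ) / 16 ≤ Q ^ (-σ) := by
        have a1 : Q ^ (-(1 : ℝ)) ≤ Q ^ (-σ) :=
          Real.rpow_le_rpow_of_exponent_le hQ (by linarith)
        rw [Real.rpow_neg_one] at a1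
        refine le_trans ?_ a1
        rw [← one_div]
        exact one_div_le_one_div_of_le hQ0 hQ16.le
      have h3 : 0 ≤ (2 + 2 * K) * Y := by positivity
      nlinarith [mul_le_mul_of_nonneg_left h2 hY.le, mul_le_mul_of_nonneg_left h2 h3]
    have hQσ : 1 ≤ Q ^ σ := Real.one_le_rpow hQ hσ0.le
    set H := ⌈Q ^ σ⌉₊ with hH
    have hH1 : 1 ≤ H := by
      rw [hH, Nat.one_le_ceil_iff]; linarith
    have hHle : (H : ℝ) ≤ 2 * Q ^ σ := by
      have := (Nat.ceil_lt_add_one (by linarith : 0 ≤ Q ^ σ)).le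
      linarith
    have hHge : Q ^ σ ≤ H := Nat.le_ceil _
    have hQ4 : 2 ≤ Q ^ (1 / 4 : ℝ) := by
      have : (16 : ℝ) ^ (1 / 4 : ℝ) = 2 := by
        rw [show (16 : ℝ) = 2 ^ (4 : ℝ) by norm_num, ← Real.rpow_mul (by norm_num)]; norm_num
      rw [← this]
      exact Real.rpow_le_rpow (by norm_num) hQ16 (by norm_num)
    set Q' := Q ^ (1 / 2 : ℝ) with hQ'
    have hQ'1 : 1 ≤ Q' := Real.one_le_rpow hQ (by norm_num)
    have hQ'sq : Q' * Q' = Q := by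
      rw [hQ', ← Real.rpow_add hQ0]; norm_num
    have hQ4sq : Q ^ (1 / 4 : ℝ) * Q ^ (1 / 4 : ℝ) = Q' := by
      rw [hQ', ← Real.rpow_add hQ0]; norm_num
    have hQσ4 : Q ^ σ ≤ Q ^ (1 / 4 : ℝ) := Real.rpow_le_rpow_of_exponent_le hQ hσ1
    have hHQ' : (H : ℝ) ≤ Q' := by nlinarith
    have hinv : Q' * (1 / Q) = 1 / Q' := by
      rw [← hQ'sq]; field_simp
    have hQ'2 : 2 ≤ Q' := by nlinarith
    have hfib : ∀ b ∈ Finset.Icc 1 H,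
        (((nearSet δ f a n).filter fun t => t + b ∈ nearSet δ f a n).card : ℝ) ≤
          K * Y * Q' ^ (-γ) := by
      intro b hb
      rw [Finset.mem_Icc] at hb
      have hb1 : (1 : ℝ) ≤ b := by exact_mod_cast hb.1
      have hbH : (b : ℝ) ≤ H := by exact_mod_cast hb.2
      have hsub : ((nearSet δ f a n).filter fun t => t + b ∈ nearSet δ f a n) ⊆
          nearSet (2 * δ) (fwdDiff b f) a (n - b) := by
        intro t ht
        rw [Finset.mem_filter, mem_nearSet, mem_nearSet] at ht
        rw [mem_nearSet]
        refine ⟨by omega, ht.2.2.sub ht.1.2⟩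
      have hcard : (((nearSet δ f a n).filter fun t => t + b ∈ nearSet δ f a n).card : ℝ) ≤
          (nearSet (2 * δ) (fwdDiff b f) a (n - b)).card := by
        exact_mod_cast Finset.card_le_card hsub
      refine hcard.trans (h Q' Y (b * l) (2 * δ) hQ'1 (by positivity) ?_ ?_ (by positivity) ?_
        _ _ _ ?_ ?_)
      · calc C * (b * l) = b * (C * l) := by ring
          _ ≤ Q' * (1 / Q) := by
            have : 0 ≤ C * l := by positivity
            gcongr
            exact hbH.trans hHQ'
          _ = _ := hinv
      · calc Q' ≤ Q := by nlinarith
          _ ≤ l * Y := hlY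
          _ ≤ b * l * Y := by nlinarith [mul_pos hl hY]
      · calc 2 * δ ≤ Q' * (1 / Q) := by gcongr
          _ = _ := hinv
      · refine le_trans ?_ hnY
        exact_mod_cast Nat.sub_le n b
      · intro t ht1 ht2
        rw [fwdDiff_iter_fwdDiff]
        have hterm : ∀ i ∈ Finset.range b, l ≤ (fwdDiff 1)^[r + 1 + 1] f (t + i) ∧
            (fwdDiff 1)^[r + 1 + 1] f (t + i) ≤ C * l := fun i hi => by
          rw [Finset.mem_range] at hi
          exact hf (t + i) (by omega) (by omega)
        constructor
        · have := Finset.card_nsmul_le_sum (Finset.range b) _ l fun i hi => (hterm i hi).1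
          simpa using this
        · have := Finset.sum_le_card_nsmul (Finset.range b) _ (C * l) fun i hi => (hterm i hi).2
          rw [Finset.card_range, nsmul_eq_mul] at this
          linarith
    have hmain := card_le_sum_card_shift (nearSet δ f a n) a n H
      (nearSet_subset δ f a n) hH1
    have hmain' : ((nearSet δ f a n).card : ℝ) ≤ ((n / H : ℕ) : ℝ) + 1 +
        ∑ b ∈ Finset.Icc 1 H,
          (((nearSet δ f a n).filter fun t => t + b ∈ nearSet δ f a n).card : ℝ) := by
      have := (Nat.cast_le (α := ℝ)).mpr hmain
      rwa [Nat.cast_add, Nat.cast_add, Nat.cast_one, Nat.cast_sum] at this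
    have hsum := Finset.sum_le_sum hfib
    rw [Finset.sum_const, Nat.card_Icc, nsmul_eq_mul, Nat.add_sub_cancel] at hsum
    have hQneg : Q ^ (-σ) * Q ^ σ = 1 := by
      rw [← Real.rpow_add hQ0, neg_add_cancel, Real.rpow_zero]
    have hQneg0 : 0 < Q ^ (-σ) := by positivity
    have b1 : ((n / H : ℕ) : ℝ) ≤ Y * Q ^ (-σ) := by
      refine Nat.cast_div_le.trans ?_
      rw [div_le_iff₀ (by linarith)]
      calc (n : ℝ) ≤ Y := hnY
        _ = Y * (Q ^ (-σ) * Q ^ σ) := by rw [hQneg, mul_one]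
        _ ≤ Y * (Q ^ (-σ) * H) := by gcongr
        _ = _ := by ring
    have b2 : 1 ≤ Y * Q ^ (-σ) := by
      have c1 : Q ≤ Y := by
        have : l ≤ 1 := by
          have : 1 / Q ≤ 1 := by rw [div_le_one hQ0]; exact hQ
          nlinarith
        nlinarith
      have c2 : Q ^ σ ≤ Q := by
        calc Q ^ σ ≤ Q ^ (1 : ℝ) := Real.rpow_le_rpow_of_exponent_le hQ (by linarith)
          _ = Q := Real.rpow_one Q
      calc (1 : ℝ) = Q ^ (-σ) * Q ^ σ := hQneg.symm
        _ ≤ Q ^ (-σ) * Y := by gcongr; exact c2.trans c1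
        _ = _ := by ring
    have b3 : (H : ℝ) * (K * Y * Q' ^ (-γ)) ≤ 2 * K * Y * Q ^ (-σ) := by
      have c1 : Q' ^ (-γ) = Q ^ (-(γ / 2)) := by
        rw [hQ', ← Real.rpow_mul hQ0.le]; congr 1; ring
      have c2 : Q ^ σ * Q ^ (-(γ / 2)) ≤ Q ^ (-σ) := by
        rw [← Real.rpow_add hQ0]
        exact Real.rpow_le_rpow_of_exponent_le hQ (by linarith)
      rw [c1]
      calc (H : ℝ) * (K * Y * Q ^ (-(γ / 2))) ≤ 2 * Q ^ σ * (K * Y * Q ^ (-(γ / 2))) := by gcongr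
        _ = 2 * K * Y * (Q ^ σ * Q ^ (-(γ / 2))) := by ring
        _ ≤ _ := by gcongr
    have b4 : 0 ≤ 16 * Y * Q ^ (-σ) := by positivity
    nlinarith

/-! ### Differences of rational phases. -/

/-- Iterated mean value theorem: the induction replaces the whole family of derivatives by its unit
increments. -/
lemma fwdDiff_iter_mem_Icc (r : ℕ) : ∀ (F : ℕ → ℝ → ℝ) (t : ℕ) (l Λ : ℝ), 0 < t →
    (∀ i x, 0 < x → HasDerivAt (F i) (F (i + 1) x) x) →
    (∀ x : ℝ, (t : ℝ) ≤ x → x ≤ t + r → F r x ∈ Set.Icc l Λ) →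
    (fwdDiff 1)^[r] (fun n : ℕ => F 0 n) t ∈ Set.Icc l Λ := by
  induction r with
  | zero => intro F t l Λ _ _ h; simpa using h t le_rfl (by simp)
  | succ r ih =>
    intro F t l Λ ht hd h
    have ht0 : (0 : ℝ) < t := by exact_mod_cast ht
    have hshift : ∀ i x, 0 < x →
        HasDerivAt (fun x => F i (x + 1) - F i x) (F (i + 1) (x + 1) - F (i + 1) x) x := by
      intro i x hx
      exact ((hd i (x + 1) (by linarith)).comp_add_const x 1).sub (hd i x hx)
    have := ih (fun i x => F i (x + 1) - F i x) t l Λ ht hshift ?_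
    · rw [Function.iterate_succ_apply]
      have e : fwdDiff 1 (fun n : ℕ => F 0 n) = fun n : ℕ => F 0 ((n : ℝ) + 1) - F 0 n := by
        funext n
        simp [fwdDiff]
      rw [e]
      exact this
    · intro x hx1 hx2
      have hx0 : 0 < x := by linarith
      obtain ⟨c, hc, hc'⟩ := exists_hasDerivAt_eq_slope (F r) (F (r + 1)) (lt_add_one x)
        (fun y hy => (hd r y (by linarith [hy.1])).continuousAt.continuousWithinAt)
        (fun y hy => hd r y (by linarith [hy.1]))
      simp only [add_sub_cancel_left, div_one] at hc'
      rw [← hc']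
      refine h c (by linarith [hc.1]) ?_
      push_cast
      linarith [hc.2]

/-- The r-th derivative of x^(-s) is (-1)^r s(s+1)⋯(s+r-1) x^(-s-r), monotone in absolute value, so
its extremes on [t, t + r] are at the endpoints. -/
lemma fwdDiff_iter_inv_pow {s r t : ℕ} (ht : 0 < t) :
    (-1) ^ r * (fwdDiff 1)^[r] (fun n : ℕ => ((n : ℝ) ^ s)⁻¹) t ∈
      Set.Icc ((s.ascFactorial r : ℝ) * (((t : ℝ) + r) ^ (s + r))⁻¹)
        ((s.ascFactorial r : ℝ) * ((t : ℝ) ^ (s + r))⁻¹) := by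
  have ht0 : (0 : ℝ) < t := by exact_mod_cast ht
  have h := fwdDiff_iter_mem_Icc r
    (fun i x => (-1) ^ r * ((-1) ^ i * (s.ascFactorial i : ℝ) * (x ^ (s + i))⁻¹)) t
    ((s.ascFactorial r : ℝ) * (((t : ℝ) + r) ^ (s + r))⁻¹)
        ((s.ascFactorial r : ℝ) * ((t : ℝ) ^ (s + r))⁻¹) ht ?_ ?_
  · have e : (fun n : ℕ => (-1 : ℝ) ^ r * ((-1) ^ 0 * (s.ascFactorial 0 : ℝ) *
        (((n : ℕ) : ℝ) ^ (s + 0))⁻¹)) = ((-1 : ℝ) ^ r) • fun n : ℕ => ((n : ℝ) ^ s)⁻¹ := by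
      funext n; simp
    rw [e, fwdDiff_iter_const_smul] at h
    simpa using h
  · intro i x hx
    have h1 := (((hasDerivAt_pow (s + i) x).fun_inv (by positivity)).const_mul
      ((-1 : ℝ) ^ i * (s.ascFactorial i : ℝ))).const_mul ((-1 : ℝ) ^ r)
    refine h1.congr_deriv ?_
    · rw [Nat.ascFactorial_succ]
      push_cast
      rcases Nat.eq_zero_or_pos (s + i) with h0 | h0
      · have : s = 0 ∧ i = 0 := by omega
        simp [this.1, this.2]
      · obtain ⟨m, hm⟩ := Nat.exists_eq_add_of_lt h0
        have hm' : s + i = m + 1 := by omega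
        have e2 : (s : ℝ) + i = m + 1 := by exact_mod_cast hm'
        rw [show s + (i + 1) = m + 2 by omega, hm', e2]
        push_cast
        field_simp
        ring
  · intro x hx1 hx2
    have hx0 : 0 < x := by linarith
    have e : (-1 : ℝ) ^ r * ((-1) ^ r * (s.ascFactorial r : ℝ) * (x ^ (s + r))⁻¹) =
        (s.ascFactorial r : ℝ) * (x ^ (s + r))⁻¹ := by
      rw [← mul_assoc, ← mul_assoc, ← mul_pow]; simp
    simp only [e]
    constructor <;> gcongr

lemma fwdDiff_iter_const_zero (m : ℕ) (c : ℝ) : (fwdDiff 1)^[m + 1] (fun _ : ℕ => c) = 0 := by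
  induction m with
  | zero => funext t; simp [fwdDiff]
  | succ m ih =>
    rw [Function.iterate_succ_apply', ih]
    funext t; simp [fwdDiff]

lemma abs_fwdDiff_iter_linear (A : ℝ) (r t : ℕ) (hr : 1 ≤ r) :
    |(fwdDiff 1)^[r] (fun n : ℕ => A * (n : ℝ)) t| ≤ if r = 1 then |A| else 0 := by
  have e : fwdDiff 1 (fun n : ℕ => A * (n : ℝ)) = fun _ => A := by
    funext n; simp [fwdDiff]; ring
  obtain ⟨m, rfl⟩ := Nat.exists_eq_add_of_le' hr
  rw [Function.iterate_succ_apply, e]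
  cases m with
  | zero => simp
  | succ m => rw [fwdDiff_iter_const_zero]; simp

lemma nearSet_neg (δ : ℝ) (f : ℕ → ℝ) (a n : ℕ) :
    nearSet δ (fun t => -f t) a n = nearSet δ f a n := by
  ext t
  rw [mem_nearSet, mem_nearSet]
  refine and_congr_right fun _ => ⟨fun h => ?_, fun h => h.neg⟩
  simpa using h.neg

lemma one_le_ascFactorial_succ (j r : ℕ) : 1 ≤ (j + 1).ascFactorial r :=
  Nat.ascFactorial_pos _ _

/-- Derivative estimates for `A t + ∑ b_j t^{-(j+1)}` dominated by the term `j₀`. -/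
lemma fwdDiff_iter_rational_bounds {r J : ℕ} (hr : 1 ≤ r) {H : ℝ} (hH : 0 ≤ H)
    {Pp A S c₀ : ℝ} {b : ℕ → ℝ} {j₀ y t : ℕ}
    (hS : S = ∑ j ∈ Finset.range J, ((j + 1).ascFactorial r : ℝ))
    (hc₀ : c₀ = ((4 : ℝ) ^ (J + r))⁻¹)
    (hPp : 0 < Pp) (hj₀ : j₀ < J) (hb0 : ∀ j < j₀, b j = 0) (hbj : Pp ≤ |b j₀|)
    (hbH : ∀ j < J, |b j| ≤ H * Pp) (hry : r ≤ y) (hy : 4 * (H * S) / c₀ ≤ y) (hy1 : 1 ≤ y)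
    (hA : |A| ≤ c₀ / 4 * (Pp / y ^ (j₀ + 2))) (ht : y ≤ t) (ht2 : t < y + y)
    {s : ℝ} (hs : s * b j₀ = |b j₀|) (hs1 : |s| = 1) :
    c₀ / 2 * (Pp / y ^ (j₀ + 1 + r)) ≤ (fwdDiff 1)^[r] (fun t : ℕ =>
      ((-1) ^ r * s) * (A * t + ∑ j ∈ Finset.range J, b j * ((t : ℝ) ^ (j + 1))⁻¹)) t ∧
    (fwdDiff 1)^[r] (fun t : ℕ =>
      ((-1) ^ r * s) * (A * t + ∑ j ∈ Finset.range J, b j * ((t : ℝ) ^ (j + 1))⁻¹)) t ≤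
      (H * S + 1) * (Pp / y ^ (j₀ + 1 + r)) := by
  have hy0 : (0 : ℝ) < y := by exact_mod_cast hy1
  have hy1' : (1 : ℝ) ≤ y := by exact_mod_cast hy1
  have hc₀0 : 0 < c₀ := by rw [hc₀]; positivity
  have hc₀1 : c₀ ≤ 1 := by rw [hc₀]; exact inv_le_one_of_one_le₀ (one_le_pow₀ (by norm_num))
  set μ := Pp / (y : ℝ) ^ (j₀ + 1 + r) with hμ
  have hμ0 : 0 < μ := by positivity
  set D : ℕ → ℝ := fun j => (-1) ^ r * (fwdDiff 1)^[r] (fun n : ℕ => ((n : ℝ) ^ (j + 1))⁻¹) t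
    with hD
  have htpos : 0 < t := by omega
  have hDb : ∀ j, D j ∈ Set.Icc (((j + 1).ascFactorial r : ℝ) * (((t : ℝ) + r) ^ (j + 1 + r))⁻¹)
        (((j + 1).ascFactorial r : ℝ) * ((t : ℝ) ^ (j + 1 + r))⁻¹) := fun j =>
    fwdDiff_iter_inv_pow htpos
  set E := (fwdDiff 1)^[r] (fun n : ℕ => A * (n : ℝ)) t with hE
  have hexp : (fwdDiff 1)^[r] (fun t : ℕ =>
      ((-1) ^ r * s) * (A * t + ∑ j ∈ Finset.range J, b j * ((t : ℝ) ^ (j + 1))⁻¹)) t =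
      (-1) ^ r * s * E + ∑ j ∈ Finset.range J, s * b j * D j := by
    have e : (fun t : ℕ => ((-1) ^ r * s) * (A * t + ∑ j ∈ Finset.range J,
        b j * ((t : ℝ) ^ (j + 1))⁻¹)) = ((-1 : ℝ) ^ r * s) • ((fun n : ℕ => A * (n : ℝ)) +
          ∑ j ∈ Finset.range J, (b j) • fun n : ℕ => ((n : ℝ) ^ (j + 1))⁻¹) := by
      funext n
      simp [Finset.sum_apply]
    rw [e, fwdDiff_iter_const_smul, fwdDiff_iter_add, fwdDiff_iter_finsetSum]
    simp only [fwdDiff_iter_const_smul, Pi.smul_apply, Pi.add_apply, Finset.sum_apply,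
      smul_eq_mul, mul_add, Finset.mul_sum]
    congr 1
    refine Finset.sum_congr rfl fun j _ => ?_
    simp only [hD]; ring
  -- The linear term survives only the first difference, and for r = 1 the hypothesis on `A` is
  -- exactly this bound.
  have hEb : |(-1) ^ r * s * E| ≤ c₀ / 4 * μ := by
    rw [abs_mul, abs_mul, hs1, abs_pow, abs_neg, abs_one, one_pow, one_mul, one_mul]
    refine (abs_fwdDiff_iter_linear A r t hr).trans ?_
    split_ifs with h1
    · subst h1
      exact hA
    · positivity
  have hyt : (y : ℝ) ≤ t := by exact_mod_cast ht
  -- Terms below `j₀` vanish. Each term above gains a factor 1/y, which beats the constants once y ≥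
  -- 4HS/c₀.
  have hrest : |∑ j ∈ (Finset.range J).erase j₀, s * b j * D j| ≤ c₀ / 4 * μ := by
    refine (Finset.abs_sum_le_sum_abs _ _).trans ?_
    have hterm : ∀ j ∈ (Finset.range J).erase j₀, |s * b j * D j| ≤
        ((j + 1).ascFactorial r : ℝ) * (H * μ / y) := by
      intro j hj
      rw [Finset.mem_erase, Finset.mem_range] at hj
      rcases lt_or_gt_of_ne hj.1 with hlt | hlt
      · rw [hb0 j hlt]; simp; positivity
      · have hDj := hDb j
        have hD0 : 0 ≤ D j := le_trans (by positivity) hDj.1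
        rw [abs_mul, abs_mul, hs1, one_mul, abs_of_nonneg hD0]
        calc |b j| * D j ≤ (H * Pp) *
              (((j + 1).ascFactorial r : ℝ) * ((y : ℝ) ^ (j₀ + 1 + r + 1))⁻¹) := by
              refine mul_le_mul (hbH j hj.2) (hDj.2.trans ?_) hD0 (by positivity)
              refine mul_le_mul_of_nonneg_left ?_ (Nat.cast_nonneg _)
              refine inv_anti₀ (by positivity) ?_
              calc (y : ℝ) ^ (j₀ + 1 + r + 1) ≤ (y : ℝ) ^ (j + 1 + r) :=
                    pow_le_pow_right₀ hy1' (by omega)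
                _ ≤ _ := by gcongr
          _ = _ := by rw [hμ, pow_succ]; field_simp
    refine (Finset.sum_le_sum hterm).trans ?_
    rw [← Finset.sum_mul]
    have hSle : ∑ j ∈ (Finset.range J).erase j₀, ((j + 1).ascFactorial r : ℝ) ≤ S := by
      rw [hS]
      exact Finset.sum_le_sum_of_subset_of_nonneg (Finset.erase_subset _ _)
        fun j _ _ => Nat.cast_nonneg _
    calc _ ≤ S * (H * μ / y) := by gcongr
      _ ≤ c₀ / 4 * μ := by
        rw [div_le_iff₀ hc₀0] at hy
        rw [← mul_div_assoc, div_le_iff₀ hy0]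
        nlinarith
  -- The base 4 in `c₀` comes from t + r ≤ 4y on the dyadic block.
  have hmain : c₀ * μ ≤ s * b j₀ * D j₀ ∧ s * b j₀ * D j₀ ≤ H * S * μ := by
    rw [hs]
    have hDj := hDb j₀
    constructor
    · calc c₀ * μ ≤ Pp * (1 * (((t : ℝ) + r) ^ (j₀ + 1 + r))⁻¹) := by
            have h4 : ((t : ℝ) + r) ^ (j₀ + 1 + r) ≤
                (4 : ℝ) ^ (J + r) * (y : ℝ) ^ (j₀ + 1 + r) := by
              have h5 : (t : ℝ) + r ≤ 4 * y := by
                have h6 : (t : ℝ) ≤ y + y := by exact_mod_cast ht2.le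
                have h7 : (r : ℝ) ≤ y := by exact_mod_cast hry
                linarith
              calc ((t : ℝ) + r) ^ (j₀ + 1 + r) ≤ (4 * (y : ℝ)) ^ (j₀ + 1 + r) := by gcongr
                _ = (4 : ℝ) ^ (j₀ + 1 + r) * (y : ℝ) ^ (j₀ + 1 + r) := mul_pow _ _ _
                _ ≤ _ := by
                  gcongr
                  · norm_num
                  · omega
            rw [one_mul, hμ, hc₀, ← div_eq_mul_inv, ← div_eq_inv_mul, div_div]
            refine div_le_div_of_nonneg_left hPp.le (by positivity) ?_
            linarith [mul_comm ((4 : ℝ) ^ (J + r)) ((y : ℝ) ^ (j₀ + 1 + r))]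
        _ ≤ |b j₀| * D j₀ := by
            refine mul_le_mul hbj (le_trans ?_ hDj.1) (by positivity) (abs_nonneg _)
            gcongr
            exact_mod_cast one_le_ascFactorial_succ j₀ r
    · calc |b j₀| * D j₀ ≤ (H * Pp) * (S * ((y : ℝ) ^ (j₀ + 1 + r))⁻¹) := by
            have hD0 : 0 ≤ D j₀ := le_trans (by positivity) hDj.1
            refine mul_le_mul (hbH _ hj₀) (hDj.2.trans ?_) hD0 (by positivity)
            have : ((j₀ + 1).ascFactorial r : ℝ) ≤ S := by
              rw [hS]
              exact Finset.single_le_sum (f := fun j => ((j + 1).ascFactorial r : ℝ))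
                (fun j _ => Nat.cast_nonneg _) (Finset.mem_range.mpr hj₀)
            have hS0 : 0 ≤ S := (Nat.cast_nonneg _).trans this
            gcongr
        _ = _ := by rw [hμ]; ring
  rw [hexp, ← Finset.add_sum_erase _ _ (Finset.mem_range.mpr hj₀)]
  rw [abs_le] at hEb hrest
  constructor
  · linarith [hEb.1, hrest.1, hmain.1]
  · nlinarith [hEb.2, hrest.2, hmain.2]

/-- Pp/y^(j₀+1+r) is the order of magnitude of the r-th difference, and Pp/y^(j₀+r) is that times
the length `y` of the block. Differencing needs the former below about 1/Q and the latter above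
about Q. The sign of the difference is irrelevant, since `NearInt` is invariant under negation. -/
lemma card_nearSet_rational (r J : ℕ) (hr : 1 ≤ r) (H : ℝ) (hH : 0 ≤ H) :
    ∃ K γ c C ρ Y₀ : ℝ, 0 < K ∧ 0 < γ ∧ 0 < c ∧ 0 < C ∧ 0 < ρ ∧ ∀ (Pp A : ℝ) (b : ℕ → ℝ)
      (j₀ y : ℕ) (Q δ : ℝ), 0 < Pp → j₀ < J → (∀ j < j₀, b j = 0) → Pp ≤ |b j₀| →
      (∀ j < J, |b j| ≤ H * Pp) → Y₀ ≤ y → |A| ≤ ρ * (Pp / y ^ (j₀ + 2)) → 1 ≤ Q →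
      C * (Pp / y ^ (j₀ + 1 + r)) ≤ 1 / Q → Q ≤ c * (Pp / y ^ (j₀ + r)) → 0 ≤ δ → δ ≤ 1 / Q →
      ((nearSet δ (fun t : ℕ => A * t + ∑ j ∈ Finset.range J, b j * ((t : ℝ) ^ (j + 1))⁻¹)
        y y).card : ℝ) ≤ K * y * Q ^ (-γ) := by
  set S : ℝ := ∑ j ∈ Finset.range J, ((j + 1).ascFactorial r : ℝ) with hS
  set c₀ : ℝ := ((4 : ℝ) ^ (J + r))⁻¹ with hc₀
  have hc₀0 : 0 < c₀ := by positivity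
  have hc₀1 : c₀ ≤ 1 := inv_le_one_of_one_le₀ (one_le_pow₀ (by norm_num))
  have hS0 : 0 ≤ S := Finset.sum_nonneg fun _ _ => Nat.cast_nonneg _
  have hHS : 0 ≤ H * S := mul_nonneg hH hS0
  obtain ⟨m, rfl⟩ := Nat.exists_eq_add_of_le' hr
  obtain ⟨K, γ, hK, hγ, h⟩ := card_nearSet_of_fwdDiff m (2 * (H * S + 1) / c₀) (by
    rw [le_div_iff₀ hc₀0]; linarith)
  refine ⟨K, γ, c₀ / 2, H * S + 1, c₀ / 4, max (max (m + 1 : ℕ) (4 * (H * S) / c₀)) 1, hK, hγ,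
    by positivity, by positivity, by positivity, ?_⟩
  intro Pp A b j₀ y Q δ hPp hj₀ hb0 hbj hbH hy hA hQ hCQ hQc hδ hδQ
  have hy1 : 1 ≤ y := by exact_mod_cast (le_max_right _ _).trans hy
  have hyr : m + 1 ≤ y := by
    exact_mod_cast (le_max_left _ _).trans ((le_max_left _ _).trans hy)
  have hy4 : 4 * (H * S) / c₀ ≤ y := (le_max_right _ _).trans ((le_max_left _ _).trans hy)
  have hy0 : (0 : ℝ) < y := by exact_mod_cast hy1
  obtain ⟨s, hs, hs1, hs2⟩ : ∃ s : ℝ, s * b j₀ = |b j₀| ∧ |s| = 1 ∧ (s = 1 ∨ s = -1) := by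
    rcases le_total 0 (b j₀) with hb | hb
    · exact ⟨1, by rw [abs_of_nonneg hb, one_mul], by simp, Or.inl rfl⟩
    · exact ⟨-1, by rw [abs_of_nonpos hb, neg_one_mul], by simp, Or.inr rfl⟩
  have hsgn : (-1 : ℝ) ^ (m + 1) * s = 1 ∨ (-1 : ℝ) ^ (m + 1) * s = -1 := by
    rcases neg_one_pow_eq_or ℝ (m + 1) with h1 | h1 <;> rcases hs2 with h2 | h2 <;>
      rw [h1, h2] <;> norm_num
  set f : ℕ → ℝ := fun t : ℕ => A * t + ∑ j ∈ Finset.range J, b j * ((t : ℝ) ^ (j + 1))⁻¹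
    with hf
  have hset : nearSet δ f y y = nearSet δ (fun t => ((-1 : ℝ) ^ (m + 1) * s) * f t) y y := by
    rcases hsgn with h1 | h1
    · simp only [h1, one_mul]
    · simp only [h1, neg_one_mul]
      exact (nearSet_neg δ f y y).symm
  rw [hset]
  refine h Q y (c₀ / 2 * (Pp / y ^ (j₀ + 1 + (m + 1)))) δ hQ (by positivity) ?_ ?_ hδ hδQ _ y y
    le_rfl ?_
  · calc _ = (H * S + 1) * (Pp / y ^ (j₀ + 1 + (m + 1))) := by field_simp
      _ ≤ _ := hCQ
  · refine hQc.trans (le_of_eq ?_)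
    rw [show j₀ + 1 + (m + 1) = j₀ + (m + 1) + 1 by ring, pow_succ]
    field_simp
  · intro t ht1 ht2
    have := fwdDiff_iter_rational_bounds (r := m + 1) hr hH hS hc₀ hPp hj₀ hb0 hbj hbH hyr hy4
      hy1 hA ht1 ht2 hs hs1
    refine ⟨this.1, this.2.trans (le_of_eq ?_)⟩
    field_simp

/-! ### Resonant tuples of primes and their rarity. -/

/-- Separation of the numbers `v i`, their multiples up to `B + 2`, `1`, and their sum. -/
structure GenericLogs {k : ℕ} (B : ℕ) (κ : ℝ) (v : Fin k → ℝ) : Prop where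
  lower : ∀ i, κ ≤ v i
  one_le : ∀ i, 1 ≤ B * v i
  sum_le : ∑ i, v i ≤ 1 - κ
  -- For v i = log p_i/log x, this and the next two fields separate powers of a prime from x, from
  -- powers of the other primes, and from the product of the tuple, each by a factor x^κ.
  one : ∀ i, ∀ b : ℕ, b ≤ B + 2 → κ ≤ |b * v i - 1|
  pair : ∀ i j, i ≠ j → ∀ a b : ℕ, 1 ≤ a → a ≤ B + 2 → 1 ≤ b → b ≤ B + 2 →
    κ ≤ |a * v i - b * v j|
  total : ∀ i, ∀ b : ℕ, 2 ≤ b → b ≤ B + 2 → κ ≤ |∑ j, v j - b * v i|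

/-- Logarithms of `p i` to base `x`. -/
noncomputable def logCoord {k : ℕ} (x : ℝ) (p : Fin k → ℕ) (i : Fin k) : ℝ :=
  Real.log (p i) / Real.log x

/-- The frequency `∑ h i j P / (p i) ^ (j + 2)`, where `P` is the product of the `p i`. -/
noncomputable def phase {k : ℕ} (J : ℕ) (h : Fin k → ℕ → ℤ) (p : Fin k → ℕ) : ℝ :=
  ∑ i, ∑ j ∈ Finset.range J, (h i j : ℝ) * (((∏ i', p i' : ℕ) : ℝ) / (p i : ℝ) ^ (j + 2))

/-- Tuples whose frequency is close to an integer, with the largest term at `(l, j₀)`. -/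
structure IsResonant {k : ℕ} (B : ℕ) (κ C₀ : ℝ) (J : ℕ) (h : Fin k → ℕ → ℤ) (l : Fin k)
    (j₀ r : ℕ) (x : ℝ) (p : Fin k → ℕ) : Prop where
  pos : ∀ i, 1 ≤ p i
  generic : GenericLogs B κ (logCoord x p)
  near : NearInt (C₀ * ((∏ i, p i : ℕ) : ℝ) / x) (phase J h p)
  small : ∀ i, ∀ j < J, h i j ≠ 0 → ((j + 2 : ℕ) : ℝ) * logCoord x p i ≤ 1
  dominant : ∀ i, ∀ j < J, h i j ≠ 0 →
    ((j₀ + 2 : ℕ) : ℝ) * logCoord x p l ≤ ((j + 2 : ℕ) : ℝ) * logCoord x p i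
  -- With P the product of the tuple, `r` is the least order with P < p_l^(j₀+2+r): the number of
  -- differences in the variable p_l that make the dominant term small.
  order : ∑ i, logCoord x p i < ((j₀ + 2 + r : ℕ) : ℝ) * logCoord x p l
  order' : r = 0 ∨ ((j₀ + 1 + r : ℕ) : ℝ) * logCoord x p l ≤ ∑ i, logCoord x p i

lemma rpow_logCoord {k : ℕ} {x : ℝ} (hx : 1 < x) {p : Fin k → ℕ} (i : Fin k) (hp : 1 ≤ p i) :
    x ^ logCoord x p i = p i := by
  have hp0 : (0 : ℝ) < p i := by exact_mod_cast hp
  rw [logCoord, Real.rpow_def_of_pos (by linarith), mul_div_cancel₀ _ (Real.log_pos hx).ne',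
    Real.exp_log hp0]

lemma rpow_sum_logCoord {k : ℕ} {x : ℝ} (hx : 1 < x) {p : Fin k → ℕ} (hp : ∀ i, 1 ≤ p i) :
    x ^ (∑ i, logCoord x p i) = ((∏ i, p i : ℕ) : ℝ) := by
  rw [Real.rpow_sum_of_pos (by linarith)]
  push_cast
  exact Finset.prod_congr rfl fun i _ => rpow_logCoord hx i (hp i)

lemma rpow_mul_logCoord {k : ℕ} {x : ℝ} (hx : 1 < x) {p : Fin k → ℕ} (i : Fin k) (hp : 1 ≤ p i)
    (m : ℕ) : x ^ ((m : ℝ) * logCoord x p i) = (p i : ℝ) ^ m := by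
  rw [mul_comm, Real.rpow_mul (by linarith), rpow_logCoord hx i hp, Real.rpow_natCast]

namespace IsResonant

variable {k : ℕ} {B : ℕ} {κ C₀ : ℝ} {J : ℕ} {h : Fin k → ℕ → ℤ} {l : Fin k}
  {j₀ r : ℕ} {x : ℝ} {p : Fin k → ℕ}

/-- Bounds the exponents that occur by `B`, so that the separations in `GenericLogs` apply to them.
-/
lemma two_add_le (hR : IsResonant B κ C₀ J h l j₀ r x p) (hκ : 0 < κ) {i : Fin k} {j : ℕ}
    (hj : j < J) (hh : h i j ≠ 0) : j + 2 ≤ B := by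
  have h1 := hR.small i j hj hh
  have h2 := hR.generic.one_le i
  have h3 := hR.generic.lower i
  have h4 : ((j + 2 : ℕ) : ℝ) * logCoord x p i ≤ B * logCoord x p i := h1.trans h2
  exact_mod_cast le_of_mul_le_mul_right h4 (by linarith)

/-- Genericity upgrades domination to a gap: a competing term either involves another prime,
separated by `pair`, or a higher power of the same prime. -/
lemma gap (hR : IsResonant B κ C₀ J h l j₀ r x p) (hκ : 0 < κ) (hj₀ : j₀ < J) (hl : h l j₀ ≠ 0)
    {i : Fin k} {j : ℕ} (hj : j < J) (hh : h i j ≠ 0) (hne : (i, j) ≠ (l, j₀)) :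
    ((j₀ + 2 : ℕ) : ℝ) * logCoord x p l + κ ≤ ((j + 2 : ℕ) : ℝ) * logCoord x p i := by
  have hd := hR.dominant i j hj hh
  by_cases hil : i = l
  · subst hil
    have hjne : j ≠ j₀ := fun hc => hne (by rw [hc])
    have hlow := hR.generic.lower i
    have hle : j₀ ≤ j := by
      have := le_of_mul_le_mul_right hd (by linarith)
      have : j₀ + 2 ≤ j + 2 := by exact_mod_cast this
      omega
    have : ((j₀ + 2 : ℕ) : ℝ) + 1 ≤ ((j + 2 : ℕ) : ℝ) := by
      exact_mod_cast (by omega : j₀ + 2 + 1 ≤ j + 2)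
    nlinarith
  · have h1 := hR.two_add_le hκ hj hh
    have h2 := hR.two_add_le hκ hj₀ hl
    have h3 := hR.generic.pair l i (Ne.symm hil) (j₀ + 2) (j + 2) (by omega) (by omega)
      (by omega) (by omega)
    rw [abs_of_nonpos (by linarith)] at h3
    linarith

lemma order_strict (hR : IsResonant B κ C₀ J h l j₀ r x p) (hκ : 0 < κ) (hj₀ : j₀ < J)
    (hl : h l j₀ ≠ 0) :
    ∑ i, logCoord x p i - ((j₀ + 2 + r : ℕ) : ℝ) * logCoord x p l ≤ -κ := by
  have h2 := hR.two_add_le hκ hj₀ hl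
  have hm : j₀ + 2 + r ≤ B + 2 := by
    rcases hR.order' with h0 | h0
    · omega
    · have h3 := hR.generic.sum_le
      have h4 := hR.generic.one_le l
      have h5 := hR.generic.lower l
      have h6 : ((j₀ + 1 + r : ℕ) : ℝ) * logCoord x p l ≤ B * logCoord x p l := by linarith
      have : j₀ + 1 + r ≤ B := by exact_mod_cast le_of_mul_le_mul_right h6 (by linarith)
      omega
  have h3 := hR.generic.total l (j₀ + 2 + r) (by omega) hm
  have h4 := hR.order
  rw [abs_of_nonpos (by linarith)] at h3
  linarith

lemma order_strict' (hR : IsResonant B κ C₀ J h l j₀ r x p) (hκ : 0 < κ) (hr : 1 ≤ r) :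
    κ ≤ ∑ i, logCoord x p i - ((j₀ + 1 + r : ℕ) : ℝ) * logCoord x p l := by
  have h0 : ((j₀ + 1 + r : ℕ) : ℝ) * logCoord x p l ≤ ∑ i, logCoord x p i := by
    rcases hR.order' with h0 | h0
    · omega
    · exact h0
  have h3 := hR.generic.sum_le
  have h4 := hR.generic.one_le l
  have h5 := hR.generic.lower l
  have h6 : ((j₀ + 1 + r : ℕ) : ℝ) * logCoord x p l ≤ B * logCoord x p l := by linarith
  have : j₀ + 1 + r ≤ B := by exact_mod_cast le_of_mul_le_mul_right h6 (by linarith)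
  have h7 := hR.generic.total l (j₀ + 1 + r) (by omega) (by omega)
  rwa [abs_of_nonneg (by linarith)] at h7

lemma term_eq (hR : IsResonant B κ C₀ J h l j₀ r x p) (hx : 1 < x) (i : Fin k) (m : ℕ) :
    ((∏ i', p i' : ℕ) : ℝ) / (p i : ℝ) ^ m =
      x ^ (∑ i, logCoord x p i - (m : ℝ) * logCoord x p i) := by
  rw [Real.rpow_sub (by linarith), rpow_sum_logCoord hx hR.pos,
    rpow_mul_logCoord hx i (hR.pos i)]

lemma prod_div_le (hR : IsResonant B κ C₀ J h l j₀ r x p) (hx : 1 < x) :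
    ((∏ i', p i' : ℕ) : ℝ) / x ≤ x ^ (-κ) := by
  rw [← rpow_sum_logCoord hx hR.pos]
  have e : x ^ (∑ i, logCoord x p i) / x = x ^ (∑ i, logCoord x p i - 1) := by
    rw [Real.rpow_sub (by linarith), Real.rpow_one]
  rw [e]
  exact Real.rpow_le_rpow_of_exponent_le hx.le (by linarith [hR.generic.sum_le])

/-- By the gap, every term other than the dominant one is smaller by a factor x^(-κ). -/
lemma abs_phase_sub_le (hR : IsResonant B κ C₀ J h l j₀ r x p) (hx : 1 < x) (hκ : 0 < κ)
    (hj₀ : j₀ < J) (hl : h l j₀ ≠ 0) {H : ℝ} (hH : 0 ≤ H) (hhH : ∀ i j, |(h i j : ℝ)| ≤ H) :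
    |phase J h p - h l j₀ * x ^ (∑ i, logCoord x p i - ((j₀ + 2 : ℕ) : ℝ) * logCoord x p l)| ≤
      k * J * H *
        x ^ (∑ i, logCoord x p i - ((j₀ + 2 : ℕ) : ℝ) * logCoord x p l - κ) := by
  have hx0 : 0 < x := by linarith
  rw [phase, ← Finset.sum_product']
  have hmem : (l, j₀) ∈ (Finset.univ : Finset (Fin k)) ×ˢ Finset.range J := by simp [hj₀]
  rw [← Finset.add_sum_erase _ _ hmem]
  simp only
  rw [hR.term_eq hx, add_sub_cancel_left]
  refine (Finset.abs_sum_le_sum_abs _ _).trans ?_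
  have hterm : ∀ z ∈ ((Finset.univ : Finset (Fin k)) ×ˢ Finset.range J).erase (l, j₀),
      |(h z.1 z.2 : ℝ) * (((∏ i', p i' : ℕ) : ℝ) / (p z.1 : ℝ) ^ (z.2 + 2))| ≤
        H * x ^ (∑ i, logCoord x p i - ((j₀ + 2 : ℕ) : ℝ) * logCoord x p l - κ) := by
    intro z hz
    rw [Finset.mem_erase, Finset.mem_product, Finset.mem_range] at hz
    by_cases hh : h z.1 z.2 = 0
    · rw [hh]; simp; positivity
    · rw [hR.term_eq hx, abs_mul, abs_of_pos (Real.rpow_pos_of_pos hx0 _)]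
      have := hR.gap hκ hj₀ hl hz.2.2 hh hz.1
      refine mul_le_mul (hhH _ _) (Real.rpow_le_rpow_of_exponent_le hx.le ?_) (by positivity) hH
      linarith
  refine (Finset.sum_le_sum hterm).trans ?_
  rw [Finset.sum_const, nsmul_eq_mul, ← mul_assoc]
  have hc : ((((Finset.univ : Finset (Fin k)) ×ˢ Finset.range J).erase (l, j₀)).card : ℝ) ≤
      k * J := by
    have := Finset.card_erase_le (s := (Finset.univ : Finset (Fin k)) ×ˢ Finset.range J)
      (a := (l, j₀))
    rw [Finset.card_product] at this
    simp only [Finset.card_univ, Fintype.card_fin, Finset.card_range] at this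
    exact_mod_cast this
  gcongr

end IsResonant

lemma eventually_le_rpow {κ : ℝ} (hκ : 0 < κ) (W : ℝ) : ∀ᶠ x : ℝ in atTop, W ≤ x ^ κ :=
  (tendsto_rpow_atTop hκ).eventually_ge_atTop W

/-- For r = 0 the dominant term itself tends to 0, so the only candidate integer is 0. But
p_l^(j₀+2) ≤ x^(1-κ) makes the phase at least of order x^κ·P/x, beyond the tolerance C₀P/x. -/
lemma not_isResonant_zero {k : ℕ} (B : ℕ) {κ : ℝ} (hκ : 0 < κ) {C₀ : ℝ} (hC₀ : 0 < C₀) (J : ℕ)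
    (h : Fin k → ℕ → ℤ) (l : Fin k) (j₀ : ℕ) (hj₀ : j₀ < J) (hl : h l j₀ ≠ 0) {H : ℝ}
    (hH : 0 ≤ H) (hhH : ∀ i j, |(h i j : ℝ)| ≤ H) :
    ∀ᶠ x : ℝ in atTop, ∀ p : Fin k → ℕ, ¬ IsResonant B κ C₀ J h l j₀ 0 x p := by
  filter_upwards [eventually_gt_atTop 1,
    eventually_le_rpow hκ (2 * (k * J * H) + 4 * H + 4 * C₀ + 4)] with x hx hW p hR
  have hx0 : 0 < x := by linarith
  set e := ∑ i, logCoord x p i - ((j₀ + 2 : ℕ) : ℝ) * logCoord x p l with he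
  have h1 := hR.abs_phase_sub_le hx hκ hj₀ hl hH hhH
  rw [← he] at h1
  have h2 : e ≤ -κ := hR.order_strict hκ hj₀ hl
  have hkJ : 0 ≤ k * J * H := by positivity
  have hxκ0 : 0 < x ^ κ := by positivity
  have hprod : x ^ (-κ) * x ^ κ = 1 := by
    rw [← Real.rpow_add hx0, neg_add_cancel, Real.rpow_zero]
  have hm0 : 0 < x ^ (-κ) := by positivity
  have hrest : k * J * H * x ^ (e - κ) ≤ x ^ e / 2 := by
    rw [sub_eq_add_neg, Real.rpow_add hx0]
    have : k * J * H * x ^ (-κ) ≤ 1 / 2 := by nlinarith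
    calc k * J * H * (x ^ e * x ^ (-κ)) = x ^ e * (k * J * H * x ^ (-κ)) := by ring
      _ ≤ x ^ e * (1 / 2) := by gcongr
      _ = _ := by ring
  have hxe : x ^ e ≤ x ^ (-κ) := Real.rpow_le_rpow_of_exponent_le hx.le h2
  have hxe0 : 0 < x ^ e := by positivity
  have hh1 : (1 : ℝ) ≤ |(h l j₀ : ℝ)| := by
    rw [← Int.cast_abs]
    exact_mod_cast Int.one_le_abs hl
  have habs : |(h l j₀ : ℝ) * x ^ e| = |(h l j₀ : ℝ)| * x ^ e := by
    rw [abs_mul, abs_of_pos hxe0]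
  have hlow : x ^ e / 2 ≤ |phase J h p| := by
    have := abs_sub_abs_le_abs_sub ((h l j₀ : ℝ) * x ^ e) (phase J h p)
    rw [abs_sub_comm] at this
    nlinarith
  have hup : |phase J h p| ≤ 1 / 4 := by
    have h3 := abs_sub_abs_le_abs_sub (phase J h p) ((h l j₀ : ℝ) * x ^ e)
    have h4 : |(h l j₀ : ℝ)| * x ^ e ≤ H * x ^ (-κ) :=
      mul_le_mul (hhH _ _) hxe hxe0.le hH
    have h5 : (H + 1 / 2) * x ^ (-κ) ≤ 1 / 4 := by nlinarith
    linarith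
  have hP := hR.prod_div_le hx
  obtain ⟨z, hz⟩ := hR.near
  have hδ : C₀ * ((∏ i, p i : ℕ) : ℝ) / x ≤ 1 / 4 := by
    rw [mul_div_assoc]
    nlinarith
  have hz0 : z = 0 := by
    by_contra hne
    have h5 : (1 : ℝ) ≤ |(z : ℝ)| := by
      rw [← Int.cast_abs]
      exact_mod_cast Int.one_le_abs hne
    have h6 := abs_sub_abs_le_abs_sub (z : ℝ) (phase J h p)
    rw [abs_sub_comm] at h6
    linarith
  rw [hz0, Int.cast_zero, sub_zero] at hz
  have hj := hR.two_add_le hκ hj₀ hl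
  have hone := hR.generic.one l (j₀ + 2) (by omega)
  have hsm := hR.small l j₀ hj₀ hl
  rw [abs_of_nonpos (by linarith)] at hone
  have hlb : x ^ (κ - 1) * ((∏ i, p i : ℕ) : ℝ) ≤ x ^ e := by
    rw [← rpow_sum_logCoord hx hR.pos, ← Real.rpow_add hx0]
    exact Real.rpow_le_rpow_of_exponent_le hx.le (by linarith)
  rw [Real.rpow_sub hx0, Real.rpow_one] at hlb
  have hPpos : 0 < ((∏ i, p i : ℕ) : ℝ) := by
    exact_mod_cast Finset.prod_pos fun i _ => hR.pos i
  have h7 : x ^ κ / x * ((∏ i, p i : ℕ) : ℝ) / 2 ≤ C₀ * ((∏ i, p i : ℕ) : ℝ) / x := by linarith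
  have h8 : x ^ κ * (((∏ i, p i : ℕ) : ℝ) / x) ≤ (2 * C₀) * (((∏ i, p i : ℕ) : ℝ) / x) := by
    calc _ = 2 * (x ^ κ / x * ((∏ i, p i : ℕ) : ℝ) / 2) := by ring
      _ ≤ 2 * (C₀ * ((∏ i, p i : ℕ) : ℝ) / x) := by linarith
      _ = _ := by ring
  have h9 := le_of_mul_le_mul_right h8 (by positivity)
  linarith

/-- In a single entry `t`, the phase is a linear term plus inverse powers, the shape required by
`card_nearSet_rational`. -/
lemma phase_insertNth {k J : ℕ} (h : Fin (k + 1) → ℕ → ℤ) (l : Fin (k + 1)) (q : Fin k → ℕ)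
    {t : ℕ} (ht : 0 < t) :
    phase J h (l.insertNth t q : Fin (k + 1) → ℕ) =
      (((∏ i, q i : ℕ) : ℝ) * ∑ i, ∑ j ∈ Finset.range J,
        (h (l.succAbove i) j : ℝ) * ((q i : ℝ) ^ (j + 2))⁻¹) * t +
      ∑ j ∈ Finset.range J, ((h l j : ℝ) * ((∏ i, q i : ℕ) : ℝ)) * ((t : ℝ) ^ (j + 1))⁻¹ := by
  have ht0 : (t : ℝ) ≠ 0 := by positivity
  rw [phase, Fin.sum_univ_succAbove _ l, Fin.prod_univ_succAbove _ l, add_comm]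
  simp only [Fin.insertNth_apply_same, Fin.insertNth_apply_succAbove]
  congr 1
  · simp only [Finset.mul_sum, Finset.sum_mul]
    refine Finset.sum_congr rfl fun i _ => Finset.sum_congr rfl fun j _ => ?_
    push_cast
    rw [div_eq_mul_inv]
    ring
  · refine Finset.sum_congr rfl fun j _ => ?_
    push_cast
    rw [show j + 2 = j + 1 + 1 by ring, pow_succ]
    field_simp

-- All entries but the dominant one are fixed. The separations give every size condition with room
-- x^κ; differencing is run with Q = x^(κ/2), and the other half of the room absorbs the constants.
set_option maxHeartbeats 1000000 in
open scoped Classical in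
lemma card_resonant_line {k : ℕ} (B : ℕ) {κ : ℝ} (hκ : 0 < κ) {C₀ : ℝ} (hC₀ : 0 < C₀) (J : ℕ)
    (h : Fin (k + 1) → ℕ → ℤ) (l : Fin (k + 1)) (j₀ r : ℕ) (hj₀ : j₀ < J) (hl : h l j₀ ≠ 0)
    {H : ℝ} (hH : 0 ≤ H) (hhH : ∀ i j, |(h i j : ℝ)| ≤ H) :
    ∃ K γ : ℝ, 0 < K ∧ 0 < γ ∧ ∀ᶠ x : ℝ in atTop, ∀ (q : Fin k → ℕ) (y : ℕ),
      (((Finset.Ico y (y + y)).filter fun t =>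
        IsResonant B κ C₀ J h l j₀ r x (l.insertNth t q)).card : ℝ) ≤ K * y * x ^ (-γ) := by
  rcases Nat.eq_zero_or_pos r with rfl | hr
  · refine ⟨1, 1, one_pos, one_pos, ?_⟩
    filter_upwards [not_isResonant_zero B hκ hC₀ J h l j₀ hj₀ hl hH hhH,
      eventually_gt_atTop 0] with x hx hx0 q y
    rw [Finset.filter_false_of_mem fun t _ => hx _]
    simp
    positivity
  obtain ⟨K, γ, c, C, ρ, Y₀, hK, hγ, hc, hC, hρ, hmain⟩ := card_nearSet_rational r J hr H hH
  refine ⟨K, κ / 2 * γ, hK, by positivity, ?_⟩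
  filter_upwards [eventually_gt_atTop 1, eventually_le_rpow (half_pos hκ)
    (1 + |2 * Y₀| + (k + 1) * J * H / ρ + C * 2 ^ (j₀ + 2 + r) + 1 / c + 2 * C₀)] with x hx hW q y
  have hx0 : 0 < x := by linarith
  -- One resonant `t₀` in the block yields size relations for the fixed entries `q`; up to powers of
  -- 2 these hold with `y` in place of `t₀`, hence for the whole block.
  rcases Finset.eq_empty_or_nonempty ((Finset.Ico y (y + y)).filter fun t =>
    IsResonant B κ C₀ J h l j₀ r x (l.insertNth t q)) with hemp | ⟨t₀, ht₀⟩
  · rw [hemp]; simp; positivity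
  rw [Finset.mem_filter, Finset.mem_Ico] at ht₀
  obtain ⟨⟨hyt, hty⟩, hR⟩ := ht₀
  set p : Fin (k + 1) → ℕ := l.insertNth t₀ q with hp
  have hpl : p l = t₀ := by simp [hp]
  have hpq : ∀ i, p (l.succAbove i) = q i := fun i => by simp [hp]
  set Z := x ^ (κ / 2) with hZ
  have hZ2 : x ^ κ = Z * Z := by
    rw [hZ, ← Real.rpow_add hx0]; congr 1; ring
  have hZi : x ^ (-κ) = 1 / (Z * Z) := by rw [Real.rpow_neg hx0.le, hZ2, one_div]
  have n1 : 0 ≤ |2 * Y₀| := abs_nonneg _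
  have n2 : 0 ≤ (k + 1) * J * H / ρ := by positivity
  have n3 : 0 ≤ C * 2 ^ (j₀ + 2 + r) := by positivity
  have n4 : 0 ≤ 1 / c := by positivity
  have hZ1 : 1 ≤ Z := by linarith
  have hZ0 : 0 < Z := by linarith
  have hZZ : Z ≤ Z * Z := by nlinarith
  have ht₀1 : 1 ≤ t₀ := by rw [← hpl]; exact hR.pos l
  have ht₀0 : (0 : ℝ) < t₀ := by exact_mod_cast ht₀1
  have hy1 : 1 ≤ y := by omega
  have hy0 : (0 : ℝ) < y := by exact_mod_cast hy1
  have hyt' : (y : ℝ) ≤ t₀ := by exact_mod_cast hyt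
  have hty' : (t₀ : ℝ) ≤ 2 * y := by
    have : (t₀ : ℝ) ≤ y + y := by exact_mod_cast hty.le
    linarith
  have hq1 : ∀ i, 1 ≤ q i := fun i => by rw [← hpq]; exact hR.pos _
  set Pp : ℝ := ((∏ i, q i : ℕ) : ℝ) with hPp
  have hPp0 : 0 < Pp := by
    rw [hPp]; exact_mod_cast Finset.prod_pos fun i _ => hq1 i
  have hprod : ∀ t : ℕ, ((∏ i, (l.insertNth t q : Fin (k + 1) → ℕ) i : ℕ) : ℝ) = t * Pp := by
    intro t
    rw [Fin.prod_univ_succAbove _ l]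
    simp [hPp]
  have hPt : ∀ m : ℕ, Pp / (t₀ : ℝ) ^ m =
      x ^ (∑ i, logCoord x p i - ((m + 1 : ℕ) : ℝ) * logCoord x p l) := by
    intro m
    rw [← hR.term_eq hx, hpl, hp, hprod, pow_succ]
    field_simp
  have hxlow : x ^ κ ≤ t₀ := by
    have := rpow_logCoord hx l (hR.pos l)
    rw [hpl] at this
    rw [← this]
    exact Real.rpow_le_rpow_of_exponent_le hx.le (hR.generic.lower l)
  set A : ℝ := Pp * ∑ i, ∑ j ∈ Finset.range J,
    (h (l.succAbove i) j : ℝ) * ((q i : ℝ) ^ (j + 2))⁻¹ with hA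
  have hAle : |A| ≤ ρ * (Pp / y ^ (j₀ + 2)) := by
    have hterm : ∀ i : Fin k, ∀ j ∈ Finset.range J,
        |(h (l.succAbove i) j : ℝ) * ((q i : ℝ) ^ (j + 2))⁻¹| ≤
          H * (1 / (Z * Z) * (1 / (y : ℝ) ^ (j₀ + 2))) := by
      intro i j hj
      rw [Finset.mem_range] at hj
      by_cases hh : h (l.succAbove i) j = 0
      · rw [hh]; simp; positivity
      · have hne : (l.succAbove i, j) ≠ (l, j₀) := fun hc =>
          Fin.succAbove_ne l i (Prod.ext_iff.mp hc).1
        have hg := hR.gap hκ hj₀ hl hj hh hne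
        have h1 : (t₀ : ℝ) ^ (j₀ + 2) * x ^ κ ≤ (q i : ℝ) ^ (j + 2) := by
          have e1 := rpow_mul_logCoord hx l (hR.pos l) (j₀ + 2)
          have e2 := rpow_mul_logCoord hx (l.succAbove i) (hR.pos _) (j + 2)
          rw [hpl] at e1
          rw [hpq] at e2
          rw [← e1, ← e2, ← Real.rpow_add hx0]
          exact Real.rpow_le_rpow_of_exponent_le hx.le hg
        have hq0 : (0 : ℝ) < q i := by exact_mod_cast hq1 i
        rw [abs_mul, abs_of_pos (by positivity : 0 < ((q i : ℝ) ^ (j + 2))⁻¹)]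
        refine mul_le_mul (hhH _ _) ?_ (by positivity) hH
        have h2 : (y : ℝ) ^ (j₀ + 2) * x ^ κ ≤ (q i : ℝ) ^ (j + 2) := le_trans (by gcongr) h1
        rw [← hZ2, ← one_div, one_div_mul_one_div, mul_comm (x ^ κ)]
        exact one_div_le_one_div_of_le (by positivity) h2
    have hsum : |∑ i, ∑ j ∈ Finset.range J,
        (h (l.succAbove i) j : ℝ) * ((q i : ℝ) ^ (j + 2))⁻¹| ≤
          k * (J * (H * (1 / (Z * Z) * (1 / (y : ℝ) ^ (j₀ + 2))))) := by
      refine (Finset.abs_sum_le_sum_abs _ _).trans ?_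
      have : ∀ i ∈ (Finset.univ : Finset (Fin k)), |∑ j ∈ Finset.range J,
          (h (l.succAbove i) j : ℝ) * ((q i : ℝ) ^ (j + 2))⁻¹| ≤
            J * (H * (1 / (Z * Z) * (1 / (y : ℝ) ^ (j₀ + 2)))) := fun i _ => by
        refine (Finset.abs_sum_le_sum_abs _ _).trans ((Finset.sum_le_sum (hterm i)).trans ?_)
        simp
      refine (Finset.sum_le_sum this).trans ?_
      simp
    rw [hA, abs_mul, abs_of_pos hPp0]
    have hkey : k * J * H * (1 / (Z * Z)) ≤ ρ := by
      rw [mul_one_div, div_le_iff₀ (by positivity)]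
      have h1 : (k + 1) * J * H / ρ ≤ Z * Z := by linarith
      rw [div_le_iff₀ hρ] at h1
      have : 0 ≤ J * H := by positivity
      nlinarith
    calc Pp * _ ≤ Pp * (k * (J * (H * (1 / (Z * Z) * (1 / (y : ℝ) ^ (j₀ + 2)))))) := by gcongr
      _ = (k * J * H * (1 / (Z * Z))) * (Pp / y ^ (j₀ + 2)) := by ring
      _ ≤ _ := by gcongr
  have hsub : ((Finset.Ico y (y + y)).filter fun t =>
      IsResonant B κ C₀ J h l j₀ r x (l.insertNth t q)) ⊆
      nearSet (2 * C₀ * x ^ (-κ)) (fun t : ℕ => A * t + ∑ j ∈ Finset.range J,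
        ((h l j : ℝ) * Pp) * ((t : ℝ) ^ (j + 1))⁻¹) y y := by
    intro t ht
    rw [Finset.mem_filter, Finset.mem_Ico] at ht
    refine mem_nearSet.mpr ⟨ht.1, ?_⟩
    have hnear := ht.2.near
    rw [phase_insertNth h l q (by omega)] at hnear
    refine hnear.mono ?_
    have htt : (t : ℝ) ≤ 2 * t₀ := by
      have : t ≤ 2 * t₀ := by omega
      exact_mod_cast this
    have hP := hR.prod_div_le hx
    rw [hp, hprod] at hP
    rw [hprod]
    calc C₀ * (t * Pp) / x ≤ C₀ * ((2 * t₀) * Pp) / x := by gcongr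
      _ = 2 * C₀ * (t₀ * Pp / x) := by ring
      _ ≤ _ := by gcongr
  have hZγ : x ^ (-(κ / 2 * γ)) = Z ^ (-γ) := by
    rw [hZ, ← Real.rpow_mul hx0.le]; congr 1; ring
  rw [hZγ]
  refine (Nat.cast_le.mpr (Finset.card_le_card hsub)).trans
    (hmain Pp A (fun j => (h l j : ℝ) * Pp) j₀ y Z _ hPp0 hj₀ ?_ ?_ ?_ ?_ hAle
    hZ1 ?_ ?_ (by positivity) ?_)
  · intro j hj
    by_contra hne
    have hh : h l j ≠ 0 := fun hc => hne (by rw [hc]; simp)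
    have hg := hR.gap hκ hj₀ hl (hj.trans hj₀) hh (by simpa using hj.ne)
    have hlow := hR.generic.lower l
    have : ((j + 2 : ℕ) : ℝ) ≤ ((j₀ + 2 : ℕ) : ℝ) := by exact_mod_cast (by omega)
    nlinarith
  · rw [abs_mul, abs_of_pos hPp0]
    have hh1 : (1 : ℝ) ≤ |(h l j₀ : ℝ)| := by
      rw [← Int.cast_abs]
      exact_mod_cast Int.one_le_abs hl
    nlinarith
  · intro j _
    rw [abs_mul, abs_of_pos hPp0]
    exact mul_le_mul_of_nonneg_right (hhH _ _) hPp0.le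
  · have := le_abs_self (2 * Y₀)
    linarith
  · have h1 : Pp / (y : ℝ) ^ (j₀ + 1 + r) ≤ 2 ^ (j₀ + 2 + r) * x ^ (-κ) := by
      have h2 : Pp / (t₀ : ℝ) ^ (j₀ + 1 + r) ≤ x ^ (-κ) := by
        rw [hPt]
        refine Real.rpow_le_rpow_of_exponent_le hx.le ?_
        have := hR.order_strict hκ hj₀ hl
        rwa [show j₀ + 1 + r + 1 = j₀ + 2 + r by ring]
      calc Pp / (y : ℝ) ^ (j₀ + 1 + r) ≤ Pp / ((t₀ : ℝ) / 2) ^ (j₀ + 1 + r) := by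
            gcongr
            linarith
        _ = 2 ^ (j₀ + 1 + r) * (Pp / (t₀ : ℝ) ^ (j₀ + 1 + r)) := by
            rw [div_pow]; field_simp
        _ ≤ 2 ^ (j₀ + 2 + r) * x ^ (-κ) := by
            gcongr
            · norm_num
            · omega
    calc C * (Pp / (y : ℝ) ^ (j₀ + 1 + r)) ≤ C * (2 ^ (j₀ + 2 + r) * x ^ (-κ)) := by gcongr
      _ = (C * 2 ^ (j₀ + 2 + r)) * (1 / (Z * Z)) := by rw [hZi]; ring
      _ ≤ Z * (1 / (Z * Z)) := by gcongr; linarith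
      _ = 1 / Z := by field_simp
  · have h1 : x ^ κ ≤ Pp / (y : ℝ) ^ (j₀ + r) := by
      calc x ^ κ ≤ Pp / (t₀ : ℝ) ^ (j₀ + r) := by
            rw [hPt]
            refine Real.rpow_le_rpow_of_exponent_le hx.le ?_
            have := hR.order_strict' hκ hr
            rwa [show j₀ + r + 1 = j₀ + 1 + r by ring]
        _ ≤ _ := by gcongr
    have h2 : 1 / c ≤ Z := by linarith
    rw [div_le_iff₀ hc] at h2
    calc Z ≤ Z * (Z * c) := by nlinarith
      _ = c * x ^ κ := by rw [hZ2]; ring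
      _ ≤ _ := by gcongr
  · calc 2 * C₀ * x ^ (-κ) = 2 * C₀ * (1 / (Z * Z)) := by rw [hZi]
      _ ≤ Z * (1 / (Z * Z)) := by gcongr; linarith
      _ = 1 / Z := by field_simp

lemma sum_piFinset_insertNth {k : ℕ} (s : Finset ℕ) (l : Fin (k + 1))
    (G : (Fin (k + 1) → ℕ) → ℝ) :
    ∑ p ∈ Fintype.piFinset (fun _ : Fin (k + 1) => s), G p =
      ∑ q ∈ Fintype.piFinset (fun _ : Fin k => s), ∑ t ∈ s, G (l.insertNth t q) := by
  rw [← Finset.sum_product']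
  symm
  refine Finset.sum_bij' (fun z _ => l.insertNth z.2 z.1) (fun p _ => (l.removeNth p, p l))
    ?_ ?_ ?_ ?_ ?_
  · intro z hz
    rw [Finset.mem_product, Fintype.mem_piFinset] at hz
    rw [Fintype.mem_piFinset]
    intro i
    refine Fin.succAboveCases l ?_ (fun i => ?_) i
    · simpa using hz.2
    · simpa using hz.1 i
  · intro p hp
    rw [Fintype.mem_piFinset] at hp
    rw [Finset.mem_product, Fintype.mem_piFinset]
    exact ⟨fun i => hp _, hp _⟩
  · intro z _; simp
  · intro p _; simp
  · intro z _; rfl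

/-- The weights depend on the order of the primes through the successive heights. On the support of
`Φ` all these heights have logarithm at least `D`, so product weights dominate, and any coordinate
may then be summed first. The separate bound `x₀` keeps the range of primes fixed during the
induction. -/
lemma sizeBiased_le_sum {k : ℕ} : ∀ {x x₀ D : ℝ}, 1 ≤ x → x ≤ x₀ → 0 < D →
    ∀ {Φ : (Fin k → ℕ) → ℝ}, (∀ p, 0 ≤ Φ p) →
    (∀ p : Fin k → ℕ, (∀ i, (p i).Prime) → Φ p ≠ 0 → D ≤ Real.log (x / (∏ i, p i : ℕ))) →
    sizeBiased k x Φ ≤ ∑ p ∈ Fintype.piFinset (fun _ : Fin k => ⌊x₀⌋₊.primesLE),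
      (∏ i, Real.log (p i) / (p i * D)) * Φ p := by
  induction k with
  | zero =>
    intro x x₀ D _ _ _ Φ _ _
    simp [sizeBiased, Fintype.piFinset_of_isEmpty]
    exact le_of_eq (congrArg Φ (Subsingleton.elim _ _))
  | succ k ih =>
    intro x x₀ D hx hxx hD Φ hΦ hsupp
    have hx0 : 0 ≤ x := by linarith
    have hlog : ∀ p : ℕ, 0 ≤ Real.log p / (p * D) := fun p => by
      have := Real.log_natCast_nonneg p
      positivity
    rw [sum_piFinset_insertNth _ 0, Finset.sum_comm]
    have hsub : ⌊x⌋₊.primesLE ⊆ ⌊x₀⌋₊.primesLE := Nat.primesLE_mono (Nat.floor_mono hxx)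
    set S : ℕ → ℝ := fun t => ∑ q ∈ Fintype.piFinset (fun _ : Fin k => ⌊x₀⌋₊.primesLE),
      (∏ i, Real.log (q i) / (q i * D)) * Φ (Fin.cons t q) with hS
    have hS0 : ∀ t, 0 ≤ S t := fun t => Finset.sum_nonneg fun q _ =>
      mul_nonneg (Finset.prod_nonneg fun i _ => hlog _) (hΦ _)
    have hrhs : ∀ t ∈ ⌊x₀⌋₊.primesLE, ∑ q ∈ Fintype.piFinset (fun _ : Fin k => ⌊x₀⌋₊.primesLE),
        (∏ i, Real.log (((0 : Fin (k + 1)).insertNth t q : Fin (k + 1) → ℕ) i) /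
          ((((0 : Fin (k + 1)).insertNth t q : Fin (k + 1) → ℕ) i : ℕ) * D)) *
          Φ ((0 : Fin (k + 1)).insertNth t q) = Real.log t / (t * D) * S t := by
      intro t _
      rw [hS, Finset.mul_sum]
      refine Finset.sum_congr rfl fun q _ => ?_
      simp only [Fin.insertNth_zero', Fin.prod_univ_succ, Fin.cons_zero, Fin.cons_succ]
      ring
    rw [Finset.sum_congr rfl hrhs]
    refine le_trans ?_ (Finset.sum_le_sum_of_subset_of_nonneg hsub
      fun t _ _ => mul_nonneg (hlog t) (hS0 t))
    refine Finset.sum_le_sum fun t ht => ?_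
    have htp := Nat.prime_of_mem_primesLE ht
    have ht1 := one_le_div_of_mem_primesLE hx0 ht
    have htpos : (0 : ℝ) < t := by exact_mod_cast htp.pos
    have hT : sizeBiased k (x / t) (fun q => Φ (Fin.cons t q)) ≤ S t := by
      refine ih ht1 (le_trans (div_le_self hx0 (by exact_mod_cast htp.one_lt.le)) hxx) hD
        (fun q => hΦ _) fun q hq hne => ?_
      have := hsupp (Fin.cons t q) (fun i => by
        refine Fin.cases ?_ (fun i => ?_) i
        · simpa using htp
        · simpa using hq i) hne
      rw [Fin.prod_univ_succ] at this
      simpa only [Fin.cons_zero, Fin.cons_succ, Nat.cast_mul, div_div] using this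
    refine (mul_le_mul_of_nonneg_left hT (primeWeight_nonneg hx t)).trans ?_
    rcases (hS0 t).eq_or_lt with h0 | h0
    · rw [← h0]; simp
    refine mul_le_mul_of_nonneg_right ?_ (hS0 t)
    obtain ⟨q, hq, hqne⟩ := Finset.exists_ne_zero_of_sum_ne_zero h0.ne'
    have hΦne : Φ (Fin.cons t q) ≠ 0 := fun h => hqne (by rw [h, mul_zero])
    rw [Fintype.mem_piFinset] at hq
    have hprime : ∀ i, ((Fin.cons t q : Fin (k + 1) → ℕ) i).Prime := fun i => by
      refine Fin.cases ?_ (fun i => ?_) i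
      · simpa using htp
      · simpa using Nat.prime_of_mem_primesLE (hq i)
    have hge : (1 : ℝ) ≤ ((∏ i, (Fin.cons t q : Fin (k + 1) → ℕ) i : ℕ) : ℝ) := by
      exact_mod_cast Finset.prod_pos fun i _ => (hprime i).pos
    have hDx : D ≤ Real.log x := by
      refine (hsupp _ hprime hΦne).trans (Real.log_le_log (by positivity) ?_)
      exact div_le_self hx0 hge
    unfold primeWeight
    have := Real.log_natCast_nonneg t
    gcongr

open scoped Classical in
lemma sum_inv_dyadic_le (S : Set ℕ) (N : ℕ) (M : ℝ)
    (hM : ∀ y : ℕ, (((Finset.Ico y (y + y)).filter (· ∈ S)).card : ℝ) ≤ M * y) :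
    ∑ t ∈ (Finset.Icc 1 N).filter (· ∈ S), (t : ℝ)⁻¹ ≤ (Nat.log 2 N + 1) * M := by
  have hmaps : ∀ t ∈ (Finset.Icc 1 N).filter (· ∈ S),
      Nat.log 2 t ∈ Finset.range (Nat.log 2 N + 1) := by
    intro t ht
    rw [Finset.mem_filter, Finset.mem_Icc] at ht
    rw [Finset.mem_range]
    exact Nat.lt_succ_of_le (Nat.log_mono_right ht.1.2)
  rw [← Finset.sum_fiberwise_of_maps_to hmaps]
  have hfib : ∀ s ∈ Finset.range (Nat.log 2 N + 1),
      ∑ t ∈ ((Finset.Icc 1 N).filter (· ∈ S)).filter (fun t => Nat.log 2 t = s), (t : ℝ)⁻¹ ≤ M := by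
    intro s _
    have h2 : (0 : ℝ) < 2 ^ s := by positivity
    calc _ ≤ ∑ t ∈ (Finset.Ico (2 ^ s) (2 ^ s + 2 ^ s)).filter (· ∈ S), ((2 : ℝ) ^ s)⁻¹ := by
          refine Finset.sum_le_sum_of_subset_of_nonneg ?_ (fun _ _ _ => by positivity) |>.trans'
            (Finset.sum_le_sum fun t ht => ?_)
          · intro t ht
            simp only [Finset.mem_filter, Finset.mem_Icc] at ht
            have h1 := Nat.pow_log_le_self 2 (show t ≠ 0 by omega)
            have h2 := Nat.lt_pow_succ_log_self (b := 2) (by norm_num) t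
            rw [ht.2] at h1 h2
            rw [Finset.mem_filter, Finset.mem_Ico]
            exact ⟨⟨h1, by rw [pow_succ] at h2; omega⟩, ht.1.2⟩
          · simp only [Finset.mem_filter, Finset.mem_Icc] at ht
            have h1 := Nat.pow_log_le_self 2 (show t ≠ 0 by omega)
            rw [ht.2] at h1
            have h1' : (2 : ℝ) ^ s ≤ t := by exact_mod_cast h1
            gcongr
      _ ≤ M := by
          rw [Finset.sum_const, nsmul_eq_mul]
          have := hM (2 ^ s)
          push_cast at this
          rw [← div_eq_mul_inv, div_le_iff₀ h2]
          exact this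
  refine (Finset.sum_le_sum hfib).trans ?_
  simp

lemma tendsto_log_mul_rpow_neg {γ : ℝ} (hγ : 0 < γ) (a b : ℝ) :
    Tendsto (fun x : ℝ => (a * Real.log x + b) * x ^ (-γ)) atTop (𝓝 0) := by
  have h1 : Tendsto (fun x : ℝ => Real.log x / x ^ γ) atTop (𝓝 0) :=
    (isLittleO_log_rpow_atTop hγ).tendsto_div_nhds_zero
  have h2 : Tendsto (fun x : ℝ => x ^ (-γ)) atTop (𝓝 0) := tendsto_rpow_neg_atTop hγ
  have h3 := (h1.const_mul a).add (h2.const_mul b)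
  simp only [mul_zero, add_zero] at h3
  refine h3.congr' ?_
  filter_upwards [eventually_gt_atTop 0] with x hx
  rw [Real.rpow_neg hx.le]
  ring

lemma sizeBiased_nonneg {k : ℕ} {x : ℝ} (hx : 1 ≤ x) {Φ : (Fin k → ℕ) → ℝ} (h : ∀ p, 0 ≤ Φ p) :
    0 ≤ sizeBiased k x Φ := by
  have := sizeBiased_mono hx (Φ := fun _ => 0) (Ψ := Φ) fun p _ _ => h p
  have h0 := sizeBiased_const_mul (k := k) x 0 (fun _ => 0)
  simp only [zero_mul] at h0
  linarith

lemma log_div_prod {k : ℕ} {x : ℝ} (hx : 1 < x) {p : Fin k → ℕ} (hp : ∀ i, 1 ≤ p i) :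
    Real.log (x / (∏ i, p i : ℕ)) = Real.log x * (1 - ∑ i, logCoord x p i) := by
  have hlx := Real.log_pos hx
  have h0 : (0 : ℝ) < ((∏ i, p i : ℕ) : ℝ) := by
    exact_mod_cast Finset.prod_pos fun i _ => hp i
  rw [Real.log_div (by linarith) h0.ne', ← rpow_sum_logCoord hx hp, Real.log_rpow (by linarith)]
  ring

/-- The entry `l` is summed first. Its weight is at most a constant times 1/t, so primes may be
replaced by all integers t, and the dyadic counts give a factor of order log x · x^(-γ). The other
coordinates contribute a bounded power of the total prime weight. -/
lemma tendsto_sizeBiased_isResonant {k : ℕ} (B : ℕ) {κ : ℝ} (hκ : 0 < κ) {C₀ : ℝ} (hC₀ : 0 < C₀)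
    (J : ℕ) (h : Fin (k + 1) → ℕ → ℤ) (l : Fin (k + 1)) (j₀ r : ℕ) (hj₀ : j₀ < J)
    (hl : h l j₀ ≠ 0) {H : ℝ} (hH : 0 ≤ H) (hhH : ∀ i j, |(h i j : ℝ)| ≤ H) :
    Tendsto (fun x => sizeBiased (k + 1) x
      ({p | IsResonant B κ C₀ J h l j₀ r x p}.indicator 1)) atTop (𝓝 0) := by
  classical
  obtain ⟨K, γ, hK, hγ, hline⟩ := card_resonant_line B hκ hC₀ J h l j₀ r hj₀ hl hH hhH
  obtain ⟨C₁, hC₁, hm⟩ := sum_primeWeight_bounded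
  have hl2 : 0 < Real.log 2 := Real.log_pos (by norm_num)
  have hlim := (tendsto_log_mul_rpow_neg hγ (1 / Real.log 2) 1).const_mul
    ((C₁ / κ) ^ k * (κ⁻¹ * K))
  rw [mul_zero] at hlim
  refine squeeze_zero' ?_ ?_ hlim
  · filter_upwards [eventually_ge_atTop 1] with x hx
    exact sizeBiased_nonneg hx fun p => Set.indicator_nonneg (fun _ _ => zero_le_one) _
  filter_upwards [hline, eventually_gt_atTop 1] with x hx hx1
  have hx0 : 0 < x := by linarith
  have hlx := Real.log_pos hx1
  set s := ⌊x⌋₊.primesLE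
  have h1 := sizeBiased_le_sum (k := k + 1) (x := x) (x₀ := x) (D := κ * Real.log x) hx1.le le_rfl
    (by positivity) (Φ := {p | IsResonant B κ C₀ J h l j₀ r x p}.indicator 1)
    (fun p => Set.indicator_nonneg (fun _ _ => zero_le_one) _) (fun p hp hne => by
      have hmem : IsResonant B κ C₀ J h l j₀ r x p := Set.mem_of_indicator_ne_zero hne
      rw [log_div_prod hx1 hmem.pos, mul_comm]
      have := hmem.generic.sum_le
      gcongr
      linarith)
  refine h1.trans ?_
  rw [sum_piFinset_insertNth _ l]
  have hfac : ∀ t : ℕ, Real.log t / (t * (κ * Real.log x)) = κ⁻¹ * primeWeight x t := fun t => by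
    rw [primeWeight]; field_simp
  have hw0 : ∀ t : ℕ, 0 ≤ κ⁻¹ * primeWeight x t := fun t =>
    mul_nonneg (by positivity) (primeWeight_nonneg hx1.le t)
  simp only [hfac, Fin.prod_univ_succAbove _ l, Fin.insertNth_apply_same,
    Fin.insertNth_apply_succAbove]
  have hinner : ∀ q : Fin k → ℕ, ∑ t ∈ s, (κ⁻¹ * primeWeight x t * ∏ i, κ⁻¹ * primeWeight x (q i)) *
      ({p | IsResonant B κ C₀ J h l j₀ r x p}.indicator 1 (l.insertNth t q) : ℝ) ≤
      (∏ i, κ⁻¹ * primeWeight x (q i)) *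
        (κ⁻¹ * (K * ((1 / Real.log 2 * Real.log x + 1) * x ^ (-γ)))) := by
    intro q
    have e : ∀ t ∈ s, (κ⁻¹ * primeWeight x t * ∏ i, κ⁻¹ * primeWeight x (q i)) *
        ({p | IsResonant B κ C₀ J h l j₀ r x p}.indicator 1 (l.insertNth t q) : ℝ) ≤
        (∏ i, κ⁻¹ * primeWeight x (q i)) * (κ⁻¹ * (if IsResonant B κ C₀ J h l j₀ r x
          (l.insertNth t q) then (t : ℝ)⁻¹ else 0)) := by
      intro t ht
      rw [primesLE_floor_mem hx0.le] at ht
      have ht0 : (0 : ℝ) < t := by exact_mod_cast ht.2.pos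
      have hP : 0 ≤ ∏ i, κ⁻¹ * primeWeight x (q i) := Finset.prod_nonneg fun i _ => hw0 _
      by_cases hR : IsResonant B κ C₀ J h l j₀ r x (l.insertNth t q)
      · rw [Set.indicator_of_mem (by exact hR), if_pos hR, Pi.one_apply, mul_one,
          mul_comm (κ⁻¹ * primeWeight x t)]
        refine mul_le_mul_of_nonneg_left (mul_le_mul_of_nonneg_left ?_ (by positivity)) hP
        rw [primeWeight, inv_eq_one_div, div_le_div_iff₀ (by positivity) ht0]
        have := Real.log_le_log ht0 ht.1
        nlinarith
      · rw [Set.indicator_of_notMem (by exact hR), if_neg hR]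
        simp
    refine (Finset.sum_le_sum e).trans ?_
    rw [← Finset.mul_sum, ← Finset.mul_sum]
    have hP : 0 ≤ ∏ i, κ⁻¹ * primeWeight x (q i) := Finset.prod_nonneg fun i _ => hw0 _
    refine mul_le_mul_of_nonneg_left (mul_le_mul_of_nonneg_left ?_ (by positivity)) hP
    rw [← Finset.sum_filter]
    have hdy := sum_inv_dyadic_le {t | IsResonant B κ C₀ J h l j₀ r x (l.insertNth t q)} ⌊x⌋₊
      (K * x ^ (-γ)) (fun y => by
        refine (le_of_eq ?_).trans ((hx q y).trans (le_of_eq (by ring)))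
        rfl)
    calc _ ≤ ∑ t ∈ (Finset.Icc 1 ⌊x⌋₊).filter
          (· ∈ {t | IsResonant B κ C₀ J h l j₀ r x (l.insertNth t q)}), (t : ℝ)⁻¹ := by
          refine Finset.sum_le_sum_of_subset_of_nonneg ?_ fun _ _ _ => by positivity
          intro t ht
          rw [Finset.mem_filter] at ht ⊢
          refine ⟨?_, ht.2⟩
          have := Nat.mem_primesLE.mp ht.1
          exact Finset.mem_Icc.mpr ⟨this.2.pos, this.1⟩
      _ ≤ _ := hdy
      _ ≤ _ := by
          have hlog : (Nat.log 2 ⌊x⌋₊ : ℝ) ≤ 1 / Real.log 2 * Real.log x := by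
            refine (Real.natLog_le_logb _ _).trans ?_
            rw [Real.logb, div_eq_mul_one_div, mul_comm]
            have hf : (1 : ℝ) ≤ ⌊x⌋₊ := by exact_mod_cast (Nat.one_le_floor_iff x).mpr hx1.le
            have := Real.log_le_log (by linarith) (Nat.floor_le hx0.le)
            push_cast
            gcongr
          calc _ = K * ((Nat.log 2 ⌊x⌋₊ + 1) * x ^ (-γ)) := by ring
            _ ≤ _ := by gcongr
  refine (Finset.sum_le_sum fun q _ => hinner q).trans ?_
  rw [← Finset.sum_mul]
  have hpow : ∑ q ∈ Fintype.piFinset (fun _ : Fin k => s), ∏ i, κ⁻¹ * primeWeight x (q i) ≤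
      (C₁ / κ) ^ k := by
    have e := (Finset.prod_univ_sum (fun _ : Fin k => s) fun _ t => κ⁻¹ * primeWeight x t).symm
    rw [e, Finset.prod_const, Finset.card_univ, Fintype.card_fin, ← Finset.mul_sum]
    have := hm x hx1.le
    have h0 : 0 ≤ ∑ t ∈ s, primeWeight x t :=
      Finset.sum_nonneg fun t _ => primeWeight_nonneg hx1.le t
    rw [div_eq_inv_mul]
    gcongr
  refine (mul_le_mul_of_nonneg_right hpow (by positivity)).trans (le_of_eq ?_)
  ring

/-- Separated tuples whose frequency, formed with coefficients supported on small powers,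
is close to an integer. -/
structure NearResonant {k : ℕ} (B : ℕ) (κ C₀ : ℝ) (J : ℕ) (h : Fin k → ℕ → ℤ) (x : ℝ)
    (p : Fin k → ℕ) : Prop where
  pos : ∀ i, 1 ≤ p i
  generic : GenericLogs B κ (logCoord x p)
  near : NearInt (C₀ * ((∏ i, p i : ℕ) : ℝ) / x) (phase J h p)
  small : ∀ i, ∀ j < J, h i j ≠ 0 → ((j + 2 : ℕ) : ℝ) * logCoord x p i ≤ 1

/-- The pair (l, j₀) minimises (j + 2)·log p_i over the nonzero coefficients, and `r` is then the
least admissible order. It is at most `B`, because p_l^B ≥ x exceeds the product of the tuple. -/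
lemma NearResonant.exists_isResonant {k B : ℕ} {κ C₀ : ℝ} (hκ : 0 < κ) {J : ℕ}
    {h : Fin k → ℕ → ℤ} (hne : ∃ i, ∃ j < J, h i j ≠ 0) {x : ℝ} {p : Fin k → ℕ}
    (hp : NearResonant B κ C₀ J h x p) :
    ∃ l, ∃ j₀ < J, h l j₀ ≠ 0 ∧ ∃ r < B + 1, IsResonant B κ C₀ J h l j₀ r x p := by
  classical
  obtain ⟨i₁, j₁, hj₁, hh₁⟩ := hne
  set s := ((Finset.univ : Finset (Fin k)) ×ˢ Finset.range J).filter fun z => h z.1 z.2 ≠ 0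
    with hs
  obtain ⟨z, hz, hmin⟩ := Finset.exists_min_image s
    (fun z => ((z.2 + 2 : ℕ) : ℝ) * logCoord x p z.1) ⟨(i₁, j₁), by simp [hs, hj₁, hh₁]⟩
  simp only [hs, Finset.mem_filter, Finset.mem_product, Finset.mem_univ, true_and,
    Finset.mem_range] at hz hmin
  have hv := hp.generic.lower z.1
  have hex : ∃ r : ℕ, ∑ i, logCoord x p i < ((z.2 + 2 + r : ℕ) : ℝ) * logCoord x p z.1 := by
    refine ⟨B, ?_⟩
    have h1 := hp.generic.sum_le
    have h2 := hp.generic.one_le z.1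
    push_cast
    nlinarith [mul_nonneg (Nat.cast_nonneg (α := ℝ) z.2) (hκ.le.trans hv)]
  have hB : Nat.find hex ≤ B := by
    refine Nat.find_min' hex ?_
    have h1 := hp.generic.sum_le
    have h2 := hp.generic.one_le z.1
    push_cast
    nlinarith [mul_nonneg (Nat.cast_nonneg (α := ℝ) z.2) (hκ.le.trans hv)]
  refine ⟨z.1, z.2, hz.1, hz.2, Nat.find hex, Nat.lt_succ_of_le hB, hp.pos, hp.generic, hp.near,
    hp.small, fun i j hj hh => hmin (i, j) ⟨hj, hh⟩, Nat.find_spec hex, ?_⟩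
  rcases Nat.eq_zero_or_pos (Nat.find hex) with h0 | h0
  · exact Or.inl h0
  · right
    have := Nat.find_min hex (Nat.sub_lt h0 one_pos)
    rw [not_lt] at this
    have e : z.2 + 2 + (Nat.find hex - 1) = z.2 + 1 + Nat.find hex := by omega
    rwa [e] at this

lemma tendsto_sizeBiased_nearResonant {k : ℕ} (B : ℕ) {κ : ℝ} (hκ : 0 < κ) {C₀ : ℝ}
    (hC₀ : 0 < C₀) (J : ℕ) (h : Fin k → ℕ → ℤ) (hne : ∃ i, ∃ j < J, h i j ≠ 0)
    {H : ℝ} (hH : 0 ≤ H) (hhH : ∀ i j, |(h i j : ℝ)| ≤ H) :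
    Tendsto (fun x => sizeBiased k x ({p | NearResonant B κ C₀ J h x p}.indicator 1)) atTop
      (𝓝 0) := by
  classical
  cases k with
  | zero => obtain ⟨i, _⟩ := hne; exact i.elim0
  | succ k =>
    set s := (((Finset.univ : Finset (Fin (k + 1))) ×ˢ Finset.range J).filter
      fun z => h z.1 z.2 ≠ 0) ×ˢ Finset.range (B + 1) with hs
    have hlim : Tendsto (fun x => ∑ z ∈ s, sizeBiased (k + 1) x
        ({p | IsResonant B κ C₀ J h z.1.1 z.1.2 z.2 x p}.indicator 1)) atTop (𝓝 0) := by
      have := tendsto_finsetSum s (f := fun z x => sizeBiased (k + 1) x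
        ({p | IsResonant B κ C₀ J h z.1.1 z.1.2 z.2 x p}.indicator 1)) (a := fun _ => (0 : ℝ))
        (x := atTop) fun z hz => by
          simp only [hs, Finset.mem_product, Finset.mem_filter, Finset.mem_univ, true_and,
            Finset.mem_range] at hz
          exact tendsto_sizeBiased_isResonant B hκ hC₀ J h z.1.1 z.1.2 z.2 hz.1.1 hz.1.2 hH hhH
      simpa using this
    refine squeeze_zero' ?_ ?_ hlim
    · filter_upwards [eventually_ge_atTop 1] with x hx
      exact sizeBiased_nonneg hx fun p => Set.indicator_nonneg (fun _ _ => zero_le_one) _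
    filter_upwards [eventually_ge_atTop 1] with x hx
    rw [← sizeBiased_sum]
    refine sizeBiased_mono hx fun p _ _ => ?_
    have hnn : ∀ z ∈ s, (0 : ℝ) ≤ ({p | IsResonant B κ C₀ J h z.1.1 z.1.2 z.2 x p}.indicator 1 p) :=
      fun z _ => Set.indicator_nonneg (fun _ _ => zero_le_one) _
    by_cases hp : NearResonant B κ C₀ J h x p
    · obtain ⟨l, j₀, hj₀, hl, r, hr, hR⟩ := hp.exists_isResonant hκ hne
      have hmem : ((l, j₀), r) ∈ s := by
        simp [hs, hj₀, hl]; omega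
      refine le_trans ?_ (Finset.single_le_sum hnn hmem)
      rw [Set.indicator_of_mem (by exact hp), Set.indicator_of_mem (by exact hR)]
    · rw [Set.indicator_of_notMem (by exact hp)]
      exact Finset.sum_nonneg hnn

/-! ### Exponential sums and equidistribution on the torus. -/

/-- The additive character `e(θ) = exp (2πiθ)`. -/
noncomputable def expChar (θ : ℝ) : ℂ := Complex.exp (2 * Real.pi * Complex.I * θ)

/-- Geometric sum: the numerator has norm at most 2, and |w - 1| = 2|sin πd| ≥ 4|d|, where |d| is
the distance from θ to the nearest integer. -/
lemma norm_sum_expChar_le {θ δ : ℝ} (hδ : 0 < δ) (hθ : ¬ NearInt δ θ) (M : ℕ) :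
    ‖∑ m ∈ Finset.Icc 1 M, expChar (m * θ)‖ ≤ 1 / (2 * δ) := by
  set w := expChar θ with hw
  have hpow : ∀ m : ℕ, expChar (m * θ) = w ^ m := fun m => by
    rw [hw, expChar, expChar, ← Complex.exp_nat_mul]
    congr 1
    push_cast
    ring
  have hnorm : ‖w‖ = 1 := by
    rw [hw, expChar, Complex.norm_exp]
    simp
  have hlow : 4 * δ ≤ ‖w - 1‖ := by
    set d := θ - round θ with hd
    have hd2 : |d| ≤ 1 / 2 := abs_sub_round θ
    have hd1 : δ ≤ |d| := by
      by_contra hcon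
      exact hθ ⟨round θ, (not_le.mp hcon).le⟩
    have e : w = Complex.exp (Complex.I * ((2 * Real.pi * d : ℝ) : ℂ)) := by
      rw [hw, expChar, hd]
      rw [Complex.exp_eq_exp_iff_exists_int]
      refine ⟨round θ, ?_⟩
      push_cast
      ring
    rw [e, Complex.norm_exp_I_mul_ofReal_sub_one]
    have h1 : Real.sin (2 * Real.pi * d / 2) = Real.sin (Real.pi * d) := by
      congr 1; ring
    rw [h1, norm_mul, Real.norm_eq_abs, Real.norm_eq_abs, abs_two]
    have h2 : |Real.sin (Real.pi * d)| = Real.sin (Real.pi * |d|) := by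
      rcases le_total 0 d with h0 | h0
      · rw [abs_of_nonneg h0] at hd2 ⊢
        exact abs_of_nonneg (Real.sin_nonneg_of_nonneg_of_le_pi (by positivity)
          (by nlinarith [Real.pi_pos]))
      · rw [abs_of_nonpos h0] at hd2 ⊢
        rw [mul_neg, Real.sin_neg, abs_of_nonpos]
        have := Real.sin_nonneg_of_nonneg_of_le_pi (x := Real.pi * (-d))
          (mul_nonneg Real.pi_pos.le (by linarith)) (by nlinarith [Real.pi_pos])
        rw [mul_neg, Real.sin_neg] at this
        linarith
    rw [h2]
    have h3 := Real.mul_le_sin (x := Real.pi * |d|) (by positivity) (by nlinarith [Real.pi_pos])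
    have h4 : 2 / Real.pi * (Real.pi * |d|) = 2 * |d| := by
      have := Real.pi_pos.ne'
      field_simp
    linarith
  have hne : w - 1 ≠ 0 := fun h0 => by rw [h0, norm_zero] at hlow; linarith
  have hsum : ∑ m ∈ Finset.Icc 1 M, expChar (m * θ) = w * ((w ^ M - 1) / (w - 1)) := by
    rw [← geom_sum_eq (sub_ne_zero.mp hne), Finset.mul_sum, Finset.range_eq_Ico,
      Finset.sum_Ico_eq_sum_range]
    have : Finset.Icc 1 M = Finset.Ico 1 (M + 1) := by ext; simp
    rw [this, Finset.sum_Ico_eq_sum_range]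
    refine Finset.sum_congr (by simp) fun m _ => ?_
    rw [hpow]
    ring
  rw [hsum, norm_mul, norm_div, hnorm, one_mul]
  have hnum : ‖w ^ M - 1‖ ≤ 2 := by
    refine (norm_sub_le _ _).trans ?_
    rw [norm_pow, hnorm]; norm_num
  calc ‖w ^ M - 1‖ / ‖w - 1‖ ≤ 2 / (4 * δ) := by gcongr
    _ = 1 / (2 * δ) := by field_simp; ring

instance : IsProbabilityMeasure (volume : Measure UnitAddCircle) :=
  ⟨UnitAddCircle.measure_univ⟩

lemma volume_singleton_unitAddCircle (z : UnitAddCircle) : volume {z} = 0 := by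
  have hmp := UnitAddCircle.measurePreserving_mk 0
  rw [← hmp.measure_preimage (measurableSet_singleton z).nullMeasurableSet,
    Measure.restrict_apply (hmp.measurable (measurableSet_singleton z))]
  refine Set.Subsingleton.measure_zero (fun a ha b hb => ?_) _
  exact (AddCircle.coe_eq_coe_iff_of_mem_Ioc (p := (1 : ℝ)) (a := 0) ha.2 hb.2).mp
    (ha.1.trans hb.1.symm)

section Torus

variable {ι : Type}

/-- The empirical distribution of the multiples `m α`, `1 ≤ m ≤ M`, on the torus. -/
noncomputable def empirical (M : ℕ) (α : ι → ℝ) : Measure (UnitAddTorus ι) :=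
  (M : ENNReal)⁻¹ • ∑ m ∈ Finset.Icc 1 M, Measure.dirac (fun a => ((m * α a : ℝ) : UnitAddCircle))

lemma isProbabilityMeasure_empirical {M : ℕ} (hM : 1 ≤ M) (α : ι → ℝ) :
    IsProbabilityMeasure (empirical M α) := by
  constructor
  rw [empirical, Measure.smul_apply, Measure.finsetSum_apply]
  simp only [measure_univ, Finset.sum_const, Nat.card_Icc, Nat.add_sub_cancel, smul_eq_mul,
    nsmul_eq_mul, mul_one]
  exact ENNReal.inv_mul_cancel (by simp; omega) (ENNReal.natCast_ne_top M)

variable [Fintype ι]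

lemma integral_empirical (M : ℕ) (α : ι → ℝ) (f : C(UnitAddTorus ι, ℂ)) :
    ∫ z, f z ∂empirical M α =
      (M : ℂ)⁻¹ * ∑ m ∈ Finset.Icc 1 M, f (fun a => ((m * α a : ℝ) : UnitAddCircle)) := by
  rw [empirical, integral_smul_measure, integral_finsetSum_measure]
  · simp [integral_dirac]
  · intro m _
    exact integrable_dirac (by simp)

lemma mFourier_coe (n : ι → ℤ) (y : ι → ℝ) :
    UnitAddTorus.mFourier n (fun a => (y a : UnitAddCircle)) = expChar (∑ a, n a * y a) := by
  rw [UnitAddTorus.mFourier, ContinuousMap.coe_mk, expChar]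
  simp only [fourier_coe_apply]
  rw [← Complex.exp_sum]
  congr 1
  push_cast
  rw [Finset.mul_sum]
  refine Finset.sum_congr rfl fun a _ => ?_
  ring

/-- In a coordinate with nonzero frequency, a suitable translation reverses the sign of the
character. -/
lemma integral_mFourier_eq_zero {n : ι → ℤ} (hn : n ≠ 0) :
    ∫ z, UnitAddTorus.mFourier n z = 0 := by
  obtain ⟨i, hi⟩ := Function.ne_iff.mp hn
  rw [UnitAddTorus.mFourier, ContinuousMap.coe_mk,
    MeasureTheory.integral_fintype_prod_volume_eq_prod (fun i (z : UnitAddCircle) =>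
      (fourier (n i) z : ℂ))]
  refine Finset.prod_eq_zero (Finset.mem_univ i) ?_
  exact integral_eq_zero_of_add_right_eq_neg (μ := (volume : Measure UnitAddCircle))
    (fun z => fourier_add_half_inv_index hi one_pos z)

/-- The arc `[1/2, 1)` of the circle. -/
def halfArc : Set UnitAddCircle := {z | (1 / 2 : ℝ) ≤ (AddCircle.equivIco (1 : ℝ) 0 z : ℝ)}

lemma coe_mem_halfArc (y : ℝ) : (y : UnitAddCircle) ∈ halfArc ↔ 1 / 2 ≤ Int.fract y := by
  have := AddCircle.coe_equivIco_mk_apply (p := (1 : ℝ)) y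
  rw [div_one, mul_one] at this
  rw [halfArc, Set.mem_ofPred_eq, ← this]

lemma frontier_halfArc_subset :
    frontier halfArc ⊆ {(0 : UnitAddCircle), ((1 / 2 : ℝ) : UnitAddCircle)} := by
  intro z hz
  by_contra hcon
  simp only [Set.mem_insert_iff, Set.mem_singleton_iff, not_or] at hcon
  have hc : ContinuousAt (fun z => (AddCircle.equivIco (1 : ℝ) 0 z : ℝ)) z :=
    continuousAt_subtype_val.comp (AddCircle.continuousAt_equivIco 1 0 (by simpa using hcon.1))
  have hne : (AddCircle.equivIco (1 : ℝ) 0 z : ℝ) ≠ 1 / 2 := by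
    intro h
    apply hcon.2
    rw [← h]
    exact (AddCircle.coe_equivIco (p := (1 : ℝ)) (a := 0)).symm
  rw [frontier_eq_closure_inter_closure] at hz
  rcases lt_or_gt_of_ne hne with h | h
  · have hev := hc.eventually (gt_mem_nhds h)
    obtain ⟨y, hy1, hy2⟩ := ((mem_closure_iff_frequently.mp hz.1).and_eventually hev).exists
    exact absurd hy1 (not_le.mpr hy2)
  · have hev := hc.eventually (lt_mem_nhds h)
    obtain ⟨y, hy1, hy2⟩ := ((mem_closure_iff_frequently.mp hz.2).and_eventually hev).exists
    exact hy1 hy2.le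

lemma volume_frontier_halfArc : volume (frontier halfArc) = 0 := by
  refine measure_mono_null frontier_halfArc_subset ?_
  rw [Set.insert_eq]
  exact measure_union_null (volume_singleton_unitAddCircle _) (volume_singleton_unitAddCircle _)

lemma measurableSet_halfArc : MeasurableSet halfArc :=
  measurableSet_le measurable_const
    (measurable_subtype_coe.comp (AddCircle.measurableEquivIco (1 : ℝ) 0).measurable)

lemma volume_halfArc : volume halfArc = 1 / 2 := by
  have hmp := UnitAddCircle.measurePreserving_mk 0
  rw [← hmp.measure_preimage measurableSet_halfArc.nullMeasurableSet,
    Measure.restrict_apply (hmp.measurable measurableSet_halfArc)]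
  have : ((fun y : ℝ => (y : UnitAddCircle)) ⁻¹' halfArc) ∩ Set.Ioc (0 : ℝ) (0 + 1) =
      Set.Ico (1 / 2) 1 := by
    ext y
    simp only [Set.mem_inter_iff, Set.mem_preimage, coe_mem_halfArc, Set.mem_Ioc, Set.mem_Ico,
      zero_add]
    constructor
    · rintro ⟨h1, h2, h3⟩
      rcases h3.lt_or_eq with h4 | h4
      · rw [Int.fract_eq_self.mpr ⟨h2.le, h4⟩] at h1
        exact ⟨h1, h4⟩
      · rw [h4, Int.fract_one] at h1
        norm_num at h1
    · rintro ⟨h1, h2⟩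
      rw [Int.fract_eq_self.mpr ⟨by linarith, h2⟩]
      exact ⟨h1, by linarith, h2.le⟩
  rw [this, Real.volume_Ico]
  rw [show (1 : ℝ) - 1 / 2 = 1 / 2 by norm_num]
  rw [ENNReal.ofReal_div_of_pos (by norm_num)]
  simp

open scoped Classical in
/-- Points whose coordinates in the upper half circle are exactly those in `A`. -/
noncomputable def patternSet (A : Finset ι) : Set (UnitAddTorus ι) :=
  Set.univ.pi fun a => if a ∈ A then halfArc else halfArcᶜ

lemma volume_patternSet (A : Finset ι) :
    volume (patternSet A) = (1 / 2) ^ Fintype.card ι := by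
  classical
  rw [patternSet, volume_pi_pi]
  rw [Finset.prod_congr rfl (g := fun _ => (1 / 2 : ENNReal)), Finset.prod_const, Finset.card_univ]
  intro a _
  split_ifs
  · exact volume_halfArc
  · rw [prob_compl_eq_one_sub measurableSet_halfArc, volume_halfArc]
    simp

lemma measurableSet_patternSet (A : Finset ι) : MeasurableSet (patternSet A) := by
  classical
  refine MeasurableSet.univ_pi fun a => ?_
  split_ifs
  · exact measurableSet_halfArc
  · exact measurableSet_halfArc.compl

lemma volume_frontier_patternSet (A : Finset ι) : volume (frontier (patternSet A)) = 0 := by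
  classical
  have hsub : frontier (patternSet A) ⊆ ⋃ a : ι, Function.eval a ⁻¹' frontier halfArc := by
    intro z hz
    rw [patternSet, frontier, closure_pi_set, interior_pi_set Set.finite_univ] at hz
    obtain ⟨h1, h2⟩ := hz
    simp only [Set.mem_pi, Set.mem_univ, true_imp_iff, not_forall] at h1 h2
    obtain ⟨a, ha⟩ := h2
    rw [Set.mem_iUnion]
    refine ⟨a, ?_⟩
    have h3 := h1 a
    rw [Set.mem_preimage]
    by_cases hA : a ∈ A
    · simp only [hA, if_true] at h3 ha
      exact ⟨h3, ha⟩
    · simp only [hA, if_false] at h3 ha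
      rw [← frontier_compl]
      exact ⟨h3, ha⟩
  refine measure_mono_null hsub (measure_iUnion_null fun a => ?_)
  exact (measurePreserving_eval (fun _ : ι => (volume : Measure UnitAddCircle)) a
    ).quasiMeasurePreserving.preimage_null
    volume_frontier_halfArc

/-- Convergence of all Fourier coefficients implies convergence on pattern sets. -/
lemma tendsto_empirical_patternSet {Ix : Type*} {L : Filter Ix} (M : Ix → ℕ) (hM : ∀ i, 1 ≤ M i)
    (α : Ix → ι → ℝ)
    (h : ∀ n : ι → ℤ, n ≠ 0 → Tendsto (fun i => ((M i : ℕ) : ℂ)⁻¹ *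
      ∑ m ∈ Finset.Icc 1 (M i), expChar (m * ∑ a, n a * α i a)) L (𝓝 0)) (A : Finset ι) :
    Tendsto (fun i => (empirical (M i) (α i)).real (patternSet A)) L
      (𝓝 ((1 / 2) ^ Fintype.card ι)) := by
  have hprob : ∀ i, IsProbabilityMeasure (empirical (M i) (α i)) := fun i =>
    isProbabilityMeasure_empirical (hM i) _
  set μs : Ix → ProbabilityMeasure (UnitAddTorus ι) := fun i => ⟨empirical (M i) (α i), hprob i⟩
    with hμs
  set μ : ProbabilityMeasure (UnitAddTorus ι) := ⟨volume, inferInstance⟩ with hμ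
  -- The characters span a dense subspace, so convergence of Fourier coefficients gives weak
  -- convergence; pattern sets have null boundary, so their measures converge too.
  have hcont : ∀ f : C(UnitAddTorus ι, ℂ),
      Tendsto (fun i => ∫ z, f z ∂empirical (M i) (α i)) L (𝓝 (∫ z, f z)) := by
    have hspan : ∀ g ∈ Submodule.span ℂ (Set.range (UnitAddTorus.mFourier (d := ι))),
        Tendsto (fun i => ∫ z, g z ∂empirical (M i) (α i)) L (𝓝 (∫ z, g z)) := by
      have hint : ∀ (g : C(UnitAddTorus ι, ℂ)) (ν : Measure (UnitAddTorus ι)) [IsFiniteMeasure ν],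
          Integrable g ν := fun g ν _ => g.continuous.integrable_of_hasCompactSupport
            (HasCompactSupport.of_compactSpace _)
      intro g hg
      induction hg using Submodule.span_induction with
      | mem g hg =>
        obtain ⟨n, rfl⟩ := hg
        by_cases hn : n = 0
        · subst hn
          simp [UnitAddTorus.mFourier_zero, tendsto_const_nhds]
        · rw [integral_mFourier_eq_zero hn]
          refine (h n hn).congr fun i => ?_
          rw [integral_empirical]
          congr 1
          refine Finset.sum_congr rfl fun m _ => ?_
          rw [mFourier_coe, Finset.mul_sum]
          congr 1
          exact Finset.sum_congr rfl fun a _ => by ring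
      | zero => simp [tendsto_const_nhds]
      | add f g _ _ hf hg =>
        simp only [ContinuousMap.add_apply]
        rw [integral_add (hint f _) (hint g _)]
        refine (hf.add hg).congr fun i => ?_
        rw [integral_add (hint f _) (hint g _)]
      | smul c f _ hf =>
        simp only [ContinuousMap.smul_apply, smul_eq_mul, integral_const_mul]
        exact hf.const_mul c
    intro f
    have hf : f ∈ (Submodule.span ℂ (Set.range (UnitAddTorus.mFourier (d := ι)))).topologicalClosure
        := by rw [UnitAddTorus.span_mFourier_closure_eq_top]; trivial
    rw [← SetLike.mem_coe, Submodule.topologicalClosure_coe, Metric.mem_closure_iff] at hf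
    rw [Metric.tendsto_nhds]
    intro ε hε
    obtain ⟨g, hg, hfg⟩ := hf (ε / 3) (by positivity)
    have hclose : ∀ (ν : Measure (UnitAddTorus ι)) [IsProbabilityMeasure ν],
        dist (∫ z, f z ∂ν) (∫ z, g z ∂ν) ≤ ε / 3 := by
      intro ν _
      rw [dist_eq_norm, ← integral_sub]
      · refine (norm_integral_le_of_norm_le_const (C := ε / 3) (Eventually.of_forall fun z => ?_)
          ).trans (by simp)
        rw [← dist_eq_norm]
        exact (ContinuousMap.dist_apply_le_dist z).trans hfg.le
      · exact f.continuous.integrable_of_hasCompactSupport (HasCompactSupport.of_compactSpace _)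
      · exact g.continuous.integrable_of_hasCompactSupport (HasCompactSupport.of_compactSpace _)
    filter_upwards [Metric.tendsto_nhds.mp (hspan g hg) (ε / 3) (by positivity)] with i hi
    have h1 := hclose (empirical (M i) (α i))
    have h2 := hclose (volume : Measure (UnitAddTorus ι))
    rw [dist_comm] at h2
    have h3 := dist_triangle4 (∫ z, f z ∂empirical (M i) (α i))
      (∫ z, g z ∂empirical (M i) (α i)) (∫ z, g z) (∫ z, f z)
    linarith
  have hlim : Tendsto μs L (𝓝 μ) := by
    rw [ProbabilityMeasure.tendsto_iff_forall_integral_rclike_tendsto ℂ]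
    intro f
    exact hcont f.toContinuousMap
  have := ProbabilityMeasure.tendsto_measure_of_null_frontier_of_tendsto' hlim
    (E := patternSet A) (volume_frontier_patternSet A)
  have h2 := (ENNReal.tendsto_toReal (measure_ne_top _ _)).comp this
  have h3 : (((μ : Measure (UnitAddTorus ι)) (patternSet A))).toReal =
      (1 / 2) ^ Fintype.card ι := by
    change ((volume : Measure (UnitAddTorus ι)) (patternSet A)).toReal = _
    rw [volume_patternSet]
    simp
  rw [h3] at h2
  exact h2

open scoped Classical in
lemma empirical_real_patternSet {M : ℕ} (α : ι → ℝ) (A : Finset ι) :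
    (empirical M α).real (patternSet A) =
      (((Finset.Icc 1 M).filter fun m : ℕ =>
        (Finset.univ.filter fun a => 1 / 2 ≤ Int.fract (m * α a)) = A).card : ℝ) / M := by
  have hmem : ∀ m : ℕ, (fun a => ((m * α a : ℝ) : UnitAddCircle)) ∈ patternSet A ↔
      (Finset.univ.filter fun a => 1 / 2 ≤ Int.fract (m * α a)) = A := by
    intro m
    rw [patternSet, Set.mem_univ_pi, Finset.ext_iff]
    refine forall_congr' fun a => ?_
    by_cases hA : a ∈ A
    · simp only [hA, if_true, Finset.mem_filter, Finset.mem_univ, true_and, iff_true]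
      exact coe_mem_halfArc _
    · simp only [hA, if_false, Finset.mem_filter, Finset.mem_univ, true_and, iff_false,
        Set.mem_compl_iff]
      exact not_congr (coe_mem_halfArc _)
  rw [Measure.real, empirical, Measure.smul_apply, Measure.finsetSum_apply]
  simp only [Measure.dirac_apply' _ (measurableSet_patternSet A), Set.indicator_apply, hmem,
    Pi.one_apply, Finset.sum_boole, smul_eq_mul, ENNReal.toReal_mul, ENNReal.toReal_inv,
    ENNReal.toReal_natCast]
  exact (div_eq_inv_mul _ _).symm

open scoped Classical in
/-- Quantitative equidistribution of the pattern of upper-half coordinates. -/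
lemma exists_frequencies (ε : ℝ) (hε : 0 < ε) :
    ∃ (S : Finset (ι → ℤ)) (η : ℝ), 0 < η ∧ (∀ n ∈ S, n ≠ 0) ∧ ∀ M : ℕ, 1 ≤ M → ∀ α : ι → ℝ,
      (∀ n ∈ S, ‖∑ m ∈ Finset.Icc 1 M, expChar (m * ∑ a, n a * α a)‖ ≤ η * M) →
      ∀ A : Finset ι, |(((Finset.Icc 1 M).filter fun m : ℕ =>
        (Finset.univ.filter fun a => 1 / 2 ≤ Int.fract (m * α a)) = A).card : ℝ) / M -
          (1 / 2) ^ Fintype.card ι| ≤ ε := by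
  -- Compactness: counterexamples indexed by pairs (finite set of frequencies, integer) would have
  -- every nonzero Fourier coefficient tending to 0 while some pattern frequency stays off by more
  -- than ε.
  by_contra hcon
  push Not at hcon
  have hc := fun i : Finset (ι → ℤ) × ℕ => hcon (i.1.erase 0) (1 / ((i.2 : ℝ) + 1)) (by positivity)
    (fun n hn => Finset.ne_of_mem_erase hn)
  choose M hM α hα A hA using hc
  have hF : ∀ n : ι → ℤ, n ≠ 0 → Tendsto (fun i => ((M i : ℕ) : ℂ)⁻¹ *
      ∑ m ∈ Finset.Icc 1 (M i), expChar (m * ∑ a, n a * α i a)) atTop (𝓝 0) := by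
    intro n hn
    have hlim : Tendsto (fun i : Finset (ι → ℤ) × ℕ => 1 / ((i.2 : ℝ) + 1)) atTop (𝓝 0) := by
      rw [← prod_atTop_atTop_eq]
      exact tendsto_one_div_add_atTop_nhds_zero_nat.comp tendsto_snd
    refine squeeze_zero_norm' ?_ hlim
    have hev : ∀ᶠ i : Finset (ι → ℤ) × ℕ in atTop, {n} ⊆ i.1 := by
      rw [← prod_atTop_atTop_eq]
      exact tendsto_fst.eventually (eventually_ge_atTop ({n} : Finset (ι → ℤ)))
    filter_upwards [hev] with i hi
    have h1 := hα i n (Finset.mem_erase.mpr ⟨hn, hi (Finset.mem_singleton_self n)⟩)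
    have hM0 : (0 : ℝ) < M i := by exact_mod_cast hM i
    rw [norm_mul, norm_inv, Complex.norm_natCast, inv_mul_le_iff₀ hM0]
    linarith
  have hT : ∀ B : Finset ι, ∀ᶠ i in (atTop : Filter (Finset (ι → ℤ) × ℕ)),
      |(empirical (M i) (α i)).real (patternSet B) - (1 / 2) ^ Fintype.card ι| ≤ ε := by
    intro B
    have := tendsto_empirical_patternSet M hM α hF B
    filter_upwards [Metric.tendsto_nhds.mp this ε hε] with i hi
    exact hi.le
  obtain ⟨i, hi⟩ := (eventually_all.mpr hT).exists
  have h1 := hi (A i)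
  rw [empirical_real_patternSet] at h1
  exact absurd h1 (not_le.mpr (hA i))

end Torus

/-! ### Carry patterns as subsets. -/

/-- `carryFactor ℓ b` is the probability that `b` fair coins show at least `ℓ` heads. -/
lemma card_filter_le_card (ℓ b : ℕ) :
    (((Finset.univ : Finset (Finset (Fin b))).filter fun B => ℓ ≤ B.card).card : ℝ) =
      2 ^ b * carryFactor ℓ b := by
  have h1 : ((Finset.univ : Finset (Finset (Fin b))).filter fun B => ¬ ℓ ≤ B.card).card =
      ∑ h ∈ Finset.range ℓ, b.choose h := by
    rw [Finset.card_eq_sum_card_fiberwise (f := Finset.card) (t := Finset.range ℓ)]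
    · refine Finset.sum_congr rfl fun h hh => ?_
      rw [Finset.filter_filter]
      have : ((Finset.univ : Finset (Finset (Fin b))).filter fun B => ¬ ℓ ≤ B.card ∧ B.card = h) =
          Finset.powersetCard h Finset.univ := by
        ext B
        simp only [Finset.mem_filter, Finset.mem_univ, true_and, Finset.mem_powersetCard,
          Finset.subset_univ, not_le, and_iff_right_iff_imp]
        intro hB
        rw [hB]
        exact Finset.mem_range.mp hh
      rw [this, Finset.card_powersetCard, Finset.card_univ, Fintype.card_fin]
    · intro B hB
      simpa using hB
  have h2 := Finset.card_filter_add_card_filter_not (s := (Finset.univ : Finset (Finset (Fin b))))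
    (fun B => ℓ ≤ B.card)
  rw [h1, Finset.card_univ, Fintype.card_finset, Fintype.card_fin] at h2
  have h3 : (((Finset.univ : Finset (Finset (Fin b))).filter fun B => ℓ ≤ B.card).card : ℝ) +
      ∑ h ∈ Finset.range ℓ, (b.choose h : ℝ) = 2 ^ b := by exact_mod_cast h2
  have h4 : (2 : ℝ) ^ b ≠ 0 := by positivity
  rw [carryFactor]
  field_simp
  linarith

lemma carryFactor_nonneg (ℓ b : ℕ) : 0 ≤ carryFactor ℓ b := by
  have h := card_filter_le_card ℓ b
  have h2 : (0 : ℝ) < 2 ^ b := by positivity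
  by_contra hcon
  have := mul_neg_of_pos_of_neg h2 (not_le.mp hcon)
  rw [← h] at this
  exact absurd this (not_lt.mpr (Nat.cast_nonneg _))

lemma carryFactor_le_one (ℓ b : ℕ) : carryFactor ℓ b ≤ 1 := by
  rw [carryFactor, sub_le_self_iff]
  positivity

/-- For every `i`, at least `ℓ` of the numbers `m (∏ p) / p i ^ (j + 2)`, `j < g i`, have fractional
part at least `1 / 2`. -/
def ManyCarries {k : ℕ} (ℓ : ℕ) (g p : Fin k → ℕ) (m : ℕ) : Prop :=
  ∀ i, ℓ ≤ Nat.card {j : Fin (g i) //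
    1 / 2 ≤ Int.fract ((m : ℝ) * (((∏ i, p i : ℕ) : ℝ) / (p i : ℝ) ^ ((j : ℕ) + 2)))}

open scoped Classical in
lemma card_good_patterns {k : ℕ} (ℓ : ℕ) (g : Fin k → ℕ) :
    (((Finset.univ : Finset (Finset (Σ i, Fin (g i)))).filter fun A =>
      ∀ i, ℓ ≤ (Finset.univ.filter fun j => (⟨i, j⟩ : Σ i, Fin (g i)) ∈ A).card).card : ℝ) =
      2 ^ (∑ i, g i) * ∏ i, carryFactor ℓ (g i) := by
  have h : ((Finset.univ : Finset (Finset (Σ i, Fin (g i)))).filter fun A =>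
      ∀ i, ℓ ≤ (Finset.univ.filter fun j => (⟨i, j⟩ : Σ i, Fin (g i)) ∈ A).card).card =
      (Fintype.piFinset fun i =>
        (Finset.univ : Finset (Finset (Fin (g i)))).filter fun B => ℓ ≤ B.card).card := by
    refine Finset.card_nbij' (fun A i => Finset.univ.filter fun j => (⟨i, j⟩ : Σ i, Fin (g i)) ∈ A)
      (fun B => Finset.univ.sigma B) ?_ ?_ ?_ ?_
    · intro A hA
      simpa [Fintype.mem_piFinset] using hA
    · intro B hB
      have hB' : ∀ i, ℓ ≤ (B i).card := by simpa [Fintype.mem_piFinset] using hB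
      have hf : ∀ i, (Finset.univ.filter fun j => j ∈ B i) = B i := fun i => by ext; simp
      simpa [hf] using hB'
    · intro A _
      ext ⟨i, j⟩
      simp
    · intro B _
      funext i
      ext j
      simp
  rw [h, Fintype.card_piFinset, Nat.cast_prod]
  simp only [card_filter_le_card]
  rw [Finset.prod_mul_distrib, Finset.prod_pow_eq_pow_sum]

open scoped Classical in
/-- Equidistribution of the carry pattern, provided finitely many phases are far from integers. -/
lemma exists_phases {k : ℕ} (ℓ J : ℕ) (g : Fin k → ℕ) (hg : ∀ i, g i ≤ J) {ε : ℝ} (hε : 0 < ε) :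
    ∃ (S : Finset (Fin k → ℕ → ℤ)) (C₀ : ℝ), 0 < C₀ ∧
      (∀ h ∈ S, (∃ i, ∃ j < J, h i j ≠ 0) ∧ ∀ i j, h i j ≠ 0 → j < g i) ∧
      ∀ M : ℕ, 1 ≤ M → ∀ p : Fin k → ℕ, ∀ δ : ℝ, C₀ / M ≤ δ →
        (∀ h ∈ S, ¬ NearInt δ (phase J h p)) →
        |(((Finset.Icc 1 M).filter fun m => ManyCarries ℓ g p m).card : ℝ) / M -
          ∏ i, carryFactor ℓ (g i)| ≤ ε := by
  set N : ℕ := (Finset.univ : Finset (Finset (Σ i, Fin (g i)))).card with hN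
  have hN0 : (0 : ℝ) < N := by
    rw [hN]; exact_mod_cast Finset.card_pos.mpr ⟨∅, Finset.mem_univ _⟩
  obtain ⟨S, η, hη, hS0, hS⟩ := exists_frequencies (ι := Σ i, Fin (g i)) (ε / N) (by positivity)
  -- The torus has one coordinate for each pair (i, j) with j < g i; a frequency on it is extended
  -- by zero to a coefficient family for `phase`.
  set T : ((Σ i, Fin (g i)) → ℤ) → Fin k → ℕ → ℤ :=
    fun n i j => if hj : j < g i then n ⟨i, ⟨j, hj⟩⟩ else 0 with hT
  have hphase : ∀ n p, phase J (T n) p =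
      ∑ a : (Σ i, Fin (g i)), (n a : ℝ) *
        (((∏ i, p i : ℕ) : ℝ) / (p a.1 : ℝ) ^ ((a.2 : ℕ) + 2)) := by
    intro n p
    rw [phase, Fintype.sum_sigma]
    refine Finset.sum_congr rfl fun i _ => ?_
    rw [← Finset.sum_subset (Finset.range_subset_range.mpr (hg i)), Finset.sum_range]
    · refine Finset.sum_congr rfl fun j _ => ?_
      simp [hT]
    · intro j _ hj
      simp only [Finset.mem_range] at hj
      simp [hT, hj]
  -- Away from integers by δ, the geometric sums are at most 1/(2δ), which is at most ηM as soon as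
  -- δ ≥ 1/(2ηM).
  refine ⟨S.image T, 1 / (2 * η), by positivity, ?_, ?_⟩
  · intro h hh
    obtain ⟨n, hn, rfl⟩ := Finset.mem_image.mp hh
    constructor
    · obtain ⟨⟨i, j⟩, hij⟩ := Function.ne_iff.mp (hS0 n hn)
      refine ⟨i, j, j.2.trans_le (hg i), ?_⟩
      simpa [hT] using hij
    · intro i j hij
      by_contra hj
      simp [hT, hj] at hij
  · intro M hM p δ hδ hnear
    have hM0 : (0 : ℝ) < M := by exact_mod_cast hM
    have hδ0 : 0 < δ := lt_of_lt_of_le (by positivity) hδ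
    set α : (Σ i, Fin (g i)) → ℝ :=
      fun a => ((∏ i, p i : ℕ) : ℝ) / (p a.1 : ℝ) ^ ((a.2 : ℕ) + 2) with hα
    have hpat := hS M hM α (fun n hn => by
      have h1 := norm_sum_expChar_le hδ0 (hnear (T n) (Finset.mem_image_of_mem _ hn)) M
      rw [hphase] at h1
      refine h1.trans ?_
      rw [div_le_iff₀ (by positivity)]
      rw [div_le_iff₀ hM0, div_le_iff₀ (by positivity)] at hδ
      linarith)
    set G := (Finset.univ : Finset (Finset (Σ i, Fin (g i)))).filter fun A =>
      ∀ i, ℓ ≤ (Finset.univ.filter fun j => (⟨i, j⟩ : Σ i, Fin (g i)) ∈ A).card with hG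
    set pat : ℕ → Finset (Σ i, Fin (g i)) :=
      fun m => Finset.univ.filter fun a => 1 / 2 ≤ Int.fract (m * α a) with hpatdef
    have hmany : ∀ m, ManyCarries ℓ g p m ↔ pat m ∈ G := by
      intro m
      rw [ManyCarries, hG, Finset.mem_filter]
      simp only [Finset.mem_univ, true_and, hpatdef, Finset.mem_filter, Nat.card_eq_fintype_card,
        Fintype.card_subtype, hα]
    have hcount : (((Finset.Icc 1 M).filter fun m => ManyCarries ℓ g p m).card : ℝ) =
        ∑ A ∈ G, (((Finset.Icc 1 M).filter fun m => pat m = A).card : ℝ) := by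
      rw [← Nat.cast_sum]
      congr 1
      rw [Finset.card_eq_sum_card_fiberwise (f := pat) (t := G)]
      · refine Finset.sum_congr rfl fun A hA => ?_
        rw [Finset.filter_filter]
        congr 1
        refine Finset.filter_congr fun m _ => ?_
        rw [hmany]
        exact ⟨fun h => h.2, fun h => ⟨h ▸ hA, h⟩⟩
      · intro m hm
        exact (hmany m).mp (Finset.mem_filter.mp hm).2
    have hprod : ∏ i, carryFactor ℓ (g i) =
        ∑ A ∈ G, (1 / 2 : ℝ) ^ Fintype.card (Σ i, Fin (g i)) := by
      rw [Finset.sum_const, nsmul_eq_mul, card_good_patterns, Fintype.card_sigma]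
      simp only [Fintype.card_fin]
      rw [mul_comm, ← mul_assoc, ← mul_pow]
      norm_num
    rw [hcount, hprod, Finset.sum_div, ← Finset.sum_sub_distrib]
    have hle : ∀ A ∈ G, |(((Finset.Icc 1 M).filter fun m => pat m = A).card : ℝ) / M -
        (1 / 2 : ℝ) ^ Fintype.card (Σ i, Fin (g i))| ≤ ε / N := fun A _ => by
      convert hpat A
    refine (Finset.abs_sum_le_sum_abs _ _).trans ((Finset.sum_le_sum hle).trans ?_)
    rw [Finset.sum_const, nsmul_eq_mul]
    have : (G.card : ℝ) ≤ N := by exact_mod_cast Finset.card_le_card (Finset.subset_univ _)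
    calc (G.card : ℝ) * (ε / N) ≤ N * (ε / N) := by gcongr
      _ = ε := by field_simp

/-! ### Carries, and obstructions from small primes. -/

/-- The number of exponents `1 ≤ i ≤ D` at which adding `n` to itself in base `q` carries. -/
def carryCount (q D n : ℕ) : ℕ := ((Finset.Icc 1 D).filter fun i => q ^ i ≤ 2 * (n % q ^ i)).card

/-- The exponent of `q` in the central binomial coefficient of `n`. -/
noncomputable def centralVal (q n : ℕ) : ℕ := ((2 * n).choose n).factorization q

/-- Kummer's theorem; exponents above `b` cannot carry, since q^(b+1) exceeds 2n. -/
lemma centralVal_eq {q n b : ℕ} (hq : q.Prime) (hb : 2 * n < q ^ (b + 1)) :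
    centralVal q n = carryCount q b n := by
  rw [centralVal, two_mul, Nat.factorization_choose' hq (b := b + 1), carryCount]
  · have : Finset.Ico 1 (b + 1) = Finset.Icc 1 b := by ext; simp
    rw [this]
    simp only [two_mul]
  · rw [← two_mul]
    exact Nat.log_lt_of_lt_pow' (by omega) hb

lemma carryCount_mono (q n : ℕ) {D E : ℕ} (h : D ≤ E) : carryCount q D n ≤ carryCount q E n :=
  Finset.card_le_card (Finset.filter_subset_filter _ (Finset.Icc_subset_Icc_right h))

lemma carryCount_le_centralVal {q : ℕ} (hq : q.Prime) (D n : ℕ) :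
    carryCount q D n ≤ centralVal q n := by
  have h : 2 * n < q ^ (max D (2 * n) + 1) :=
    (Nat.lt_pow_self hq.one_lt).trans_le (Nat.pow_le_pow_right hq.pos (by omega))
  rw [centralVal_eq hq h]
  exact carryCount_mono q n (le_max_left _ _)

lemma carryCount_mod (q D n : ℕ) : carryCount q D (n % q ^ D) = carryCount q D n := by
  rw [carryCount, carryCount]
  congr 1
  refine Finset.filter_congr fun i hi => ?_
  rw [Nat.mod_mod_of_dvd _ (pow_dvd_pow q (Finset.mem_Icc.mp hi).2)]

/-- Multiplication by `q` shifts the base-q digits, and hence every carry, by one place. -/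
lemma carryCount_mul_ge (q D n : ℕ) :
    carryCount q D n ≤ carryCount q (D + 1) (q * n) := by
  refine Finset.card_le_card_of_injOn (fun i => i + 1) ?_ (fun _ _ _ _ h => by simpa using h)
  intro i hi
  simp only [Finset.coe_filter, Finset.mem_Icc, Set.mem_ofPred_eq] at hi ⊢
  refine ⟨by omega, ?_⟩
  rw [pow_succ', Nat.mul_mod_mul_left]
  nlinarith [hi.2]

/-- A new leading digit with 2d ≥ q produces a carry whatever the lower digits are, and lower
carries are unaffected. -/
lemma carryCount_succ_ge {q D d r : ℕ} (hr : r < q ^ D) (hd : d < q) :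
    carryCount q D r + (if q ≤ 2 * d then 1 else 0) ≤ carryCount q (D + 1) (r + q ^ D * d) := by
  have hsub : ((Finset.Icc 1 D).filter fun i => q ^ i ≤ 2 * (r % q ^ i)) ∪
      (if q ≤ 2 * d then {D + 1} else ∅) ⊆
      (Finset.Icc 1 (D + 1)).filter fun i => q ^ i ≤ 2 * ((r + q ^ D * d) % q ^ i) := by
    refine Finset.union_subset (fun i hi => ?_) ?_
    · rw [Finset.mem_filter, Finset.mem_Icc] at hi ⊢
      obtain ⟨⟨h1, h2⟩, h3⟩ := hi
      refine ⟨⟨h1, by omega⟩, ?_⟩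
      obtain ⟨c, hc⟩ := pow_dvd_pow q h2
      rw [hc, mul_assoc, Nat.add_mul_mod_self_left]
      exact h3
    · split_ifs with h
      · rw [Finset.singleton_subset_iff, Finset.mem_filter, Finset.mem_Icc]
        refine ⟨⟨by omega, le_rfl⟩, ?_⟩
        have hlt : r + q ^ D * d < q ^ (D + 1) := by
          have : q ^ D * (d + 1) ≤ q ^ D * q := Nat.mul_le_mul_left _ hd
          rw [pow_succ]
          nlinarith
        rw [Nat.mod_eq_of_lt hlt, pow_succ]
        have : q ^ D * q ≤ q ^ D * (2 * d) := Nat.mul_le_mul_left _ h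
        nlinarith
      · exact Finset.empty_subset _
  have hdisj : Disjoint ((Finset.Icc 1 D).filter fun i => q ^ i ≤ 2 * (r % q ^ i))
      (if q ≤ 2 * d then {D + 1} else ∅) := by
    split_ifs
    · rw [Finset.disjoint_singleton_right, Finset.mem_filter, Finset.mem_Icc]
      omega
    · exact Finset.disjoint_empty_right _
  have h := Finset.card_le_card hsub
  rw [Finset.card_union_of_disjoint hdisj] at h
  rw [carryCount, carryCount]
  refine le_trans (le_of_eq ?_) h
  congr 1
  split_ifs <;> simp

/-- At least ⌊q/2⌋ ≥ q/3 digits satisfy 2d ≥ q, whence the factor 1 - (1/2)(1/3) = 5/6. -/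
lemma sum_range_half_pow_le {q : ℕ} (hq : 2 ≤ q) :
    ∑ d ∈ Finset.range q, (1 / 2 : ℝ) ^ (if q ≤ 2 * d then 1 else 0) ≤ 5 / 6 * q := by
  have h1 : ∀ d, (1 / 2 : ℝ) ^ (if q ≤ 2 * d then 1 else 0) =
      1 - (1 / 2) * (if q ≤ 2 * d then 1 else 0) := fun d => by
    split_ifs <;> norm_num
  simp only [h1]
  rw [Finset.sum_sub_distrib, ← Finset.mul_sum, Finset.sum_boole]
  simp only [Finset.sum_const, Finset.card_range, nsmul_eq_mul, mul_one]
  have h2 : q / 2 ≤ ((Finset.range q).filter fun d => q ≤ 2 * d).card := by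
    have : Finset.Ico (q - q / 2) q ⊆ (Finset.range q).filter fun d => q ≤ 2 * d := by
      intro d hd
      rw [Finset.mem_Ico] at hd
      rw [Finset.mem_filter, Finset.mem_range]
      omega
    have h := Finset.card_le_card this
    rw [Nat.card_Ico] at h
    omega
  have h3 : q ≤ 3 * (q / 2) := by omega
  have h4 : (q : ℝ) ≤ 3 * (((Finset.range q).filter fun d => q ≤ 2 * d).card : ℝ) := by
    exact_mod_cast h3.trans (Nat.mul_le_mul_left 3 h2)
  linarith

lemma sum_half_pow_carryCount_le {q : ℕ} (hq : 2 ≤ q) (D : ℕ) :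
    ∑ n ∈ Finset.range (q ^ D), (1 / 2 : ℝ) ^ carryCount q D n ≤ (5 / 6 * q) ^ D := by
  induction D with
  | zero => simp [carryCount]
  | succ D ih =>
    have hre : ∑ n ∈ Finset.range (q ^ (D + 1)), (1 / 2 : ℝ) ^ carryCount q (D + 1) n =
        ∑ r ∈ Finset.range (q ^ D), ∑ d ∈ Finset.range q,
          (1 / 2 : ℝ) ^ carryCount q (D + 1) (r + q ^ D * d) := by
      have hQ : 0 < q ^ D := by positivity
      rw [← Finset.sum_product']
      refine Finset.sum_nbij' (fun n => (n % q ^ D, n / q ^ D)) (fun a => a.1 + q ^ D * a.2)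
        ?_ ?_ ?_ ?_ ?_
      · intro n hn
        rw [Finset.mem_range, pow_succ] at hn
        simp only [Finset.mem_product, Finset.mem_range]
        exact ⟨Nat.mod_lt _ hQ, Nat.div_lt_of_lt_mul hn⟩
      · rintro ⟨r, d⟩ ha
        simp only [Finset.mem_product, Finset.mem_range] at ha ⊢
        have : q ^ D * (d + 1) ≤ q ^ D * q := Nat.mul_le_mul_left _ ha.2
        rw [pow_succ]
        nlinarith [ha.1]
      · intro n _
        exact Nat.mod_add_div n _
      · rintro ⟨r, d⟩ ha
        simp only [Finset.mem_product, Finset.mem_range] at ha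
        ext
        · simp [Nat.add_mul_mod_self_left, Nat.mod_eq_of_lt ha.1]
        · simp [Nat.add_mul_div_left _ _ hQ, Nat.div_eq_of_lt ha.1]
      · intro n _
        rw [Nat.mod_add_div]
    rw [hre, pow_succ]
    calc ∑ r ∈ Finset.range (q ^ D), ∑ d ∈ Finset.range q,
          (1 / 2 : ℝ) ^ carryCount q (D + 1) (r + q ^ D * d)
        ≤ ∑ r ∈ Finset.range (q ^ D), ∑ d ∈ Finset.range q,
          (1 / 2 : ℝ) ^ carryCount q D r * (1 / 2 : ℝ) ^ (if q ≤ 2 * d then 1 else 0) := by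
          refine Finset.sum_le_sum fun r hr => Finset.sum_le_sum fun d hd => ?_
          rw [← pow_add]
          exact pow_le_pow_of_le_one (by norm_num) (by norm_num)
            (carryCount_succ_ge (Finset.mem_range.mp hr) (Finset.mem_range.mp hd))
      _ = (∑ r ∈ Finset.range (q ^ D), (1 / 2 : ℝ) ^ carryCount q D r) *
          ∑ d ∈ Finset.range q, (1 / 2 : ℝ) ^ (if q ≤ 2 * d then 1 else 0) := by
          rw [Finset.sum_mul_sum]
      _ ≤ _ := mul_le_mul ih (sum_range_half_pow_le hq)
          (Finset.sum_nonneg fun _ _ => by positivity) (by positivity)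

/-- Chernoff's argument: Markov's inequality for the exponential moment of the number of carries. -/
lemma card_carryCount_lt {q : ℕ} (hq : 2 ≤ q) (D L : ℕ) :
    (((Finset.range (q ^ D)).filter fun n => carryCount q D n < L).card : ℝ) ≤
      2 ^ L * (5 / 6 * q) ^ D := by
  have h1 : (((Finset.range (q ^ D)).filter fun n => carryCount q D n < L).card : ℝ) * (1 / 2) ^ L ≤
      ∑ n ∈ Finset.range (q ^ D), (1 / 2 : ℝ) ^ carryCount q D n := by
    rw [← nsmul_eq_mul, ← Finset.sum_const]
    refine (Finset.sum_le_sum fun n hn => ?_).trans (Finset.sum_le_sum_of_subset_of_nonneg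
      (Finset.filter_subset _ _) fun _ _ _ => by positivity)
    exact pow_le_pow_of_le_one (by norm_num) (by norm_num) (Finset.mem_filter.mp hn).2.le
  have h2 := h1.trans (sum_half_pow_carryCount_le hq D)
  rw [one_div, inv_pow, ← div_eq_mul_inv, div_le_iff₀ (by positivity)] at h2
  linarith

lemma card_Icc_carryCount_lt {q : ℕ} (hq : 2 ≤ q) {D N : ℕ} (hN : q ^ D ≤ N) (L : ℕ) :
    (((Finset.Icc 1 N).filter fun n => carryCount q D n < L).card : ℝ) ≤
      2 ^ (L + 1) * (5 / 6) ^ D * N := by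
  have hQ : 0 < q ^ D := by positivity
  have h1 : ((Finset.Icc 1 N).filter fun n => carryCount q D n < L).card ≤
      (Finset.range (N / q ^ D + 1) ×ˢ
        (Finset.range (q ^ D)).filter fun n => carryCount q D n < L).card := by
    refine Finset.card_le_card_of_injOn (fun n => (n / q ^ D, n % q ^ D)) ?_ ?_
    · intro n hn
      simp only [Finset.coe_filter, Finset.mem_Icc, Set.mem_ofPred_eq] at hn
      simp only [Finset.coe_product, Set.mem_prod, Finset.mem_coe, Finset.mem_range,
        Finset.mem_filter, carryCount_mod]
      exact ⟨Nat.lt_succ_of_le (Nat.div_le_div_right hn.1.2), Nat.mod_lt _ hQ, hn.2⟩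
    · intro a _ b _ hab
      simp only [Prod.mk.injEq] at hab
      rw [← Nat.div_add_mod a (q ^ D), ← Nat.div_add_mod b (q ^ D), hab.1, hab.2]
  rw [Finset.card_product, Finset.card_range] at h1
  have hQ' : (0 : ℝ) < (q : ℝ) ^ D := by exact_mod_cast hQ
  have h2 : ((N / q ^ D + 1 : ℕ) : ℝ) ≤ 2 * N / q ^ D := by
    rw [le_div_iff₀ hQ']
    have h3 : (N / q ^ D + 1) * q ^ D ≤ 2 * N := by
      have := Nat.div_mul_le_self N (q ^ D)
      nlinarith
    exact_mod_cast h3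
  calc (((Finset.Icc 1 N).filter fun n => carryCount q D n < L).card : ℝ)
      ≤ ((N / q ^ D + 1 : ℕ) : ℝ) *
        (((Finset.range (q ^ D)).filter fun n => carryCount q D n < L).card : ℝ) := by
        exact_mod_cast h1
    _ ≤ 2 * N / q ^ D * (2 ^ L * (5 / 6 * q) ^ D) :=
        mul_le_mul h2 (card_carryCount_lt hq D L) (Nat.cast_nonneg _) (by positivity)
    _ = 2 ^ (L + 1) * (5 / 6) ^ D * N := by
        rw [mul_pow]
        field_simp
        ring

/-- Multiples of `q` with few carries are rare. -/
lemma card_dvd_centralVal_lt {q : ℕ} (hq : q.Prime) {x : ℝ} (hx : 1 < x) (hqx : (q : ℝ) ≤ x)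
    (L : ℕ) :
    (((Finset.Icc 1 ⌊x⌋₊).filter fun n => q ∣ n ∧ centralVal q n < L).card : ℝ) ≤
      10 * 2 ^ (L + 1) * (Real.log q / q / Real.log x) * x := by
  have hq0 : (0 : ℝ) < q := by exact_mod_cast hq.pos
  set N := ⌊x / q⌋₊ with hN
  have hN1 : 1 ≤ N := Nat.le_floor (by rw [Nat.cast_one, one_le_div hq0]; exact hqx)
  set D := Nat.log q N with hD
  have hDN : q ^ D ≤ N := Nat.pow_log_le_self q (by omega)
  have h1 : ((Finset.Icc 1 ⌊x⌋₊).filter fun n => q ∣ n ∧ centralVal q n < L).card ≤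
      ((Finset.Icc 1 N).filter fun n => carryCount q D n < L).card := by
    refine Finset.card_le_card_of_injOn (fun n => n / q) ?_ ?_
    · intro n hn
      simp only [Finset.coe_filter, Finset.mem_Icc, Set.mem_ofPred_eq] at hn ⊢
      obtain ⟨⟨h1, h2⟩, ⟨m, rfl⟩, h4⟩ := hn
      rw [Nat.mul_div_cancel_left _ hq.pos]
      refine ⟨⟨Nat.pos_of_ne_zero fun h0 => by simp [h0] at h1, ?_⟩, ?_⟩
      · refine Nat.le_floor ?_
        rw [le_div_iff₀ hq0]
        have := (Nat.le_floor_iff (by linarith)).mp h2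
        push_cast at this
        linarith
      · exact ((carryCount_mul_ge q D m).trans
          (carryCount_le_centralVal hq _ _)).trans_lt h4
    · intro a ha b hb hab
      simp only [Finset.coe_filter, Set.mem_ofPred_eq] at ha hb
      exact (Nat.div_left_inj ha.2.1 hb.2.1).mp hab
  have h2 := card_Icc_carryCount_lt hq.two_le hDN L
  have hNx : (N : ℝ) ≤ x / q := Nat.floor_le (by positivity)
  have hlogx : 0 < Real.log x := Real.log_pos hx
  have hlogq : 0 < Real.log q := Real.log_pos (by exact_mod_cast hq.one_lt)
  have hxD : Real.log x ≤ (D + 2) * Real.log q := by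
    have h3 : x / q < (q : ℝ) ^ (D + 1) := by
      have h4 : N + 1 ≤ q ^ (D + 1) := Nat.lt_pow_succ_log_self hq.one_lt N
      exact (Nat.lt_floor_add_one _).trans_le (by exact_mod_cast h4)
    rw [div_lt_iff₀ hq0, ← pow_succ] at h3
    have h5 := Real.log_le_log (by linarith) h3.le
    rw [Real.log_pow] at h5
    push_cast at h5
    linarith
  -- By Bernoulli, the exponential decay in the number of digits is weakened to 10/(D + 2), and D +
  -- 2 ≥ log x/log q. The resulting bound can be summed over q by Mertens.
  have hpow : (5 / 6 : ℝ) ^ D ≤ 10 * (Real.log q / Real.log x) := by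
    have hb : 1 + (D : ℝ) * (1 / 5) ≤ (1 + 1 / 5) ^ D :=
      one_add_mul_le_pow (by norm_num) D
    have hb2 : (5 / 6 : ℝ) ^ D * (1 + 1 / 5) ^ D = 1 := by
      rw [← mul_pow]; norm_num
    have hp : (0 : ℝ) < (5 / 6) ^ D := by positivity
    have h6 : (5 / 6 : ℝ) ^ D * (D + 2) ≤ 10 := by nlinarith
    rw [← mul_div_assoc, le_div_iff₀ hlogx]
    calc (5 / 6 : ℝ) ^ D * Real.log x ≤ (5 / 6 : ℝ) ^ D * ((D + 2) * Real.log q) := by gcongr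
      _ = (5 / 6 : ℝ) ^ D * (D + 2) * Real.log q := by ring
      _ ≤ 10 * Real.log q := by gcongr
  calc (((Finset.Icc 1 ⌊x⌋₊).filter fun n => q ∣ n ∧ centralVal q n < L).card : ℝ)
      ≤ (((Finset.Icc 1 N).filter fun n => carryCount q D n < L).card : ℝ) := by
        exact_mod_cast h1
    _ ≤ 2 ^ (L + 1) * (5 / 6) ^ D * N := h2
    _ ≤ 2 ^ (L + 1) * (10 * (Real.log q / Real.log x)) * (x / q) := by gcongr
    _ = _ := by field_simp

/-- The integers divisible by a prime `q ≤ y` whose exponent in the central binomial coefficient is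
too small. -/
def smallPrimeObstruction (ℓ : ℕ) (y : ℝ) : Set ℕ :=
  {n | ∃ q : ℕ, q.Prime ∧ (q : ℝ) ≤ y ∧ q ∣ n ∧ centralVal q n < ℓ * n.factorization q}

open scoped Classical in
lemma avg_indicator (x : ℝ) (s : Set ℕ) :
    avg x (s.indicator 1) = (((Finset.Icc 1 ⌊x⌋₊).filter fun n => n ∈ s).card : ℝ) / x := by
  rw [avg]
  simp [Set.indicator_apply, Finset.sum_boole]

lemma sum_Icc_inv_pow_le (A N : ℕ) :
    ∑ q ∈ Finset.Icc 2 N, ((q : ℝ) ^ (A + 2))⁻¹ ≤ (1 / 2) ^ A := by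
  have h2 : ∑ q ∈ Finset.Icc 2 N, ((q : ℝ) ^ 2)⁻¹ ≤ 1 := by
    have h := sum_Ioc_inv_sq_le_sub (α := ℝ) (k := 1) (n := max 1 N) (by norm_num) (le_max_left _ _)
    have hsub : Finset.Icc 2 N ⊆ Finset.Ioc 1 (max 1 N) := by
      intro q hq
      rw [Finset.mem_Icc] at hq
      rw [Finset.mem_Ioc]
      omega
    refine (Finset.sum_le_sum_of_subset_of_nonneg hsub fun _ _ _ => by positivity).trans ?_
    refine h.trans ?_
    rw [Nat.cast_one, inv_one, sub_le_self_iff]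
    positivity
  calc ∑ q ∈ Finset.Icc 2 N, ((q : ℝ) ^ (A + 2))⁻¹
      ≤ ∑ q ∈ Finset.Icc 2 N, (1 / 2) ^ A * ((q : ℝ) ^ 2)⁻¹ := by
        refine Finset.sum_le_sum fun q hq => ?_
        have hq2 : (2 : ℝ) ≤ q := by exact_mod_cast (Finset.mem_Icc.mp hq).1
        rw [pow_add, mul_inv, one_div, inv_pow]
        gcongr
    _ = (1 / 2) ^ A * ∑ q ∈ Finset.Icc 2 N, ((q : ℝ) ^ 2)⁻¹ := by rw [Finset.mul_sum]
    _ ≤ (1 / 2) ^ A * 1 := by gcongr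
    _ = _ := mul_one _

open scoped Classical in
/-- Obstructions from primes at most `x ^ η` have small upper density. -/
lemma avg_smallPrimeObstruction_le (ℓ : ℕ) {ε : ℝ} (hε : 0 < ε) :
    ∃ η : ℝ, 0 < η ∧ η ≤ 1 ∧ ∃ X : ℝ, 1 < X ∧ ∀ x ≥ X,
      avg x ((smallPrimeObstruction ℓ (x ^ η)).indicator 1) ≤ ε := by
  obtain ⟨C, hC, hmert⟩ := mertens
  -- Integers divisible by some q^(A+2) have density below ε/2. For the others v_q(n) ≤ A + 1, so an
  -- obstruction means fewer than L = ℓ(A + 1) carries.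
  obtain ⟨A, hA⟩ := exists_pow_lt_of_lt_one (half_pos hε) (by norm_num : (1 / 2 : ℝ) < 1)
  set L := ℓ * (A + 1) with hL
  set K : ℝ := 10 * 2 ^ (L + 1) with hK
  have hK0 : 0 < K := by positivity
  -- Mertens bounds the remaining density by K(η log x + C)/log x; the choices of η and of the
  -- threshold make each half at most ε/4.
  refine ⟨min 1 (ε / (4 * K)), by positivity, min_le_left _ _,
    max 2 (Real.exp (4 * K * C / ε)), by norm_num, fun x hx => ?_⟩
  set η := min 1 (ε / (4 * K)) with hη
  have hx2 : 2 ≤ x := (le_max_left _ _).trans hx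
  have hx1 : 1 < x := by linarith
  have hx0 : 0 < x := by linarith
  have hlogx : 0 < Real.log x := Real.log_pos hx1
  have hlogC : 4 * K * C / ε ≤ Real.log x := by
    rw [Real.le_log_iff_exp_le hx0]
    exact (le_max_right _ _).trans hx
  have hη0 : 0 < η := by positivity
  have hη1 : η ≤ 1 := min_le_left _ _
  have hηε : η ≤ ε / (4 * K) := min_le_right _ _
  have hy1 : 1 ≤ x ^ η := Real.one_le_rpow hx1.le hη0.le
  have hyx : x ^ η ≤ x := by
    conv_rhs => rw [← Real.rpow_one x]
    exact Real.rpow_le_rpow_of_exponent_le hx1.le hη1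
  have hsub : ((Finset.Icc 1 ⌊x⌋₊).filter fun n => n ∈ smallPrimeObstruction ℓ (x ^ η)) ⊆
      (⌊x ^ η⌋₊.primesLE.biUnion fun q =>
        (Finset.Icc 1 ⌊x⌋₊).filter fun n => q ∣ n ∧ centralVal q n < L) ∪
      ((Finset.Icc 2 ⌊x⌋₊).biUnion fun q =>
        (Finset.Icc 1 ⌊x⌋₊).filter fun n => q ^ (A + 2) ∣ n) := by
    intro n hn
    rw [Finset.mem_filter] at hn
    obtain ⟨hn1, q, hq, hqy, hqn, hc⟩ := hn
    rw [Finset.mem_union, Finset.mem_biUnion, Finset.mem_biUnion]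
    have hn0 : n ≠ 0 := by have := (Finset.mem_Icc.mp hn1).1; omega
    by_cases hv : n.factorization q ≤ A + 1
    · left
      refine ⟨q, (primesLE_floor_mem (by positivity)).mpr ⟨hqy, hq⟩, ?_⟩
      rw [Finset.mem_filter]
      exact ⟨hn1, hqn, hc.trans_le (Nat.mul_le_mul_left ℓ hv)⟩
    · right
      refine ⟨q, ?_, ?_⟩
      · rw [Finset.mem_Icc]
        exact ⟨hq.two_le, Nat.le_floor (hqy.trans hyx)⟩
      · rw [Finset.mem_filter]
        exact ⟨hn1, (hq.pow_dvd_iff_le_factorization hn0).mpr (by omega)⟩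
  have hcard := (Finset.card_le_card hsub).trans (Finset.card_union_le _ _)
  have hb1 : ((⌊x ^ η⌋₊.primesLE.biUnion fun q =>
        (Finset.Icc 1 ⌊x⌋₊).filter fun n => q ∣ n ∧ centralVal q n < L).card : ℝ) ≤
      ε / 2 * x := by
    calc ((⌊x ^ η⌋₊.primesLE.biUnion fun q =>
        (Finset.Icc 1 ⌊x⌋₊).filter fun n => q ∣ n ∧ centralVal q n < L).card : ℝ)
        ≤ ∑ q ∈ ⌊x ^ η⌋₊.primesLE, (((Finset.Icc 1 ⌊x⌋₊).filter
            fun n => q ∣ n ∧ centralVal q n < L).card : ℝ) := by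
          exact_mod_cast Finset.card_biUnion_le
      _ ≤ ∑ q ∈ ⌊x ^ η⌋₊.primesLE, K * (Real.log q / q / Real.log x) * x := by
          refine Finset.sum_le_sum fun q hq => ?_
          have hq' := (primesLE_floor_mem (by positivity)).mp hq
          exact card_dvd_centralVal_lt hq'.2 hx1 (hq'.1.trans hyx) L
      _ = K * x / Real.log x * ∑ q ∈ ⌊x ^ η⌋₊.primesLE, Real.log q / q := by
          rw [Finset.mul_sum]
          refine Finset.sum_congr rfl fun q _ => ?_
          ring
      _ ≤ K * x / Real.log x * (η * Real.log x + C) := by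
          have := (abs_le.mp (hmert _ hy1)).2
          rw [Real.log_rpow hx0] at this
          gcongr
          linarith
      _ = (K * η + K * C / Real.log x) * x := by field_simp
      _ ≤ (ε / 4 + ε / 4) * x := by
          rw [le_div_iff₀ (by positivity)] at hηε
          rw [div_le_iff₀ hε] at hlogC
          have h3 : K * C / Real.log x ≤ ε / 4 := by
            rw [div_le_iff₀ hlogx]
            linarith
          exact mul_le_mul_of_nonneg_right (by linarith) hx0.le
      _ = ε / 2 * x := by ring
  have hb2 : (((Finset.Icc 2 ⌊x⌋₊).biUnion fun q =>
        (Finset.Icc 1 ⌊x⌋₊).filter fun n => q ^ (A + 2) ∣ n).card : ℝ) ≤ ε / 2 * x := by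
    calc (((Finset.Icc 2 ⌊x⌋₊).biUnion fun q =>
        (Finset.Icc 1 ⌊x⌋₊).filter fun n => q ^ (A + 2) ∣ n).card : ℝ)
        ≤ ∑ q ∈ Finset.Icc 2 ⌊x⌋₊, (((Finset.Icc 1 ⌊x⌋₊).filter
            fun n => q ^ (A + 2) ∣ n).card : ℝ) := by
          exact_mod_cast Finset.card_biUnion_le
      _ ≤ ∑ q ∈ Finset.Icc 2 ⌊x⌋₊, x * ((q : ℝ) ^ (A + 2))⁻¹ := by
          refine Finset.sum_le_sum fun q hq => ?_
          have hq2 := (Finset.mem_Icc.mp hq).1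
          have h := card_multiples_Icc ⌊x⌋₊ (q ^ (A + 2))
          have hle : ((⌊x⌋₊ / q ^ (A + 2) : ℕ) : ℝ) ≤ x * ((q : ℝ) ^ (A + 2))⁻¹ := by
            refine Nat.cast_div_le.trans ?_
            rw [← div_eq_mul_inv]
            push_cast
            gcongr
            exact Nat.floor_le hx0.le
          refine le_trans (le_of_eq ?_) hle
          exact_mod_cast h
      _ = x * ∑ q ∈ Finset.Icc 2 ⌊x⌋₊, ((q : ℝ) ^ (A + 2))⁻¹ := by rw [Finset.mul_sum]
      _ ≤ x * (1 / 2) ^ A := by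
          gcongr
          exact sum_Icc_inv_pow_le A _
      _ ≤ ε / 2 * x := by nlinarith
  rw [avg_indicator, div_le_iff₀ hx0]
  have hcard' := Nat.cast_le (α := ℝ).mpr hcard
  rw [Nat.cast_add] at hcard'
  linarith

/-! ### Carries at the primes of a generic tuple. -/

/-- The number of exponents `e ≥ 2` with `e v ≤ 1`. -/
noncomputable def carryLength (v : ℝ) : ℕ := ⌊1 / v⌋₊ - 1

lemma pow_dvd_centralBinom_iff {n : ℕ} (hn : n ≠ 0) (ℓ : ℕ) :
    n ^ ℓ ∣ (2 * n).choose n ↔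
      ∀ q : ℕ, q.Prime → q ∣ n → ℓ * n.factorization q ≤ centralVal q n := by
  have hc : (2 * n).choose n ≠ 0 := (Nat.choose_pos (by omega)).ne'
  rw [← Nat.factorization_prime_le_iff_dvd (pow_ne_zero ℓ hn) hc]
  simp only [Nat.factorization_pow, Finsupp.smul_apply, smul_eq_mul, centralVal]
  refine forall₂_congr fun q hq => ⟨fun h _ => h, fun h => ?_⟩
  by_cases hqn : q ∣ n
  · exact h hqn
  · rw [Nat.factorization_eq_zero_of_not_dvd hqn]
    simp

lemma half_le_fract_div_iff (n q : ℕ) (hq : 0 < q) :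
    1 / 2 ≤ Int.fract ((n : ℝ) / q) ↔ q ≤ 2 * (n % q) := by
  have hq' : (0 : ℝ) < q := by exact_mod_cast hq
  rw [Int.fract_div_natCast_eq_div_natCast_mod, le_div_iff₀ hq', div_mul_eq_mul_div,
    div_le_iff₀ (by norm_num), one_mul]
  constructor
  · intro h
    have : (q : ℝ) ≤ (2 * (n % q) : ℕ) := by push_cast; linarith
    exact_mod_cast this
  · intro h
    have : (q : ℝ) ≤ (2 * (n % q) : ℕ) := by exact_mod_cast h
    push_cast at this
    linarith

section Generic

variable {k : ℕ} {B : ℕ} {κ : ℝ} {v : Fin k → ℝ}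

lemma GenericLogs.lt_one (hv : GenericLogs B κ v) (hκ : 0 < κ) (i : Fin k) : v i < 1 := by
  have h := Finset.single_le_sum (f := v) (fun j _ => hκ.le.trans (hv.lower j)) (Finset.mem_univ i)
  linarith [hv.sum_le]

/-- Both ⌊1/v⌋ and its successor are at most B + 1, so the separation of multiples of v from 1
applies on either side. -/
lemma GenericLogs.carryLength_bounds (hv : GenericLogs B κ v) (hκ : 0 < κ) (i : Fin k) :
    carryLength (v i) + 1 ≤ B ∧ ((carryLength (v i) + 1 : ℕ) : ℝ) * v i ≤ 1 - κ ∧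
      1 + κ ≤ ((carryLength (v i) + 2 : ℕ) : ℝ) * v i := by
  have hv0 : 0 < v i := hκ.trans_le (hv.lower i)
  have h1 : 1 ≤ ⌊1 / v i⌋₊ := by
    refine Nat.le_floor ?_
    rw [Nat.cast_one, one_le_div hv0]
    exact (hv.lt_one hκ i).le
  have h2 : carryLength (v i) + 1 = ⌊1 / v i⌋₊ := by rw [carryLength]; omega
  have h3 : carryLength (v i) + 2 = ⌊1 / v i⌋₊ + 1 := by omega
  have h4 : ⌊1 / v i⌋₊ ≤ B := by
    refine Nat.floor_le_of_le ?_
    rw [div_le_iff₀ hv0]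
    exact hv.one_le i
  have h5 : ((⌊1 / v i⌋₊ : ℕ) : ℝ) * v i ≤ 1 := by
    rw [← le_div_iff₀ hv0]
    exact Nat.floor_le (by positivity)
  have h6 : 1 < ((⌊1 / v i⌋₊ + 1 : ℕ) : ℝ) * v i := by
    rw [← div_lt_iff₀ hv0]
    push_cast
    exact Nat.lt_floor_add_one _
  refine ⟨h2 ▸ h4, ?_, ?_⟩
  · rw [h2]
    have := hv.one i ⌊1 / v i⌋₊ (by omega)
    rw [abs_of_nonpos (by linarith)] at this
    linarith
  · rw [h3]
    have := hv.one i (⌊1 / v i⌋₊ + 1) (by omega)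
    rw [abs_of_pos (by linarith)] at this
    linarith

variable {x : ℝ} {p : Fin k → ℕ}

lemma GenericLogs.injective (hv : GenericLogs B κ (logCoord x p)) (hκ : 0 < κ) :
    Function.Injective p := by
  intro i j hij
  by_contra hne
  have := hv.pair i j hne 1 1 le_rfl (by omega) le_rfl (by omega)
  rw [logCoord, logCoord, hij, sub_self, abs_zero] at this
  linarith

/-- Exponent 1 never carries because p_i divides n. Exponents from g + 2 on never carry because
p_i^(g+2) ≥ x^(1+κ) > 2x. The candidates that remain are j + 2 with j < g. -/
lemma GenericLogs.centralVal_eq_card (hv : GenericLogs B κ (logCoord x p)) (hκ : 0 < κ)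
    (hx : 1 < x) (hxκ : 2 < x ^ κ) (hp : ∀ i, (p i).Prime) {m : ℕ}
    (hmx : (((∏ i, p i) * m : ℕ) : ℝ) ≤ x) (i : Fin k) :
    centralVal (p i) ((∏ i, p i) * m) =
      Nat.card {j : Fin (carryLength (logCoord x p i)) //
        1 / 2 ≤ Int.fract ((m : ℝ) * (((∏ i, p i : ℕ) : ℝ) / (p i : ℝ) ^ ((j : ℕ) + 2)))} := by
  set g := carryLength (logCoord x p i) with hg
  set n := (∏ i, p i) * m with hn
  obtain ⟨-, -, hup⟩ := hv.carryLength_bounds hκ i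
  rw [← hg] at hup
  have hx0 : 0 < x := by linarith
  have hbig : 2 * n < p i ^ (g + 1 + 1) := by
    have h1 := rpow_mul_logCoord hx (p := p) i (hp i).one_le (g + 2)
    have h2 : x ^ (1 + κ) ≤ (p i : ℝ) ^ (g + 2) := by
      rw [← h1]
      exact Real.rpow_le_rpow_of_exponent_le hx.le hup
    rw [Real.rpow_add hx0, Real.rpow_one] at h2
    have h3 : ((2 * n : ℕ) : ℝ) < ((p i ^ (g + 1 + 1) : ℕ) : ℝ) := by
      push_cast
      calc 2 * (n : ℝ) ≤ 2 * x := by linarith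
        _ < x * x ^ κ := by nlinarith
        _ ≤ _ := h2
    exact_mod_cast h3
  classical
  rw [centralVal_eq (hp i) hbig, carryCount, Nat.card_eq_fintype_card, Fintype.card_subtype]
  have hiff : ∀ e : ℕ, 1 / 2 ≤ Int.fract ((m : ℝ) * (((∏ i, p i : ℕ) : ℝ) / (p i : ℝ) ^ e)) ↔
      p i ^ e ≤ 2 * (n % p i ^ e) := by
    intro e
    rw [← half_le_fract_div_iff n (p i ^ e) (pow_pos (hp i).pos e), hn]
    push_cast
    rw [mul_comm (m : ℝ), div_mul_eq_mul_div]
  simp only [hiff]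
  symm
  refine Finset.card_bij (fun j _ => (j : ℕ) + 2) ?_ ?_ ?_
  · intro j hj
    simp only [Finset.mem_filter, Finset.mem_univ, true_and, Finset.mem_Icc] at hj ⊢
    exact ⟨⟨by omega, by omega⟩, hj⟩
  · intro a _ b _ hab
    exact Fin.ext (by omega)
  · intro e he
    simp only [Finset.mem_filter, Finset.mem_Icc] at he
    have hdvd : p i ∣ n := (Finset.dvd_prod_of_mem p (Finset.mem_univ i)).mul_right m
    have h1 : e ≠ 1 := by
      rintro rfl
      rw [pow_one, Nat.mod_eq_zero_of_dvd hdvd] at he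
      have := (hp i).pos
      omega
    have h2 : e = (e - 2) + 2 := by omega
    refine ⟨⟨e - 2, by omega⟩, ?_, h2.symm⟩
    simp only [Finset.mem_filter, Finset.mem_univ, true_and]
    rw [← h2]
    exact he.2

lemma GenericLogs.manyCarries_iff (hv : GenericLogs B κ (logCoord x p)) (hκ : 0 < κ)
    (hx : 1 < x) (hxκ : 2 < x ^ κ) (hp : ∀ i, (p i).Prime) {m : ℕ}
    (hmx : (((∏ i, p i) * m : ℕ) : ℝ) ≤ x) (ℓ : ℕ) :
    ManyCarries ℓ (fun i => carryLength (logCoord x p i)) p m ↔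
      ∀ i, ℓ ≤ centralVal (p i) ((∏ i, p i) * m) := by
  rw [ManyCarries]
  refine forall_congr' fun i => ?_
  rw [hv.centralVal_eq_card hκ hx hxκ hp hmx i]

lemma GenericLogs.manyCarries_of_dvd (hv : GenericLogs B κ (logCoord x p)) (hκ : 0 < κ)
    (hx : 1 < x) (hxκ : 2 < x ^ κ) (hp : ∀ i, (p i).Prime) {m : ℕ} (hm : m ≠ 0)
    (hmx : (((∏ i, p i) * m : ℕ) : ℝ) ≤ x) {ℓ : ℕ}
    (hd : ((∏ i, p i) * m) ^ ℓ ∣ (2 * ((∏ i, p i) * m)).choose ((∏ i, p i) * m)) :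
    ManyCarries ℓ (fun i => carryLength (logCoord x p i)) p m := by
  rw [hv.manyCarries_iff hκ hx hxκ hp hmx]
  intro i
  have hn : (∏ i, p i) * m ≠ 0 :=
    mul_ne_zero (Finset.prod_ne_zero_iff.mpr fun i _ => (hp i).ne_zero) hm
  have hdvd : p i ∣ (∏ i, p i) * m := (Finset.dvd_prod_of_mem p (Finset.mem_univ i)).mul_right m
  have h := (pow_dvd_centralBinom_iff hn ℓ).mp hd (p i) (hp i) hdvd
  exact (Nat.le_mul_of_pos_right ℓ ((hp i).factorization_pos_of_dvd hn hdvd)).trans h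

/-- A prime q not dividing m is one of the distinct p_i and divides n exactly once, so `ℓ` carries
suffice for it. A failure of divisibility therefore comes from some q dividing m, hence q ≤ m ≤ y.
-/
lemma GenericLogs.mem_smallPrimeObstruction (hv : GenericLogs B κ (logCoord x p)) (hκ : 0 < κ)
    (hx : 1 < x) (hxκ : 2 < x ^ κ) (hp : ∀ i, (p i).Prime) {m : ℕ} (hm : m ≠ 0)
    (hmx : (((∏ i, p i) * m : ℕ) : ℝ) ≤ x) {ℓ : ℕ}
    (hc : ManyCarries ℓ (fun i => carryLength (logCoord x p i)) p m)
    (hd : ¬ ((∏ i, p i) * m) ^ ℓ ∣ (2 * ((∏ i, p i) * m)).choose ((∏ i, p i) * m))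
    {y : ℝ} (hy : (m : ℝ) ≤ y) :
    (∏ i, p i) * m ∈ smallPrimeObstruction ℓ y := by
  rw [hv.manyCarries_iff hκ hx hxκ hp hmx] at hc
  have hP : (∏ i, p i) ≠ 0 := Finset.prod_ne_zero_iff.mpr fun i _ => (hp i).ne_zero
  rw [pow_dvd_centralBinom_iff (mul_ne_zero hP hm)] at hd
  push Not at hd
  obtain ⟨q, hq, hqn, hlt⟩ := hd
  refine ⟨q, hq, ?_, hqn, hlt⟩
  by_cases hqm : q ∣ m
  · exact le_trans (by exact_mod_cast Nat.le_of_dvd (Nat.pos_of_ne_zero hm) hqm) hy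
  exfalso
  obtain ⟨i, -, hi⟩ := (hq.prime.dvd_finsetProd_iff _).mp ((hq.dvd_mul.mp hqn).resolve_right hqm)
  have hqi : q = p i := (Nat.prime_dvd_prime_iff_eq hq (hp i)).mp hi
  have hone : ((∏ i, p i) * m).factorization q = 1 := by
    rw [Nat.factorization_mul hP hm, Finsupp.add_apply, Nat.factorization_eq_zero_of_not_dvd hqm,
      add_zero, Nat.factorization_prod (fun i _ => (hp i).ne_zero), Finsupp.finsetSum_apply,
      Finset.sum_eq_single i]
    · rw [hqi, (hp i).factorization_self]
    · intro j _ hji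
      refine Nat.factorization_eq_zero_of_not_dvd fun h => ?_
      have := (Nat.prime_dvd_prime_iff_eq hq (hp j)).mp h
      exact hji (hv.injective hκ (this.symm.trans hqi))
    · intro h
      exact absurd (Finset.mem_univ i) h
  rw [hone, mul_one, hqi] at hlt
  exact absurd (hc i) (not_le.mpr hlt)

end Generic

/-! ### Geometry of stick breaking. -/

/-- Extension of a finite sequence by zero. -/
def extendZero {k : ℕ} (u : Fin k → ℝ) (i : ℕ) : ℝ := if h : i < k then u ⟨i, h⟩ else 0

/-- The sticks broken off by a finite sequence. -/
noncomputable def sticks {k : ℕ} (u : Fin k → ℝ) (i : Fin k) : ℝ := stick (extendZero u) i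

lemma extendZero_cons_zero {k : ℕ} (a : ℝ) (w : Fin k → ℝ) :
    extendZero (Fin.cons a w : Fin (k + 1) → ℝ) 0 = a := by
  simp [extendZero]

lemma extendZero_cons_succ {k : ℕ} (a : ℝ) (w : Fin k → ℝ) (i : ℕ) :
    extendZero (Fin.cons a w : Fin (k + 1) → ℝ) (i + 1) = extendZero w i := by
  rw [extendZero, extendZero]
  by_cases h : i < k
  · rw [dif_pos (Nat.succ_lt_succ h), dif_pos h]
    exact Fin.cons_succ (α := fun _ => ℝ) a w ⟨i, h⟩
  · rw [dif_neg (by omega), dif_neg h]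

lemma sticks_cons_zero {k : ℕ} (a : ℝ) (w : Fin k → ℝ) :
    sticks (Fin.cons a w : Fin (k + 1) → ℝ) 0 = a := by
  rw [sticks, stick, Fin.val_zero, Finset.prod_range_zero, one_mul, extendZero_cons_zero]

/-- Self-similarity: after the first break, the later sticks form a copy of the process scaled by 1
- a. Inductions on `k` rest on this. -/
lemma sticks_cons_succ {k : ℕ} (a : ℝ) (w : Fin k → ℝ) (i : Fin k) :
    sticks (Fin.cons a w : Fin (k + 1) → ℝ) i.succ = (1 - a) * sticks w i := by
  rw [sticks, stick, Fin.val_succ, Finset.prod_range_succ', extendZero_cons_zero, sticks, stick,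
    extendZero_cons_succ]
  simp only [extendZero_cons_succ]
  ring

lemma sum_sticks_cons {k : ℕ} (a : ℝ) (w : Fin k → ℝ) :
    ∑ i, sticks (Fin.cons a w : Fin (k + 1) → ℝ) i = a + (1 - a) * ∑ i, sticks w i := by
  rw [Fin.sum_univ_succ, sticks_cons_zero, Finset.mul_sum]
  simp only [sticks_cons_succ]

lemma continuous_sticks {k : ℕ} (i : Fin k) : Continuous fun u : Fin k → ℝ => sticks u i := by
  have h : ∀ j : ℕ, Continuous fun u : Fin k → ℝ => extendZero u j := by
    intro j
    unfold extendZero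
    split_ifs with hj
    · exact continuous_apply _
    · exact continuous_const
  unfold sticks stick
  exact (continuous_finsetProd _ fun j _ => continuous_const.sub (h j)).mul (h _)

lemma sticks_nonneg {k : ℕ} {u : Fin k → ℝ} (hu : ∀ i, u i ∈ Set.Icc (0 : ℝ) 1) (i : Fin k) :
    0 ≤ sticks u i := by
  have h : ∀ j, extendZero u j ∈ Set.Icc (0 : ℝ) 1 := by
    intro j
    unfold extendZero
    split_ifs with hj
    · exact hu _
    · simp
  exact mul_nonneg (Finset.prod_nonneg fun j _ => by linarith [(h j).2]) (h _).1

lemma sum_sticks_le_one {k : ℕ} {u : Fin k → ℝ} (hu : ∀ i, u i ∈ Set.Icc (0 : ℝ) 1) :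
    ∑ i, sticks u i ≤ 1 := by
  induction k with
  | zero => simp
  | succ k ih =>
    rw [← Fin.cons_self_tail u, sum_sticks_cons]
    have := ih (u := Fin.tail u) fun i => hu _
    nlinarith [(hu 0).1, (hu 0).2]

/-- The sticks attached to the successive logarithms of the primes in a tuple. -/
lemma sticks_uCoord {k : ℕ} {x : ℝ} {p : Fin k → ℕ} (hx : 1 < x) (hp : ∀ i, (p i).Prime)
    (hpx : ((∏ i, p i : ℕ) : ℝ) ≤ x) (i : Fin k) :
    sticks (uCoord k x p) i = logCoord x p i := by
  induction k generalizing x with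
  | zero => exact i.elim0
  | succ k ih =>
    rw [uCoord]
    refine Fin.cases ?_ (fun j => ?_) i
    · rw [sticks_cons_zero, logCoord]
    · have hp0 : (0 : ℝ) < p 0 := by exact_mod_cast (hp 0).pos
      have htail : ((∏ i, Fin.tail p i : ℕ) : ℝ) ≤ x / p 0 := by
        rw [le_div_iff₀ hp0]
        rw [Fin.prod_univ_succ] at hpx
        push_cast at hpx ⊢
        rw [mul_comm]
        exact hpx
      have h1 : 1 < x / p 0 := by
        refine lt_of_lt_of_le ?_ htail
        have h2 : (Fin.tail p j) ≤ ∏ i, Fin.tail p i :=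
          Nat.le_of_dvd (Finset.prod_pos fun i _ => (hp _).pos)
            (Finset.dvd_prod_of_mem _ (Finset.mem_univ j))
        exact_mod_cast (hp j.succ).one_lt.trans_le h2
      rw [sticks_cons_succ, ih (p := Fin.tail p) h1 (fun i => hp i.succ) htail]
      have hlx : Real.log x ≠ 0 := (Real.log_pos hx).ne'
      have hlx' : Real.log (x / p 0) ≠ 0 := (Real.log_pos h1).ne'
      rw [logCoord, logCoord, Fin.tail]
      rw [Real.log_div (by linarith) hp0.ne'] at hlx' ⊢
      field_simp

/-- Nontrivial affine forms in the sticks vanish almost nowhere. -/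
lemma ae_affine_sticks_ne_zero {k : ℕ} (c₀ : ℝ) (c : Fin k → ℝ) (h : c₀ ≠ 0 ∨ ∃ i, c i ≠ 0) :
    ∀ᵐ u ∂cubeMeasure k, c₀ + ∑ i, c i * sticks u i ≠ 0 := by
  induction k generalizing c₀ with
  | zero =>
    refine Eventually.of_forall fun u => ?_
    rcases h with h | ⟨i, -⟩
    · simpa using h
    · exact i.elim0
  | succ k ih =>
    have hmp := measurePreserving_cons k
    have hmeas : MeasurableSet {u : Fin (k + 1) → ℝ | c₀ + ∑ i, c i * sticks u i = 0} := by
      refine (isClosed_eq ?_ continuous_const).measurableSet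
      exact continuous_const.add (continuous_finsetSum _ fun i _ =>
        continuous_const.mul (continuous_sticks i))
    rw [ae_iff]
    simp only [ne_eq, not_not]
    rw [← hmp.measure_preimage hmeas.nullMeasurableSet,
      Measure.measure_prod_null (hmp.measurable hmeas)]
    have hpt : ∀ b : ℝ, ∀ᵐ a ∂(volume.restrict (Set.Icc (0 : ℝ) 1)), a ≠ b := fun b =>
      ae_restrict_of_ae (by simp [ae_iff])
    -- With the first coordinate frozen at a ≠ 1, division by 1 - a leaves an affine form in the
    -- remaining sticks. For almost every a it is still nontrivial.
    have hlin : ∀ᵐ a ∂(volume.restrict (Set.Icc (0 : ℝ) 1)),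
        c₀ + c 0 * a ≠ 0 ∨ ∃ i : Fin k, c i.succ ≠ 0 := by
      by_cases hc : ∃ i : Fin k, c i.succ ≠ 0
      · exact Eventually.of_forall fun _ => Or.inr hc
      · by_cases h0 : c 0 = 0
        · have : c₀ ≠ 0 := by
            refine h.resolve_right ?_
            rintro ⟨i, hi⟩
            refine Fin.cases (fun hi => hi h0) (fun j hj => hc ⟨j, hj⟩) i hi
          refine Eventually.of_forall fun a => Or.inl ?_
          rw [h0]; simpa using this
        · filter_upwards [hpt (-c₀ / c 0)] with a ha
          left
          intro h1
          apply ha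
          rw [eq_div_iff h0]
          linarith
    filter_upwards [hpt 1, hlin] with a ha hl
    have ha1 : 1 - a ≠ 0 := fun h0 => ha (by linarith)
    have hI := ih ((c₀ + c 0 * a) / (1 - a)) (fun i => c i.succ)
      (hl.imp (fun h0 => div_ne_zero h0 ha1) id)
    rw [ae_iff] at hI
    refine measure_mono_null ?_ hI
    intro w hw
    simp only [Set.mem_preimage, Set.mem_ofPred_eq] at hw
    simp only [Set.mem_ofPred_eq, ne_eq, not_not]
    rw [Fin.sum_univ_succ, sticks_cons_zero] at hw
    simp only [sticks_cons_succ] at hw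
    have e : ∑ i : Fin k, c i.succ * ((1 - a) * sticks w i) =
        (1 - a) * ∑ i : Fin k, c i.succ * sticks w i := by
      rw [Finset.mul_sum]
      exact Finset.sum_congr rfl fun i _ => by ring
    rw [e] at hw
    field_simp
    linarith

/-! ### Generic points and continuous cutoffs. -/

/-- Points of the cube whose sticks satisfy the inequalities of `GenericLogs` strictly. -/
def genericSet (k B : ℕ) (κ : ℝ) : Set (Fin k → ℝ) :=
  {u | (∀ i, κ < sticks u i) ∧ (∀ i, 1 < B * sticks u i) ∧ ∑ i, sticks u i < 1 - κ ∧
    (∀ i, ∀ b : Fin (B + 3), κ < |(b : ℕ) * sticks u i - 1|) ∧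
    (∀ i j, i ≠ j → ∀ a b : Fin (B + 3), 1 ≤ (a : ℕ) → 1 ≤ (b : ℕ) →
      κ < |(a : ℕ) * sticks u i - (b : ℕ) * sticks u j|) ∧
    ∀ i, ∀ b : Fin (B + 3), 2 ≤ (b : ℕ) → κ < |∑ j, sticks u j - (b : ℕ) * sticks u i|}

lemma genericLogs_of_mem_genericSet {k B : ℕ} {κ : ℝ} {u : Fin k → ℝ} (h : u ∈ genericSet k B κ) :
    GenericLogs B κ (sticks u) := by
  obtain ⟨h1, h2, h3, h4, h5, h6⟩ := h
  exact {
    lower := fun i => (h1 i).le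
    one_le := fun i => (h2 i).le
    sum_le := h3.le
    one := fun i b hb => (h4 i ⟨b, by omega⟩).le
    pair := fun i j hij a b ha ha' hb hb' => (h5 i j hij ⟨a, by omega⟩ ⟨b, by omega⟩ ha hb).le
    total := fun i b hb hb' => (h6 i ⟨b, by omega⟩ hb).le }

lemma isOpen_genericSet (k B : ℕ) (κ : ℝ) : IsOpen (genericSet k B κ) := by
  have hs := fun i : Fin k => continuous_sticks i
  have hsum : Continuous fun u : Fin k → ℝ => ∑ i, sticks u i :=
    continuous_finsetSum _ fun i _ => hs i
  unfold genericSet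
  simp only [Set.ofPred_and, Set.ofPred_forall]
  refine IsOpen.inter ?_ (IsOpen.inter ?_ (IsOpen.inter ?_ (IsOpen.inter ?_ (IsOpen.inter ?_ ?_))))
  · exact isOpen_iInter_of_finite fun i => isOpen_lt continuous_const (hs i)
  · exact isOpen_iInter_of_finite fun i => isOpen_lt continuous_const (continuous_const.mul (hs i))
  · exact isOpen_lt hsum continuous_const
  · exact isOpen_iInter_of_finite fun i => isOpen_iInter_of_finite fun b =>
      isOpen_lt continuous_const ((continuous_const.mul (hs i)).sub continuous_const).abs
  · exact isOpen_iInter_of_finite fun i => isOpen_iInter_of_finite fun j =>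
      isOpen_iInter_of_finite fun _ => isOpen_iInter_of_finite fun a =>
      isOpen_iInter_of_finite fun b => isOpen_iInter_of_finite fun _ =>
      isOpen_iInter_of_finite fun _ => isOpen_lt continuous_const
        ((continuous_const.mul (hs i)).sub (continuous_const.mul (hs j))).abs
  · exact isOpen_iInter_of_finite fun i => isOpen_iInter_of_finite fun b =>
      isOpen_iInter_of_finite fun _ =>
      isOpen_lt continuous_const (hsum.sub (continuous_const.mul (hs i))).abs

lemma genericSet_anti (k B : ℕ) {κ κ' : ℝ} (h : κ' ≤ κ) : genericSet k B κ ⊆ genericSet k B κ' :=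
  fun _ ⟨h1, h2, h3, h4, h5, h6⟩ => ⟨fun i => h.trans_lt (h1 i), h2, by linarith,
    fun i b => h.trans_lt (h4 i b), fun i j hij a b ha hb => h.trans_lt (h5 i j hij a b ha hb),
    fun i b hb => h.trans_lt (h6 i b hb)⟩

lemma ae_sticks_pos (k : ℕ) : ∀ᵐ u ∂cubeMeasure k, ∀ i, 0 < sticks u i := by
  rw [ae_all_iff]
  intro i
  filter_upwards [ae_mem_cube k, ae_affine_sticks_ne_zero 0 (Pi.single i (1 : ℝ))
    (Or.inr ⟨i, by simp⟩)] with u hu hne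
  refine lt_of_le_of_ne (sticks_nonneg hu i) fun h => hne ?_
  rw [zero_add, Finset.sum_eq_single i]
  · simp [← h]
  · intro j _ hj; simp [Pi.single_eq_of_ne hj]
  · simp

/-- For fixed `B`, finitely many quantities must exceed κ. Each is a stick, the remainder, or the
absolute value of a nontrivial affine form in the sticks, and is almost surely positive. -/
lemma ae_eventually_mem_genericSet (k B : ℕ) : ∀ᵐ u ∂cubeMeasure k,
    (∀ i, 1 < B * sticks u i) → ∀ᶠ κ : ℝ in 𝓝[>] 0, u ∈ genericSet k B κ := by
  have hone : ∀ᵐ u ∂cubeMeasure k, ∀ i, ∀ b : Fin (B + 3), (b : ℕ) * sticks u i - 1 ≠ 0 := by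
    rw [ae_all_iff]; intro i
    rw [ae_all_iff]; intro b
    filter_upwards [ae_affine_sticks_ne_zero (-1) (Pi.single i ((b : ℕ) : ℝ))
      (Or.inl (by norm_num))] with u hu h
    apply hu
    rw [Finset.sum_eq_single i]
    · simp only [Pi.single_eq_same]; linarith
    · intro j _ hj; simp [Pi.single_eq_of_ne hj]
    · simp
  have hpair : ∀ᵐ u ∂cubeMeasure k, ∀ i j, i ≠ j → ∀ a b : Fin (B + 3), 1 ≤ (a : ℕ) →
      1 ≤ (b : ℕ) → (a : ℕ) * sticks u i - (b : ℕ) * sticks u j ≠ 0 := by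
    rw [ae_all_iff]; intro i
    rw [ae_all_iff]; intro j
    rw [eventually_imp_distrib_left]; intro hij
    rw [ae_all_iff]; intro a
    rw [ae_all_iff]; intro b
    rw [eventually_imp_distrib_left]; intro ha
    rw [eventually_imp_distrib_left]; intro hb
    filter_upwards [ae_affine_sticks_ne_zero 0
      (Pi.single i ((a : ℕ) : ℝ) - Pi.single j ((b : ℕ) : ℝ))
      (Or.inr ⟨i, by
        simp only [Pi.sub_apply, Pi.single_eq_same, Pi.single_eq_of_ne hij, sub_zero]
        exact_mod_cast (by omega : (a : ℕ) ≠ 0)⟩)] with u hu h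
    apply hu
    simp only [Pi.sub_apply, sub_mul, Finset.sum_sub_distrib]
    rw [Finset.sum_eq_single i, Finset.sum_eq_single j]
    · simp only [Pi.single_eq_same]; linarith
    · intro l _ hl; simp [Pi.single_eq_of_ne hl]
    · simp
    · intro l _ hl; simp [Pi.single_eq_of_ne hl]
    · simp
  have htotal : ∀ᵐ u ∂cubeMeasure k, ∀ i, ∀ b : Fin (B + 3), 2 ≤ (b : ℕ) →
      ∑ j, sticks u j - (b : ℕ) * sticks u i ≠ 0 := by
    rw [ae_all_iff]; intro i
    rw [ae_all_iff]; intro b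
    rw [eventually_imp_distrib_left]; intro hb
    filter_upwards [ae_affine_sticks_ne_zero 0 (1 - Pi.single i ((b : ℕ) : ℝ))
      (Or.inr ⟨i, by
        simp only [Pi.sub_apply, Pi.one_apply, Pi.single_eq_same]
        have : (2 : ℝ) ≤ (b : ℕ) := by exact_mod_cast hb
        exact ne_of_lt (by linarith)⟩)] with u hu h
    apply hu
    simp only [Pi.sub_apply, Pi.one_apply, sub_mul, one_mul, Finset.sum_sub_distrib]
    rw [Finset.sum_eq_single (f := fun l => (Pi.single i ((b : ℕ) : ℝ) : Fin k → ℝ) l * sticks u l)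
      i]
    · simp only [Pi.single_eq_same]; linarith
    · intro l _ hl; simp [Pi.single_eq_of_ne hl]
    · simp
  have hsum : ∀ᵐ u ∂cubeMeasure k, ∑ j, sticks u j < 1 := by
    filter_upwards [ae_mem_cube k, ae_affine_sticks_ne_zero (k := k) 1 (fun _ => -1)
      (Or.inl one_ne_zero)] with u hu hne
    refine lt_of_le_of_ne (sum_sticks_le_one hu) fun h => hne ?_
    simp only [neg_mul, one_mul, Finset.sum_neg_distrib]
    linarith
  have hsmall : ∀ c : ℝ, 0 < c → ∀ᶠ κ : ℝ in 𝓝[>] 0, κ < c := fun c hc =>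
    mem_nhdsWithin_of_mem_nhds (Iio_mem_nhds hc)
  filter_upwards [ae_sticks_pos k, hone, hpair, htotal, hsum] with u h1 h2 h3 h4 h5 hB
  refine (eventually_all.mpr fun i => hsmall _ (h1 i)).and (Eventually.and
    (Eventually.of_forall fun _ => hB) (Eventually.and ?_ (Eventually.and ?_
    (Eventually.and ?_ ?_))))
  · filter_upwards [hsmall (1 - ∑ j, sticks u j) (by linarith)] with κ hκ
    linarith
  · exact eventually_all.mpr fun i => eventually_all.mpr fun b => hsmall _ (abs_pos.mpr (h2 i b))
  · exact eventually_all.mpr fun i => eventually_all.mpr fun j => eventually_all.mpr fun hij =>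
      eventually_all.mpr fun a => eventually_all.mpr fun b => eventually_all.mpr fun ha =>
      eventually_all.mpr fun hb => hsmall _ (abs_pos.mpr (h3 i j hij a b ha hb))
  · exact eventually_all.mpr fun i => eventually_all.mpr fun b => eventually_all.mpr fun hb =>
      hsmall _ (abs_pos.mpr (h4 i b hb))

/-- Two monotone limits: first B → ∞, which captures every point with positive sticks, and then κ →
0 for that `B`. -/
lemma exists_measure_genericSet (k : ℕ) {ε : ENNReal} (hε : 0 < ε) :
    ∃ (B : ℕ) (κ : ℝ), 0 < κ ∧ 1 - ε < cubeMeasure k (genericSet k B κ) := by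
  have hlt : (1 : ENNReal) - ε < 1 := ENNReal.sub_lt_self ENNReal.one_ne_top one_ne_zero hε.ne'
  set A : ℕ → Set (Fin k → ℝ) := fun B => {u | ∀ i, 1 < B * sticks u i} with hA
  have hAmono : Monotone A := by
    intro B B' hB u hu i
    have h1 : 1 < (B : ℝ) * sticks u i := hu i
    have h2 : 0 < sticks u i := by
      by_contra hcon
      have := mul_nonpos_of_nonneg_of_nonpos (Nat.cast_nonneg (α := ℝ) B) (not_lt.mp hcon)
      linarith
    exact h1.trans_le (mul_le_mul_of_nonneg_right (by exact_mod_cast hB) h2.le)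
  have hAuniv : ∀ᵐ u ∂cubeMeasure k, u ∈ ⋃ B, A B := by
    filter_upwards [ae_sticks_pos k] with u hu
    have hev : ∀ᶠ B : ℕ in atTop, ∀ i, 1 < B * sticks u i := eventually_all.mpr fun i =>
      (tendsto_natCast_atTop_atTop.atTop_mul_const (hu i)).eventually_gt_atTop 1
    obtain ⟨B, hB⟩ := hev.exists
    exact Set.mem_iUnion.mpr ⟨B, hB⟩
  have hone : cubeMeasure k (⋃ B, A B) = 1 := by
    rw [measure_eq_measure_of_null_sdiff (Set.subset_univ _) ?_, measure_univ]
    rw [← Set.compl_eq_univ_sdiff]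
    exact hAuniv
  have hlt : 1 - ε < cubeMeasure k (⋃ B, A B) := by rwa [hone]
  rw [hAmono.measure_iUnion, lt_iSup_iff] at hlt
  obtain ⟨B, hB⟩ := hlt
  set G : ℕ → Set (Fin k → ℝ) := fun n => genericSet k B (1 / ((n : ℝ) + 1)) with hG
  have hGmono : Monotone G := fun n n' hn => genericSet_anti k B
    (one_div_le_one_div_of_le (by positivity) (by gcongr))
  have hAG : cubeMeasure k (A B) ≤ cubeMeasure k (⋃ n, G n) := by
    refine measure_mono_ae ?_
    filter_upwards [ae_eventually_mem_genericSet k B] with u hu huA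
    have hlim : Tendsto (fun n : ℕ => 1 / ((n : ℝ) + 1)) atTop (𝓝[>] 0) :=
      tendsto_nhdsWithin_iff.mpr ⟨tendsto_one_div_add_atTop_nhds_zero_nat,
        Eventually.of_forall fun n => Set.mem_Ioi.mpr (by positivity)⟩
    obtain ⟨n, hn⟩ := (hlim.eventually (hu huA)).exists
    exact Set.mem_iUnion.mpr ⟨n, hn⟩
  have hlt2 := hB.trans_le hAG
  rw [hGmono.measure_iUnion, lt_iSup_iff] at hlt2
  obtain ⟨n, hn⟩ := hlt2
  exact ⟨B, 1 / ((n : ℝ) + 1), by positivity, hn⟩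

/-- A continuous cutoff supported on points with generic sticks. -/
lemma exists_cutoff (k : ℕ) {ε : ℝ} (hε : 0 < ε) :
    ∃ (B : ℕ) (κ : ℝ), 0 < κ ∧ ∃ χ : (Fin k → ℝ) → ℝ, Continuous χ ∧
      (∀ u, χ u ∈ Set.Icc (0 : ℝ) 1) ∧ (∀ u, χ u ≠ 0 → u ∈ genericSet k B κ) ∧
      1 - ε ≤ ∫ u, χ u ∂cubeMeasure k := by
  obtain ⟨B, κ, hκ, hlt⟩ := exists_measure_genericSet k (ENNReal.ofReal_pos.mpr hε)
  -- Inner regularity provides a closed subset of nearly full measure; Urysohn's lemma separates it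
  -- from the complement of the generic set.
  obtain ⟨F, hFsub, hF, hFlt⟩ := (isOpen_genericSet k B κ).exists_lt_isClosed hlt
  obtain ⟨f, hf0, hf1, hf⟩ := exists_continuous_zero_one_of_isClosed
    (isOpen_genericSet k B κ).isClosed_compl hF
    (Set.disjoint_left.mpr fun u hu huF => hu (hFsub huF))
  refine ⟨B, κ, hκ, f, f.continuous, hf, fun u hu => ?_, ?_⟩
  · by_contra hcon
    exact hu (hf0 hcon)
  · have h1 : ∫ u, F.indicator 1 u ∂cubeMeasure k ≤ ∫ u, f u ∂cubeMeasure k := by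
      refine integral_mono ((integrable_const (1 : ℝ)).indicator hF.measurableSet)
        (Integrable.of_bound f.continuous.aestronglyMeasurable 1
          (Eventually.of_forall fun u => ?_)) fun u => ?_
      · rw [Real.norm_eq_abs, abs_of_nonneg (hf u).1]; exact (hf u).2
      · by_cases hu : u ∈ F
        · rw [Set.indicator_of_mem hu, hf1 hu]
        · rw [Set.indicator_of_notMem hu]; exact (hf u).1
    rw [integral_indicator_one hF.measurableSet] at h1
    refine le_trans ?_ h1
    have h2 := ENNReal.toReal_mono (measure_ne_top _ _) hFlt.le
    rw [Measure.real]
    refine le_trans ?_ h2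
    rcases le_or_gt 1 ε with h | h
    · exact (by linarith : 1 - ε ≤ 0).trans ENNReal.toReal_nonneg
    · rw [ENNReal.toReal_sub_of_le (ENNReal.ofReal_le_one.mpr h.le) ENNReal.one_ne_top,
        ENNReal.toReal_ofReal hε.le, ENNReal.toReal_one]

/-- The floor of 1/w is locally constant wherever 1/w is not an integer. -/
lemma eventually_carryLength_eq {v : ℝ} (hv : 0 < v) (h : ∀ b : ℕ, b * v ≠ 1) :
    ∀ᶠ w in 𝓝 v, carryLength w = carryLength v := by
  set g := ⌊1 / v⌋₊ with hg
  have h1 : (g : ℝ) < 1 / v := by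
    refine lt_of_le_of_ne (Nat.floor_le (by positivity)) fun h0 => h g ?_
    rw [h0]; field_simp
  have h2 : 1 / v < g + 1 := Nat.lt_floor_add_one _
  have hc : ContinuousAt (fun w : ℝ => 1 / w) v := continuousAt_const.div continuousAt_id hv.ne'
  filter_upwards [hc.eventually (lt_mem_nhds h1), hc.eventually (gt_mem_nhds h2)] with w hw1 hw2
  rw [carryLength, carryLength, ← hg]
  congr 1
  rw [Nat.floor_eq_iff ((Nat.cast_nonneg g).trans hw1.le)]
  exact ⟨hw1.le, hw2⟩

/-- A function of the carry lengths becomes continuous after multiplication by a cutoff. -/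
lemma continuous_cutoff_mul {k B : ℕ} {κ : ℝ} (hκ : 0 < κ) {χ : (Fin k → ℝ) → ℝ}
    (hχ : Continuous χ) (hsupp : ∀ u, χ u ≠ 0 → u ∈ genericSet k B κ)
    {Φ : (Fin k → ℕ) → ℝ} {b : ℝ} (hb : ∀ g, |Φ g| ≤ b) :
    Continuous fun u => χ u * Φ fun i => carryLength (sticks u i) := by
  rw [continuous_iff_continuousAt]
  intro u
  by_cases hu : χ u = 0
  · rw [ContinuousAt, hu, zero_mul]
    refine squeeze_zero_norm (a := fun w => |χ w| * b) (fun w => ?_) ?_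
    · rw [norm_mul, Real.norm_eq_abs, Real.norm_eq_abs]
      exact mul_le_mul_of_nonneg_left (hb _) (abs_nonneg _)
    · have := (hχ.abs.mul_const b).tendsto u
      simpa [hu] using this
  · have hu' := hsupp u hu
    have hgen := genericLogs_of_mem_genericSet hu'
    have hev : ∀ᶠ w in 𝓝 u, (fun i => carryLength (sticks w i)) =
        fun i => carryLength (sticks u i) := by
      have : ∀ i, ∀ᶠ w in 𝓝 u, carryLength (sticks w i) = carryLength (sticks u i) := by
        intro i
        have hpos : 0 < sticks u i := hκ.trans_le (hgen.lower i)
        refine (continuous_sticks i).continuousAt.eventually (eventually_carryLength_eq hpos ?_)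
        intro b hb1
        by_cases hbB : b ≤ B + 2
        · have := hgen.one i b hbB
          rw [hb1, sub_self, abs_zero] at this
          linarith
        -- For b above `B + 2` the multiple exceeds 1 automatically, since B times the stick is
        -- already at least 1.
        · have h1 := hgen.one_le i
          have h2 : (B : ℝ) + 1 ≤ b := by exact_mod_cast (by omega : B + 1 ≤ b)
          nlinarith
      filter_upwards [eventually_all.mpr this] with w hw
      exact funext hw
    refine ContinuousAt.congr (f := fun w => χ w * Φ fun i => carryLength (sticks u i)) ?_ ?_
    · exact hχ.continuousAt.mul continuousAt_const
    · filter_upwards [hev] with w hw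
      rw [hw]

/-! ### Averaging the carries over the cofactor. -/

/-- The carry lengths at the primes of a tuple. -/
noncomputable def carryLengths {k : ℕ} (x : ℝ) (p : Fin k → ℕ) (i : Fin k) : ℕ :=
  carryLength (logCoord x p i)

lemma GenericLogs.rpow_le_div_prod {k B : ℕ} {κ x : ℝ} {p : Fin k → ℕ}
    (hv : GenericLogs B κ (logCoord x p)) (hx : 1 < x) (hp : ∀ i, 1 ≤ p i) :
    x ^ κ ≤ x / (∏ i, p i : ℕ) := by
  have hx0 : 0 < x := by linarith
  rw [← rpow_sum_logCoord hx hp]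
  have : x / x ^ (∑ i, logCoord x p i) = x ^ (1 - ∑ i, logCoord x p i) := by
    rw [Real.rpow_sub hx0, Real.rpow_one]
  rw [this]
  exact Real.rpow_le_rpow_of_exponent_le hx.le (by linarith [hv.sum_le])

lemma abs_div_sub_div_floor_le {y c : ℝ} (hy : 1 ≤ y) (hc : 0 ≤ c) (hcy : c ≤ ⌊y⌋₊) :
    |c / y - c / ⌊y⌋₊| ≤ 1 / y := by
  have hM : (1 : ℝ) ≤ ⌊y⌋₊ := by exact_mod_cast Nat.one_le_floor_iff _ |>.mpr hy
  have h1 : (⌊y⌋₊ : ℝ) ≤ y := Nat.floor_le (by linarith)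
  have h2 : y < ⌊y⌋₊ + 1 := Nat.lt_floor_add_one y
  have e : c / y - c / ⌊y⌋₊ = -((c / ⌊y⌋₊) * (y - ⌊y⌋₊) / y) := by
    field_simp
    ring
  rw [e, abs_neg, abs_of_nonneg (by
    have : 0 ≤ y - ⌊y⌋₊ := by linarith
    positivity)]
  gcongr
  have h3 : c / ⌊y⌋₊ ≤ 1 := div_le_one_of_le₀ hcy (by linarith)
  have h4 : 0 ≤ c / ⌊y⌋₊ := by positivity
  nlinarith

open scoped Classical in
/-- Up to a negligible set of tuples, the proportion of cofactors giving many carries is the product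
of the carry factors. -/
lemma exists_negligible_bound (k ℓ B : ℕ) {κ ε : ℝ} (hκ : 0 < κ) (hε : 0 < ε) :
    ∃ β : ℝ → (Fin k → ℕ) → ℝ, Tendsto (fun x => sizeBiased k x (β x)) atTop (𝓝 0) ∧
      ∀ᶠ x in atTop, ∀ p : Fin k → ℕ, (∀ i, (p i).Prime) →
        0 ≤ β x p ∧ (GenericLogs B κ (logCoord x p) →
        |avg (x / (∏ i, p i : ℕ)) ({m | ManyCarries ℓ (carryLengths x p) p m}.indicator 1) -
          ∏ i, carryFactor ℓ (carryLengths x p i)| ≤ ε + β x p) := by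
  have hg : ∀ g : Fin k → Fin (B + 1), ∀ i, (g i : ℕ) ≤ B := fun g i => by omega
  choose S C₀ hC₀ hS hdist using fun g : Fin k → Fin (B + 1) =>
    exists_phases ℓ B (fun i => (g i : ℕ)) (hg g) (half_pos hε)
  -- The error sums resonance indicators over the finitely many possible length vectors and
  -- frequencies. On a resonant tuple it is at least 1 and covers the trivial bound.
  refine ⟨fun x p => ∑ g, ∑ h ∈ S g, {p | NearResonant B κ (2 * C₀ g) B h x p}.indicator 1 p,
    ?_, ?_⟩
  · have hz : (0 : ℝ) = ∑ g : Fin k → Fin (B + 1), ∑ h ∈ S g, (0 : ℝ) := by simp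
    simp only [sizeBiased_sum]
    rw [hz]
    refine tendsto_finsetSum _ fun g _ => tendsto_finsetSum _ fun h hh => ?_
    refine tendsto_sizeBiased_nearResonant B hκ (by have := hC₀ g; positivity) B h (hS g h hh).1
      (H := ∑ i, ∑ j ∈ Finset.range B, |(h i j : ℝ)|) (by positivity) fun i j => ?_
    by_cases hij : h i j = 0
    · rw [hij, Int.cast_zero, abs_zero]; positivity
    · have hj : j < B := ((hS g h hh).2 i j hij).trans_le (hg g i)
      calc |(h i j : ℝ)| ≤ ∑ j ∈ Finset.range B, |(h i j : ℝ)| :=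
            Finset.single_le_sum (f := fun j => |(h i j : ℝ)|) (fun _ _ => abs_nonneg _)
              (Finset.mem_range.mpr hj)
        _ ≤ _ := Finset.single_le_sum (f := fun i => ∑ j ∈ Finset.range B, |(h i j : ℝ)|)
              (fun _ _ => Finset.sum_nonneg fun _ _ => abs_nonneg _) (Finset.mem_univ i)
  · have hlim := tendsto_rpow_atTop hκ
    filter_upwards [eventually_gt_atTop 1, hlim.eventually_ge_atTop (max 1 (2 / ε))]
      with x hx hxκ p hp
    have hnn : ∀ g : Fin k → Fin (B + 1), ∀ h,
        (0 : ℝ) ≤ {p | NearResonant B κ (2 * C₀ g) B h x p}.indicator 1 p :=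
      fun g h => Set.indicator_nonneg (fun _ _ => zero_le_one) _
    refine ⟨Finset.sum_nonneg fun g _ => Finset.sum_nonneg fun h _ => hnn g h, fun hv => ?_⟩
    set P := ∏ i, p i with hP
    have hP0 : (0 : ℝ) < (P : ℕ) := by
      rw [hP]; exact_mod_cast Finset.prod_pos fun i _ => (hp i).pos
    set y := x / (P : ℕ) with hy
    have hyκ : x ^ κ ≤ y := hv.rpow_le_div_prod hx fun i => (hp i).one_le
    have hy1 : 1 ≤ y := (le_max_left _ _).trans (hxκ.trans hyκ)
    have hyε : 2 / ε ≤ y := (le_max_right _ _).trans (hxκ.trans hyκ)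
    have hb := fun i => hv.carryLength_bounds hκ i
    set g : Fin k → Fin (B + 1) := fun i => ⟨carryLengths x p i, by
      have := (hb i).1; rw [carryLengths]; omega⟩ with hgdef
    have hprod0 : ∀ i, carryFactor ℓ (carryLengths x p i) ∈ Set.Icc (0 : ℝ) 1 := fun i =>
      ⟨carryFactor_nonneg _ _, carryFactor_le_one _ _⟩
    by_cases hbad : ∃ h ∈ S g, NearResonant B κ (2 * C₀ g) B h x p
    · obtain ⟨h, hh, hres⟩ := hbad
      have h1 : (1 : ℝ) ≤ ∑ g, ∑ h ∈ S g,
          {p | NearResonant B κ (2 * C₀ g) B h x p}.indicator 1 p := by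
        calc (1 : ℝ) = {p | NearResonant B κ (2 * C₀ g) B h x p}.indicator 1 p := by
              rw [Set.indicator_of_mem (by exact hres)]; rfl
          _ ≤ ∑ h ∈ S g, {p | NearResonant B κ (2 * C₀ g) B h x p}.indicator 1 p :=
              Finset.single_le_sum (f := fun h =>
                ({p | NearResonant B κ (2 * C₀ g) B h x p}.indicator 1 p : ℝ))
                (fun h _ => hnn g h) hh
          _ ≤ _ := Finset.single_le_sum (f := fun g => ∑ h ∈ S g,
                ({p | NearResonant B κ (2 * C₀ g) B h x p}.indicator 1 p : ℝ))
                (fun g _ => Finset.sum_nonneg fun h _ => hnn g h) (Finset.mem_univ g)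
      have ha0 : 0 ≤ avg y ({m | ManyCarries ℓ (carryLengths x p) p m}.indicator 1) :=
        avg_nonneg (by linarith) fun m => Set.indicator_nonneg (fun _ _ => zero_le_one) _
      have ha1 : avg y ({m | ManyCarries ℓ (carryLengths x p) p m}.indicator 1) ≤ 1 :=
        avg_le_one (by linarith) fun m => Set.indicator_le_self' (fun _ _ => zero_le_one) _
      have hp0 := Finset.prod_nonneg fun i (_ : i ∈ Finset.univ) => (hprod0 i).1
      have hp1 := Finset.prod_le_one (fun i (_ : i ∈ Finset.univ) => (hprod0 i).1)
        fun i _ => (hprod0 i).2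
      rw [abs_le]
      constructor <;> linarith
    · push Not at hbad
      have hM1 : 1 ≤ ⌊y⌋₊ := (Nat.one_le_floor_iff _).mpr hy1
      have hM1' : (1 : ℝ) ≤ ⌊y⌋₊ := by exact_mod_cast hM1
      -- The factor 2 in front of `C₀ g` pays for replacing y = x/P by its integer part.
      have hd := hdist g ⌊y⌋₊ hM1 p (2 * C₀ g * (P : ℕ) / x) (by
        have h2 : y < ⌊y⌋₊ + 1 := Nat.lt_floor_add_one y
        have h3 : y ≤ 2 * ⌊y⌋₊ := by linarith
        have h4 : 2 * C₀ g * (P : ℕ) / x = 2 * C₀ g / y := by rw [hy]; field_simp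
        rw [h4, div_le_div_iff₀ (by linarith) (by linarith)]
        have := hC₀ g
        nlinarith) (fun h hh hnear => hbad h hh
          { pos := fun i => (hp i).one_le
            generic := hv
            near := hnear
            small := fun i j _ hij => by
              have hj : j < carryLengths x p i := (hS g h hh).2 i j hij
              have hv0 : 0 ≤ logCoord x p i := hκ.le.trans (hv.lower i)
              have h5 : ((j + 2 : ℕ) : ℝ) ≤ ((carryLengths x p i + 1 : ℕ) : ℝ) := by
                exact_mod_cast (by omega : j + 2 ≤ carryLengths x p i + 1)
              calc ((j + 2 : ℕ) : ℝ) * logCoord x p i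
                  ≤ ((carryLengths x p i + 1 : ℕ) : ℝ) * logCoord x p i := by gcongr
                _ ≤ 1 - κ := (hb i).2.1
                _ ≤ 1 := by linarith })
      rw [avg_indicator]
      have hclose := abs_div_sub_div_floor_le hy1 (c := (((Finset.Icc 1 ⌊y⌋₊).filter
        fun m => ManyCarries ℓ (carryLengths x p) p m).card : ℝ)) (Nat.cast_nonneg _) (by
          have := Finset.card_filter_le (Finset.Icc 1 ⌊y⌋₊)
            (fun m => ManyCarries ℓ (carryLengths x p) p m)
          rw [Nat.card_Icc, Nat.add_sub_cancel] at this
          exact_mod_cast this)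
      have h6 : 1 / y ≤ ε / 2 := by
        rw [div_le_div_iff₀ (by linarith) (by norm_num)]
        rw [div_le_iff₀ hε] at hyε
        linarith
      have h7 : (0 : ℝ) ≤ ∑ g, ∑ h ∈ S g,
          {p | NearResonant B κ (2 * C₀ g) B h x p}.indicator 1 p :=
        Finset.sum_nonneg fun g _ => Finset.sum_nonneg fun h _ => hnn g h
      have hd' : |(((Finset.Icc 1 ⌊y⌋₊).filter
        fun m => ManyCarries ℓ (carryLengths x p) p m).card : ℝ) / ⌊y⌋₊ -
          ∏ i, carryFactor ℓ (carryLengths x p i)| ≤ ε / 2 := hd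
      have := abs_sub_le ((((Finset.Icc 1 ⌊y⌋₊).filter
        fun m => ManyCarries ℓ (carryLengths x p) p m).card : ℝ) / y)
        ((((Finset.Icc 1 ⌊y⌋₊).filter
        fun m => ManyCarries ℓ (carryLengths x p) p m).card : ℝ) / ⌊y⌋₊)
        (∏ i, carryFactor ℓ (carryLengths x p i))
      simp only [Set.mem_ofPred_eq]
      linarith

/-- The mean of the product of the first `k` carry factors. -/
noncomputable def meanProd (ℓ k : ℕ) : ℝ :=
  ∫ u, ∏ i, carryFactor ℓ (carryLength (sticks u i)) ∂cubeMeasure k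

lemma carryLengths_eq {k : ℕ} {x : ℝ} {p : Fin k → ℕ} (hx : 1 < x) (hp : ∀ i, (p i).Prime)
    (hpx : ((∏ i, p i : ℕ) : ℝ) ≤ x) :
    carryLengths x p = fun i => carryLength (sticks (uCoord k x p) i) :=
  funext fun i => by rw [carryLengths, sticks_uCoord hx hp hpx]

lemma prod_carryFactor_mem {k : ℕ} (ℓ : ℕ) (g : Fin k → ℕ) :
    ∏ i, carryFactor ℓ (g i) ∈ Set.Icc (0 : ℝ) 1 :=
  ⟨Finset.prod_nonneg fun _ _ => carryFactor_nonneg _ _,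
    Finset.prod_le_one (fun _ _ => carryFactor_nonneg _ _) fun _ _ => carryFactor_le_one _ _⟩

/-- The size-biased mean of the proportion of many carries, weighted by a cutoff, converges. -/
lemma tendsto_sizeBiased_manyCarries {k ℓ B : ℕ} {κ : ℝ} (hκ : 0 < κ) {χ : (Fin k → ℝ) → ℝ}
    (hχ : Continuous χ) (hχ01 : ∀ u, χ u ∈ Set.Icc (0 : ℝ) 1)
    (hsupp : ∀ u, χ u ≠ 0 → u ∈ genericSet k B κ) :
    Tendsto (fun x => sizeBiased k x fun p => χ (uCoord k x p) *
      avg (x / (∏ i, p i : ℕ)) ({m | ManyCarries ℓ (carryLengths x p) p m}.indicator 1)) atTop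
      (𝓝 (∫ u, χ u * ∏ i, carryFactor ℓ (carryLength (sticks u i)) ∂cubeMeasure k)) := by
  obtain ⟨C, hC1, hC⟩ := sizeBiased_const_bounded k
  have hcont := continuous_cutoff_mul hκ hχ hsupp (Φ := fun g => ∏ i, carryFactor ℓ (g i)) (b := 1)
    fun g => by
      rw [abs_of_nonneg (prod_carryFactor_mem ℓ g).1]
      exact (prod_carryFactor_mem ℓ g).2
  have hmain := tendsto_sizeBiased_uCoord hcont fun u => by
    rw [abs_mul, abs_of_nonneg (hχ01 u).1, abs_of_nonneg (prod_carryFactor_mem ℓ _).1]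
    exact mul_le_one₀ (hχ01 u).2 (prod_carryFactor_mem ℓ _).1 (prod_carryFactor_mem ℓ _).2
  have hdiff : Tendsto (fun x => sizeBiased k x (fun p => χ (uCoord k x p) *
      avg (x / (∏ i, p i : ℕ)) ({m | ManyCarries ℓ (carryLengths x p) p m}.indicator 1)) -
      sizeBiased k x (fun p => χ (uCoord k x p) *
        ∏ i, carryFactor ℓ (carryLength (sticks (uCoord k x p) i)))) atTop (𝓝 0) := by
    rw [Metric.tendsto_nhds]
    intro ε hε
    obtain ⟨β, hβ, hev⟩ := exists_negligible_bound k ℓ B hκ (ε := ε / (4 * C)) (by positivity)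
    filter_upwards [hev, Metric.tendsto_nhds.mp hβ (ε / 4) (by positivity), eventually_gt_atTop 1]
      with x hx1 hx2 hx
    rw [Real.dist_eq, sub_zero] at hx2 ⊢
    rw [← sizeBiased_sub]
    have hle : ∀ p : Fin k → ℕ, (∀ i, (p i).Prime) → ((∏ i, p i : ℕ) : ℝ) ≤ x →
        |χ (uCoord k x p) * avg (x / (∏ i, p i : ℕ))
          ({m | ManyCarries ℓ (carryLengths x p) p m}.indicator 1) - χ (uCoord k x p) *
          ∏ i, carryFactor ℓ (carryLength (sticks (uCoord k x p) i))| ≤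
        ε / (4 * C) + β x p := by
      intro p hp hpx
      obtain ⟨hβ0, hb⟩ := hx1 p hp
      rw [← mul_sub, abs_mul, abs_of_nonneg (hχ01 _).1]
      by_cases h0 : χ (uCoord k x p) = 0
      · rw [h0, zero_mul]; positivity
      · have hgen := genericLogs_of_mem_genericSet (hsupp _ h0)
        rw [show sticks (uCoord k x p) = logCoord x p from
          funext fun i => sticks_uCoord hx hp hpx i] at hgen
        have := hb hgen
        rw [carryLengths_eq hx hp hpx] at this ⊢
        exact (mul_le_of_le_one_left (abs_nonneg _) (hχ01 _).2).trans this
    refine (abs_sizeBiased_le hx.le hle).trans_lt ?_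
    rw [sizeBiased_add]
    have h1 := hC x hx.le (ε / (4 * C)) (by positivity)
    have h2 : C * (ε / (4 * C)) = ε / 4 := by field_simp
    have h3 := (abs_lt.mp hx2).2
    linarith
  have := hdiff.add hmain
  simpa using this

lemma measurable_carryLength : Measurable carryLength := by
  unfold carryLength
  exact (Nat.measurable_floor.comp (measurable_const.div measurable_id)).sub_const 1

lemma measurable_prod_carryFactor (ℓ k : ℕ) : Measurable fun u : Fin k → ℝ =>
    ∏ i, carryFactor ℓ (carryLength (sticks u i)) :=
  Finset.measurable_fun_prod _ fun i _ => (measurable_of_countable (carryFactor ℓ)).comp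
    (measurable_carryLength.comp (continuous_sticks i).measurable)

lemma integrable_prod_carryFactor (ℓ k : ℕ) : Integrable (fun u : Fin k → ℝ =>
    ∏ i, carryFactor ℓ (carryLength (sticks u i))) (cubeMeasure k) :=
  Integrable.of_bound (measurable_prod_carryFactor ℓ k).aestronglyMeasurable 1
    (Eventually.of_forall fun u => by
      rw [Real.norm_eq_abs, abs_of_nonneg (prod_carryFactor_mem ℓ _).1]
      exact (prod_carryFactor_mem ℓ _).2)

lemma integrable_of_mem_Icc {k : ℕ} {χ : (Fin k → ℝ) → ℝ} (hχ : Continuous χ)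
    (hχ01 : ∀ u, χ u ∈ Set.Icc (0 : ℝ) 1) : Integrable χ (cubeMeasure k) :=
  Integrable.of_bound hχ.aestronglyMeasurable 1 (Eventually.of_forall fun u => by
    rw [Real.norm_eq_abs, abs_of_nonneg (hχ01 u).1]
    exact (hχ01 u).2)

lemma integral_cutoff_mul_mem {ℓ k : ℕ} {χ : (Fin k → ℝ) → ℝ} (hχ : Continuous χ)
    (hχ01 : ∀ u, χ u ∈ Set.Icc (0 : ℝ) 1) :
    ∫ u, χ u * ∏ i, carryFactor ℓ (carryLength (sticks u i)) ∂cubeMeasure k ≤ meanProd ℓ k ∧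
      meanProd ℓ k - (1 - ∫ u, χ u ∂cubeMeasure k) ≤
        ∫ u, χ u * ∏ i, carryFactor ℓ (carryLength (sticks u i)) ∂cubeMeasure k := by
  have hI := integrable_prod_carryFactor ℓ k
  have hIχ := integrable_of_mem_Icc hχ hχ01
  have hIm : Integrable (fun u => χ u * ∏ i, carryFactor ℓ (carryLength (sticks u i)))
      (cubeMeasure k) := by
    refine Integrable.of_bound (hχ.measurable.mul
      (measurable_prod_carryFactor ℓ k)).aestronglyMeasurable 1 (Eventually.of_forall fun u => ?_)
    rw [Real.norm_eq_abs, abs_mul, abs_of_nonneg (hχ01 u).1,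
      abs_of_nonneg (prod_carryFactor_mem ℓ _).1]
    exact mul_le_one₀ (hχ01 u).2 (prod_carryFactor_mem ℓ _).1 (prod_carryFactor_mem ℓ _).2
  constructor
  · refine integral_mono hIm hI fun u => ?_
    exact mul_le_of_le_one_left (prod_carryFactor_mem ℓ _).1 (hχ01 u).2
  · have h1 : (1 : ℝ) = ∫ _ : Fin k → ℝ, (1 : ℝ) ∂cubeMeasure k := by simp
    have hI2 : Integrable (fun u => 1 - χ u) (cubeMeasure k) := (integrable_const _).sub hIχ
    rw [meanProd, h1, ← integral_sub (integrable_const _) hIχ, ← integral_sub hI hI2]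
    refine integral_mono (hI.sub hI2) hIm fun u => ?_
    have h2 := (prod_carryFactor_mem ℓ fun i => carryLength (sticks u i)).2
    have h3 := (hχ01 u).2
    simp only
    nlinarith

/-! ### The unbroken remainder, and the limit of the averages. -/

/-- For a tuple of primes this remainder is the exponent of x/P, the range of the cofactor. The
product form gives it mean 2^(-k). -/
lemma one_sub_sum_sticks {k : ℕ} (u : Fin k → ℝ) : 1 - ∑ i, sticks u i = ∏ i, (1 - u i) := by
  induction k with
  | zero => simp
  | succ k ih =>
    rw [← Fin.cons_self_tail u, sum_sticks_cons, Fin.prod_univ_succ]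
    simp only [Fin.cons_zero, Fin.cons_succ]
    rw [← ih]
    ring

lemma integral_prod_one_sub (k : ℕ) :
    ∫ u, ∏ i, (1 - u i) ∂cubeMeasure k = (1 / 2) ^ k := by
  rw [cubeMeasure, integral_fintype_prod_eq_prod (fun _ (a : ℝ) => 1 - a), Finset.prod_const,
    Finset.card_univ, Fintype.card_fin]
  congr 1
  rw [integral_Icc_eq_integral_Ioc, ← intervalIntegral.integral_of_le zero_le_one,
    intervalIntegral.integral_sub (by simp) (by simp)]
  simp
  norm_num

/-- A continuous majorant of the indicator that the unbroken part exceeds `η`. -/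
noncomputable def restMajorant {k : ℕ} (η : ℝ) (u : Fin k → ℝ) : ℝ :=
  min 1 (|1 - ∑ i, sticks u i| / η)

lemma continuous_restMajorant {k : ℕ} (η : ℝ) :
    Continuous (restMajorant η : (Fin k → ℝ) → ℝ) :=
  continuous_const.min ((continuous_const.sub (continuous_finsetSum _ fun i _ =>
    continuous_sticks i)).abs.div_const η)

lemma restMajorant_mem {k : ℕ} {η : ℝ} (hη : 0 < η) (u : Fin k → ℝ) :
    restMajorant η u ∈ Set.Icc (0 : ℝ) 1 :=
  ⟨le_min zero_le_one (by positivity), min_le_left _ _⟩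

lemma integral_restMajorant_le (k : ℕ) {η : ℝ} (hη : 0 < η) :
    ∫ u, restMajorant η u ∂cubeMeasure k ≤ (1 / 2) ^ k / η := by
  rw [← integral_prod_one_sub, ← integral_div]
  have hcube : ∀ᵐ u ∂cubeMeasure k, 0 ≤ ∏ i, (1 - u i) ∧ ∏ i, (1 - u i) ≤ 1 := by
    filter_upwards [ae_mem_cube k] with u hu
    exact ⟨Finset.prod_nonneg fun i _ => by linarith [(hu i).2],
      Finset.prod_le_one (fun i _ => by linarith [(hu i).2]) fun i _ => by linarith [(hu i).1]⟩
  refine integral_mono_ae (integrable_of_mem_Icc (continuous_restMajorant η)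
    (restMajorant_mem hη)) ?_ ?_
  · refine Integrable.div_const (Integrable.of_bound (Continuous.aestronglyMeasurable
      (by fun_prop)) 1 ?_) η
    filter_upwards [hcube] with u hu
    rw [Real.norm_eq_abs, abs_of_nonneg hu.1]
    exact hu.2
  · filter_upwards [hcube] with u hu
    rw [restMajorant, one_sub_sum_sticks, abs_of_nonneg hu.1]
    exact min_le_right _ _

/-- The integers whose `ℓ`-th power divides their central binomial coefficient. -/
def powDvdSet (ℓ : ℕ) : Set ℕ := {n | n ^ ℓ ∣ (2 * n).choose n}

lemma indicator_one_mem (s : Set ℕ) (n : ℕ) : (s.indicator 1 n : ℝ) ∈ Set.Icc (0 : ℝ) 1 :=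
  ⟨Set.indicator_nonneg (fun _ _ => zero_le_one) _,
    Set.indicator_le_self' (fun _ _ => zero_le_one) _⟩

section Pointwise

variable {k ℓ B : ℕ} {κ : ℝ} {χ : (Fin k → ℝ) → ℝ} {x : ℝ} {p : Fin k → ℕ}

lemma cast_prod_mul_le (hp : ∀ i, (p i).Prime) {m : ℕ} (hm : (m : ℝ) ≤ x / (∏ i, p i : ℕ)) :
    (((∏ i, p i) * m : ℕ) : ℝ) ≤ x := by
  have hP0 : (0 : ℝ) < ((∏ i, p i : ℕ) : ℝ) := by
    exact_mod_cast Finset.prod_pos fun i _ => (hp i).pos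
  rw [le_div_iff₀ hP0] at hm
  rw [Nat.cast_mul, mul_comm]
  exact hm

/-- On the support of the cutoff, divisibility forces enough carries at the chosen primes; elsewhere
the trivial bound 1 is charged to 1 - χ. -/
lemma avg_powDvdSet_le (hκ : 0 < κ) (hχ01 : ∀ u, χ u ∈ Set.Icc (0 : ℝ) 1)
    (hsupp : ∀ u, χ u ≠ 0 → u ∈ genericSet k B κ) (hx : 1 < x) (hxκ : 2 < x ^ κ)
    (hp : ∀ i, (p i).Prime) (hpx : ((∏ i, p i : ℕ) : ℝ) ≤ x) :
    avg (x / (∏ i, p i : ℕ)) (fun m => (powDvdSet ℓ).indicator 1 ((∏ i, p i) * m)) ≤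
      χ (uCoord k x p) *
        avg (x / (∏ i, p i : ℕ)) ({m | ManyCarries ℓ (carryLengths x p) p m}.indicator 1) +
      (1 - χ (uCoord k x p)) := by
  have hy : 0 ≤ x / (∏ i, p i : ℕ) := by positivity
  have h1 : avg (x / (∏ i, p i : ℕ)) (fun m => (powDvdSet ℓ).indicator 1 ((∏ i, p i) * m)) ≤ 1 :=
    avg_le_one hy fun m => (indicator_one_mem _ _).2
  have hc := hχ01 (uCoord k x p)
  by_cases h0 : χ (uCoord k x p) = 0
  · rw [h0]; linarith
  have hgen := genericLogs_of_mem_genericSet (hsupp _ h0)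
  rw [show sticks (uCoord k x p) = logCoord x p from
    funext fun i => sticks_uCoord hx hp hpx i] at hgen
  have hle : avg (x / (∏ i, p i : ℕ)) (fun m => (powDvdSet ℓ).indicator 1 ((∏ i, p i) * m)) ≤
      avg (x / (∏ i, p i : ℕ)) ({m | ManyCarries ℓ (carryLengths x p) p m}.indicator 1) := by
    refine avg_mono hy fun m hm hmy => ?_
    by_cases hd : (∏ i, p i) * m ∈ powDvdSet ℓ
    · have := hgen.manyCarries_of_dvd hκ hx hxκ hp (by omega) (cast_prod_mul_le hp hmy) hd
      rw [Set.indicator_of_mem hd, Set.indicator_of_mem (by exact this)]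
      rfl
    · rw [Set.indicator_of_notMem hd]
      exact (indicator_one_mem _ _).1
  nlinarith [hc.1, hc.2]

/-- If x/P ≤ x^η, then m ≤ x^η and every failure of divisibility is a small-prime obstruction.
Otherwise the remainder exceeds η and `restMajorant` equals 1. -/
lemma avg_manyCarries_le (hκ : 0 < κ) (hχ01 : ∀ u, χ u ∈ Set.Icc (0 : ℝ) 1)
    (hsupp : ∀ u, χ u ≠ 0 → u ∈ genericSet k B κ) (hx : 1 < x) (hxκ : 2 < x ^ κ)
    (hp : ∀ i, (p i).Prime) (hpx : ((∏ i, p i : ℕ) : ℝ) ≤ x) {η : ℝ} (hη : 0 < η) :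
    χ (uCoord k x p) *
        avg (x / (∏ i, p i : ℕ)) ({m | ManyCarries ℓ (carryLengths x p) p m}.indicator 1) ≤
      avg (x / (∏ i, p i : ℕ)) (fun m => (powDvdSet ℓ).indicator 1 ((∏ i, p i) * m)) +
      avg (x / (∏ i, p i : ℕ)) (fun m =>
        (smallPrimeObstruction ℓ (x ^ η)).indicator 1 ((∏ i, p i) * m)) +
      restMajorant η (uCoord k x p) := by
  have hy : 0 ≤ x / (∏ i, p i : ℕ) := by positivity
  have hx0 : 0 < x := by linarith
  have ha := avg_nonneg hy (f := fun m => (powDvdSet ℓ).indicator 1 ((∏ i, p i) * m))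
    fun m => (indicator_one_mem _ _).1
  have hb := avg_nonneg hy (f := fun m =>
    (smallPrimeObstruction ℓ (x ^ η)).indicator 1 ((∏ i, p i) * m))
    fun m => (indicator_one_mem _ _).1
  have hr := restMajorant_mem hη (uCoord k x p)
  have hM0 := avg_nonneg hy (f := {m | ManyCarries ℓ (carryLengths x p) p m}.indicator 1)
    fun m => (indicator_one_mem _ _).1
  have hM1 := avg_le_one hy (f := {m | ManyCarries ℓ (carryLengths x p) p m}.indicator 1)
    fun m => (indicator_one_mem _ _).2
  by_cases h0 : χ (uCoord k x p) = 0
  · rw [h0, zero_mul]; linarith [hr.1]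
  have hst : sticks (uCoord k x p) = logCoord x p :=
    funext fun i => sticks_uCoord hx hp hpx i
  have hgen := genericLogs_of_mem_genericSet (hsupp _ h0)
  rw [hst] at hgen
  refine (mul_le_of_le_one_left hM0 (hχ01 _).2).trans ?_
  rcases le_or_gt (x / (∏ i, p i : ℕ)) (x ^ η) with hyη | hyη
  · have hle : avg (x / (∏ i, p i : ℕ))
        ({m | ManyCarries ℓ (carryLengths x p) p m}.indicator 1) ≤
        avg (x / (∏ i, p i : ℕ)) (fun m => (powDvdSet ℓ).indicator 1 ((∏ i, p i) * m) +
          (smallPrimeObstruction ℓ (x ^ η)).indicator 1 ((∏ i, p i) * m)) := by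
      refine avg_mono hy fun m hm hmy => ?_
      by_cases hmc : ManyCarries ℓ (carryLengths x p) p m
      · have h2 : ({m | ManyCarries ℓ (carryLengths x p) p m}.indicator 1 m : ℝ) = 1 :=
          Set.indicator_of_mem (by exact hmc) _
        rw [h2]
        by_cases hd : (∏ i, p i) * m ∈ powDvdSet ℓ
        · rw [Set.indicator_of_mem hd, Pi.one_apply, le_add_iff_nonneg_right]
          exact (indicator_one_mem _ _).1
        · have := hgen.mem_smallPrimeObstruction hκ hx hxκ hp (by omega) (cast_prod_mul_le hp hmy)
            hmc hd (hmy.trans hyη)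
          rw [Set.indicator_of_mem this, Pi.one_apply, le_add_iff_nonneg_left]
          exact (indicator_one_mem _ _).1
      · have h2 : ({m | ManyCarries ℓ (carryLengths x p) p m}.indicator 1 m : ℝ) = 0 :=
          Set.indicator_of_notMem (by exact hmc) _
        rw [h2]
        exact add_nonneg (indicator_one_mem _ _).1 (indicator_one_mem _ _).1
    rw [avg_add] at hle
    linarith [hr.1]
  · have hlog : η * Real.log x < Real.log x * (1 - ∑ i, logCoord x p i) := by
      rw [← log_div_prod hx fun i => (hp i).one_le, ← Real.log_rpow hx0]
      exact Real.log_lt_log (by positivity) hyη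
    have hlx := Real.log_pos hx
    have hR : η < 1 - ∑ i, logCoord x p i := by
      rw [mul_comm] at hlog
      exact lt_of_mul_lt_mul_left hlog hlx.le
    have h1 : restMajorant η (uCoord k x p) = 1 := by
      rw [restMajorant, hst, min_eq_left]
      rw [one_le_div hη, abs_of_pos (by linarith)]
      exact hR.le
    linarith

end Pointwise

/-- Valid for every `k`, since enough carries at the k chosen primes is a necessary condition. -/
lemma eventually_avg_powDvdSet_le (ℓ k : ℕ) {ε : ℝ} (hε : 0 < ε) :
    ∀ᶠ x in atTop, avg x ((powDvdSet ℓ).indicator 1) ≤ meanProd ℓ k + ε := by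
  obtain ⟨B, κ, hκ, χ, hχ, hχ01, hsupp, hint⟩ := exists_cutoff k (ε := ε / 4) (by positivity)
  obtain ⟨X, -, hX⟩ := avg_sub_sizeBiased k (ε / 4) (by positivity)
  have h1 := tendsto_sizeBiased_manyCarries (ℓ := ℓ) hκ hχ hχ01 hsupp
  have h2 := tendsto_sizeBiased_uCoord (F := fun u => 1 - χ u) (continuous_const.sub hχ) fun u => by
    rw [abs_le]; constructor <;> linarith [(hχ01 u).1, (hχ01 u).2]
  rw [integral_sub (integrable_const _) (integrable_of_mem_Icc hχ hχ01)] at h2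
  have h3 := (h1.add h2).eventually_le_const (lt_add_of_pos_right _ (by positivity : 0 < ε / 4))
  filter_upwards [h3, eventually_ge_atTop X, eventually_gt_atTop 1,
    (tendsto_rpow_atTop hκ).eventually_gt_atTop 2] with x hx hxX hx1 hxκ
  have h4 := (abs_le.mp (hX x hxX _ (fun m => (indicator_one_mem (powDvdSet ℓ) m).1)
    fun m => (indicator_one_mem _ m).2)).2
  have h5 := sizeBiased_mono hx1.le fun p hp hpx =>
    avg_powDvdSet_le (ℓ := ℓ) hκ hχ01 hsupp hx1 hxκ hp hpx
  rw [sizeBiased_add] at h5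
  have h6 := (integral_cutoff_mul_mem (ℓ := ℓ) hχ hχ01).1
  simp only [integral_const, probReal_univ, smul_eq_mul, mul_one] at hx
  linarith

/-- η is fixed first by the small-prime estimate; then `k` must be large enough that the remainder
rarely exceeds η. -/
lemma eventually_le_avg_powDvdSet (ℓ : ℕ) {ε : ℝ} (hε : 0 < ε) :
    ∃ K : ℕ, ∀ k ≥ K, ∀ᶠ x in atTop, meanProd ℓ k - ε ≤ avg x ((powDvdSet ℓ).indicator 1) := by
  obtain ⟨η, hη, -, X₁, -, hobs⟩ := avg_smallPrimeObstruction_le ℓ (ε := ε / 8) (by positivity)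
  have hlim : Tendsto (fun k : ℕ => (1 / 2 : ℝ) ^ k / η) atTop (𝓝 0) := by
    have := (tendsto_pow_atTop_nhds_zero_of_lt_one (by norm_num : (0 : ℝ) ≤ 1 / 2)
      (by norm_num)).div_const η
    simpa using this
  obtain ⟨K, hK⟩ := eventually_atTop.mp (hlim.eventually_le_const (by positivity : 0 < ε / 8))
  refine ⟨K, fun k hk => ?_⟩
  obtain ⟨B, κ, hκ, χ, hχ, hχ01, hsupp, hint⟩ := exists_cutoff k (ε := ε / 8) (by positivity)
  obtain ⟨X, -, hX⟩ := avg_sub_sizeBiased k (ε / 8) (by positivity)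
  have h1 := (tendsto_sizeBiased_manyCarries (ℓ := ℓ) hκ hχ hχ01 hsupp).eventually_const_le
    (sub_lt_self _ (by positivity : 0 < ε / 8))
  have h2 := (tendsto_sizeBiased_uCoord (continuous_restMajorant (k := k) η) fun u => by
    rw [abs_of_nonneg (restMajorant_mem hη u).1]
    exact (restMajorant_mem hη u).2).eventually_le_const
      (lt_add_of_pos_right _ (by positivity : 0 < ε / 8))
  filter_upwards [h1, h2, eventually_ge_atTop X, eventually_ge_atTop X₁, eventually_gt_atTop 1,
    (tendsto_rpow_atTop hκ).eventually_gt_atTop 2] with x hx1 hx2 hxX hxX₁ hx hxκ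
  have h4 := (abs_le.mp (hX x hxX _ (fun m => (indicator_one_mem (powDvdSet ℓ) m).1)
    fun m => (indicator_one_mem _ m).2)).1
  have h5 := (abs_le.mp (hX x hxX _
    (fun m => (indicator_one_mem (smallPrimeObstruction ℓ (x ^ η)) m).1)
    fun m => (indicator_one_mem _ m).2)).1
  have h6 := sizeBiased_mono hx.le fun p hp hpx =>
    avg_manyCarries_le (ℓ := ℓ) hκ hχ01 hsupp hx hxκ hp hpx hη
  rw [sizeBiased_add, sizeBiased_add] at h6
  have h7 := (integral_cutoff_mul_mem (ℓ := ℓ) hχ hχ01).2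
  have h8 := hobs x hxX₁
  have h9 := (integral_restMajorant_le k hη).trans (hK k hk)
  linarith

/-- The proportion of integers in `powDvdSet ℓ` converges to the limit of `meanProd ℓ`. -/
lemma exists_tendsto_meanProd (ℓ : ℕ) : ∃ c, Tendsto (meanProd ℓ) atTop (𝓝 c) ∧
    Tendsto (fun x => avg x ((powDvdSet ℓ).indicator 1)) atTop (𝓝 c) := by
  have hlow := fun ε hε => eventually_le_avg_powDvdSet ℓ (ε := ε) hε
  have hup := fun k ε hε => eventually_avg_powDvdSet_le ℓ k (ε := ε) hε
  -- Two means are compared through the same average at a common x: the lower bound for large k, the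
  -- upper bound for arbitrary j.
  have hcomp : ∀ ε : ℝ, 0 < ε → ∃ K : ℕ, ∀ k ≥ K, ∀ j, meanProd ℓ k ≤ meanProd ℓ j + ε := by
    intro ε hε
    obtain ⟨K, hK⟩ := hlow (ε / 2) (by positivity)
    refine ⟨K, fun k hk j => ?_⟩
    obtain ⟨x, h1, h2⟩ := ((hK k hk).and (hup j (ε / 2) (by positivity))).exists
    linarith
  have hcauchy : CauchySeq (meanProd ℓ) := by
    rw [Metric.cauchySeq_iff]
    intro ε hε
    obtain ⟨K, hK⟩ := hcomp (ε / 2) (by positivity)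
    refine ⟨K, fun m hm n hn => ?_⟩
    rw [Real.dist_eq, abs_lt]
    constructor <;> linarith [hK m hm n, hK n hn m]
  obtain ⟨c, hc⟩ := cauchySeq_tendsto_of_complete hcauchy
  refine ⟨c, hc, ?_⟩
  rw [Metric.tendsto_nhds]
  intro ε hε
  obtain ⟨K, hK⟩ := hlow (ε / 3) (by positivity)
  have hev := (Metric.tendsto_nhds.mp hc (ε / 3) (by positivity)).and (eventually_ge_atTop K)
  obtain ⟨k, hk1, hk2⟩ := hev.exists
  filter_upwards [hK k hk2, hup k (ε / 3) (by positivity)] with x h1 h2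
  rw [Real.dist_eq, abs_lt] at hk1 ⊢
  constructor <;> linarith [hk1.1, hk1.2]

/-! ### Positivity of the limit. -/

lemma sum_range_choose_succ_le (ℓ b : ℕ) :
    ∑ h ∈ Finset.range ℓ, (b + 1).choose h ≤ 2 * ∑ h ∈ Finset.range ℓ, b.choose h := by
  cases ℓ with
  | zero => simp
  | succ ℓ =>
    rw [Finset.sum_range_succ' (fun h => (b + 1).choose h)]
    simp only [Nat.choose_succ_succ', Nat.choose_zero_right, Finset.sum_add_distrib]
    have h1 : ∑ h ∈ Finset.range ℓ, b.choose h ≤ ∑ h ∈ Finset.range (ℓ + 1), b.choose h :=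
      Finset.sum_le_sum_of_subset (Finset.range_subset_range.mpr (by omega))
    have h2 : ∑ h ∈ Finset.range ℓ, b.choose (h + 1) + 1 =
        ∑ h ∈ Finset.range (ℓ + 1), b.choose h := by
      rw [Finset.sum_range_succ' (fun h => b.choose h), Nat.choose_zero_right]
    omega

lemma carryFactor_mono (ℓ : ℕ) : Monotone (carryFactor ℓ) := by
  refine monotone_nat_of_le_succ fun b => ?_
  have h : ∑ h ∈ Finset.range ℓ, ((b + 1).choose h : ℝ) ≤
      2 * ∑ h ∈ Finset.range ℓ, (b.choose h : ℝ) := by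
    exact_mod_cast sum_range_choose_succ_le ℓ b
  rw [carryFactor, carryFactor, pow_succ, mul_inv]
  have h2 : (0 : ℝ) < ((2 : ℝ) ^ b)⁻¹ := by positivity
  nlinarith

/-- By monotonicity the worst case is b = ℓ, where all ℓ coins must show heads. -/
lemma half_pow_le_carryFactor {ℓ b : ℕ} (h : ℓ ≤ b) : (1 / 2) ^ ℓ ≤ carryFactor ℓ b := by
  refine le_trans (le_of_eq ?_) (carryFactor_mono ℓ h)
  have h1 : ∑ h ∈ Finset.range ℓ, (ℓ.choose h : ℝ) + 1 = 2 ^ ℓ := by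
    have := Nat.sum_range_choose ℓ
    rw [Finset.sum_range_succ, Nat.choose_self] at this
    exact_mod_cast this
  have h2 : (2 : ℝ) ^ ℓ ≠ 0 := by positivity
  rw [carryFactor, one_div, inv_pow, eq_sub_of_add_eq h1]
  field_simp
  ring

/-- Weighting binom(b, h) by 2^(-h) bounds the partial sum by 2^ℓ(3/2)^b. The decay (3/4)^b is then
weakened to 6/(b + 2), all that is needed for a loss linear in the stick. -/
lemma one_sub_carryFactor_le (ℓ b : ℕ) : 1 - carryFactor ℓ b ≤ 6 * 2 ^ ℓ / (b + 2) := by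
  have h1 : ∑ h ∈ Finset.range ℓ, (b.choose h : ℝ) ≤ 2 ^ ℓ * (3 / 2) ^ b := by
    have h2 : ((1 / 2 : ℝ) + 1) ^ b = ∑ h ∈ Finset.range (b + 1), (1 / 2 : ℝ) ^ h * b.choose h := by
      rw [add_pow]
      simp
    have h3 : ∀ N, ∑ h ∈ Finset.range N, (1 / 2 : ℝ) ^ h * b.choose h ≤ (3 / 2) ^ b := by
      intro N
      rw [show (3 / 2 : ℝ) = 1 / 2 + 1 by norm_num, h2]
      rcases le_total N (b + 1) with hN | hN
      · exact Finset.sum_le_sum_of_subset_of_nonneg (Finset.range_subset_range.mpr hN)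
          fun _ _ _ => by positivity
      · refine le_of_eq (Finset.sum_subset (Finset.range_subset_range.mpr hN) fun h _ hh => ?_).symm
        rw [Finset.mem_range, not_lt] at hh
        rw [Nat.choose_eq_zero_of_lt (by omega)]
        simp
    calc ∑ h ∈ Finset.range ℓ, (b.choose h : ℝ)
        ≤ ∑ h ∈ Finset.range ℓ, 2 ^ ℓ * ((1 / 2 : ℝ) ^ h * b.choose h) := by
          refine Finset.sum_le_sum fun h hh => ?_
          have h4 : (1 : ℝ) ≤ 2 ^ ℓ * (1 / 2) ^ h := by
            rw [one_div, inv_pow, ← div_eq_mul_inv, one_le_div (by positivity)]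
            exact pow_le_pow_right₀ (by norm_num) (Finset.mem_range.mp hh).le
          rw [← mul_assoc]
          exact le_mul_of_one_le_left (Nat.cast_nonneg _) h4
      _ = 2 ^ ℓ * ∑ h ∈ Finset.range ℓ, (1 / 2 : ℝ) ^ h * b.choose h := by rw [Finset.mul_sum]
      _ ≤ _ := by gcongr; exact h3 ℓ
  have hpow : (3 / 4 : ℝ) ^ b * (b + 2) ≤ 6 := by
    have hb : 1 + (b : ℝ) * (1 / 3) ≤ (1 + 1 / 3) ^ b := one_add_mul_le_pow (by norm_num) b
    have hb2 : (3 / 4 : ℝ) ^ b * (1 + 1 / 3) ^ b = 1 := by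
      rw [← mul_pow]; norm_num
    have hp : (0 : ℝ) < (3 / 4) ^ b := by positivity
    nlinarith
  rw [carryFactor, sub_sub_cancel, le_div_iff₀ (by positivity)]
  calc ((2 : ℝ) ^ b)⁻¹ * (∑ h ∈ Finset.range ℓ, (b.choose h : ℝ)) * (b + 2)
      ≤ ((2 : ℝ) ^ b)⁻¹ * (2 ^ ℓ * (3 / 2) ^ b) * (b + 2) := by gcongr
    _ = 2 ^ ℓ * ((3 / 4) ^ b * (b + 2)) := by
        rw [show (3 / 4 : ℝ) = 2⁻¹ * (3 / 2) by norm_num, mul_pow, inv_pow]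
        ring
    _ ≤ 2 ^ ℓ * 6 := by gcongr
    _ = 6 * 2 ^ ℓ := by ring

lemma one_sub_carryFactor_carryLength_le (ℓ : ℕ) {v : ℝ} (hv : 0 < v) :
    1 - carryFactor ℓ (carryLength v) ≤ 6 * 2 ^ ℓ * v := by
  refine (one_sub_carryFactor_le ℓ _).trans ?_
  rw [div_le_iff₀ (by positivity), mul_assoc]
  refine le_mul_of_one_le_right (by positivity) ?_
  have h1 : 1 / v < ⌊1 / v⌋₊ + 1 := Nat.lt_floor_add_one _
  have h2 : (⌊1 / v⌋₊ : ℝ) + 1 ≤ carryLength v + 2 := by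
    rw [carryLength]
    exact_mod_cast (by omega : ⌊1 / v⌋₊ + 1 ≤ ⌊1 / v⌋₊ - 1 + 2)
  rw [div_lt_iff₀ hv] at h1
  nlinarith

/-- The mean product of carry factors when a stick of length `R` is broken. -/
noncomputable def scaledMean (ℓ k : ℕ) (R : ℝ) : ℝ :=
  ∫ u, ∏ i, carryFactor ℓ (carryLength (R * sticks u i)) ∂cubeMeasure k

lemma measurable_prod_carryFactor_scaled (ℓ k : ℕ) (R : ℝ) : Measurable fun u : Fin k → ℝ =>
    ∏ i, carryFactor ℓ (carryLength (R * sticks u i)) :=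
  Finset.measurable_fun_prod _ fun i _ => (measurable_of_countable (carryFactor ℓ)).comp
    (measurable_carryLength.comp (continuous_const.mul (continuous_sticks i)).measurable)

lemma abs_prod_carryFactor_le_one {k : ℕ} (ℓ : ℕ) (g : Fin k → ℕ) :
    |∏ i, carryFactor ℓ (g i)| ≤ 1 := by
  rw [abs_of_nonneg (prod_carryFactor_mem ℓ g).1]
  exact (prod_carryFactor_mem ℓ g).2

lemma one_sub_sum_le_prod {ι : Type*} (s : Finset ι) {f : ι → ℝ}
    (hf : ∀ i, f i ∈ Set.Icc (0 : ℝ) 1) : 1 - ∑ i ∈ s, (1 - f i) ≤ ∏ i ∈ s, f i := by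
  classical
  induction s using Finset.induction_on with
  | empty => simp
  | insert a s ha ih =>
    rw [Finset.sum_insert ha, Finset.prod_insert ha]
    have h0 : 0 ≤ ∑ i ∈ s, (1 - f i) := Finset.sum_nonneg fun i _ => by linarith [(hf i).2]
    nlinarith [(hf a).1, (hf a).2, mul_le_mul_of_nonneg_left ih (hf a).1,
      mul_nonneg (sub_nonneg.mpr (hf a).2) h0]

/-- Union bound: the loss at each stick is linear in its length, and the lengths total at most `R`.
-/
lemma one_sub_le_scaledMean (ℓ k : ℕ) {R : ℝ} (hR : 0 < R) :
    1 - 6 * 2 ^ ℓ * R ≤ scaledMean ℓ k R := by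
  have h1 : 1 - 6 * 2 ^ ℓ * R = ∫ _ : Fin k → ℝ, (1 - 6 * 2 ^ ℓ * R) ∂cubeMeasure k := by simp
  rw [h1, scaledMean]
  refine integral_mono_ae (integrable_const _) (Integrable.of_bound
    (measurable_prod_carryFactor_scaled ℓ k R).aestronglyMeasurable 1
    (Eventually.of_forall fun u => abs_prod_carryFactor_le_one ℓ _)) ?_
  filter_upwards [ae_mem_cube k, ae_sticks_pos k] with u hu hpos
  have h2 := one_sub_sum_le_prod Finset.univ
    (f := fun i => carryFactor ℓ (carryLength (R * sticks u i)))
    fun i => ⟨carryFactor_nonneg _ _, carryFactor_le_one _ _⟩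
  have h3 : ∑ i, (1 - carryFactor ℓ (carryLength (R * sticks u i))) ≤
      ∑ i, 6 * 2 ^ ℓ * R * sticks u i := by
    refine Finset.sum_le_sum fun i _ => ?_
    have := one_sub_carryFactor_carryLength_le ℓ (mul_pos hR (hpos i))
    rwa [mul_assoc]
  rw [← Finset.mul_sum] at h3
  have h4 : 6 * 2 ^ ℓ * R * ∑ i, sticks u i ≤ 6 * 2 ^ ℓ * R :=
    mul_le_of_le_one_right (by positivity) (sum_sticks_le_one hu)
  linarith

/-- The mean product stays away from zero, uniformly in the number of factors. -/
lemma exists_pos_le_scaledMean (ℓ J : ℕ) : ∃ c : ℝ, 0 < c ∧ c ≤ 1 ∧ ∀ k : ℕ, ∀ R : ℝ, 0 < R →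
    R ≤ 1 → 6 * 2 ^ ℓ * (R * (1 - 1 / (2 * (ℓ + 2))) ^ J) ≤ 1 / 2 → c ≤ scaledMean ℓ k R := by
  set L : ℝ := ℓ + 2 with hL
  have hL2 : 2 ≤ L := by rw [hL]; linarith [Nat.cast_nonneg (α := ℝ) ℓ]
  have hL0 : 0 < L := by linarith
  have hlow : 1 / (2 * L) ≤ 1 / 2 := by
    rw [div_le_div_iff₀ (by positivity) (by norm_num)]; linarith
  have hρ : 0 ≤ 1 - 1 / (2 * L) := by linarith
  -- The first break is forced into [1/(2L), 1/L]. The stick is short enough to have carry length at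
  -- least ℓ, so its factor is at least 2^(-ℓ), and what remains shrinks by a factor at most 1 -
  -- 1/(2L). After `J` forced breaks the remainder is short enough for `one_sub_le_scaledMean`,
  -- whatever `k` is.
  induction J with
  | zero =>
    refine ⟨1 / 2, by norm_num, by norm_num, fun k R hR _ h => ?_⟩
    have := one_sub_le_scaledMean ℓ k hR
    rw [pow_zero, mul_one] at h
    linarith
  | succ J ih =>
    obtain ⟨c, hc0, hc1, hc⟩ := ih
    have hd1 : (1 / 2 : ℝ) ^ ℓ ≤ 1 := pow_le_one₀ (by norm_num) (by norm_num)
    refine ⟨1 / (2 * L) * ((1 / 2) ^ ℓ * c), by positivity, ?_, fun k R hR hR1 h => ?_⟩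
    · exact mul_le_one₀ (by linarith) (by positivity) (mul_le_one₀ hd1 hc0.le hc1)
    · cases k with
      | zero =>
        have : scaledMean ℓ 0 R = 1 := by simp [scaledMean]
        rw [this]
        exact mul_le_one₀ (by linarith) (by positivity) (mul_le_one₀ hd1 hc0.le hc1)
      | succ k =>
        set I : Set ℝ := Set.Icc (1 / (2 * L)) (1 / L) with hI
        have hmeas := measurable_prod_carryFactor_scaled ℓ (k + 1) R
        have hint : Integrable (fun a : ℝ => ∫ w, ∏ i, carryFactor ℓ (carryLength
            (R * sticks (Fin.cons a w : Fin (k + 1) → ℝ) i)) ∂cubeMeasure k)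
            (volume.restrict (Set.Icc (0 : ℝ) 1)) :=
          (Integrable.of_bound (hmeas.comp (measurePreserving_cons k).measurable
            ).aestronglyMeasurable 1 (Eventually.of_forall fun z =>
              abs_prod_carryFactor_le_one ℓ _) : Integrable _
            ((volume.restrict (Set.Icc (0 : ℝ) 1)).prod (cubeMeasure k))).integral_prod_left
        rw [scaledMean, integral_cubeMeasure_succ hmeas fun u => abs_prod_carryFactor_le_one ℓ _]
        have hsplit : ∀ a : ℝ, ∫ w, ∏ i, carryFactor ℓ (carryLength
            (R * sticks (Fin.cons a w : Fin (k + 1) → ℝ) i)) ∂cubeMeasure k =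
            carryFactor ℓ (carryLength (R * a)) * scaledMean ℓ k (R * (1 - a)) := by
          intro a
          rw [scaledMean, ← integral_const_mul]
          refine integral_congr_ae (Eventually.of_forall fun w => ?_)
          simp only [Fin.prod_univ_succ, sticks_cons_zero, sticks_cons_succ, mul_assoc]
        simp only [hsplit] at hint ⊢
        have hnonneg : ∀ R', 0 ≤ scaledMean ℓ k R' := fun R' =>
          integral_nonneg fun u => (prod_carryFactor_mem ℓ _).1
        have hIlen : volume.real I = 1 / (2 * L) := by
          rw [hI, Real.volume_real_Icc_of_le (by gcongr; linarith)]
          field_simp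
          ring
        have hIsub : I ⊆ Set.Icc (0 : ℝ) 1 := by
          refine Set.Icc_subset_Icc (by positivity) ?_
          rw [div_le_one hL0]; linarith
        calc 1 / (2 * L) * ((1 / 2) ^ ℓ * c)
            = ∫ a in I, (1 / 2) ^ ℓ * c := by
              rw [setIntegral_const, hIlen, smul_eq_mul]
          _ ≤ ∫ a in I, carryFactor ℓ (carryLength (R * a)) * scaledMean ℓ k (R * (1 - a)) := by
              refine setIntegral_mono_on (integrableOn_const (by simp [hI]))
                (IntegrableOn.mono_set hint hIsub) measurableSet_Icc fun a ha => ?_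
              have ha0 : 0 < a := lt_of_lt_of_le (by positivity) ha.1
              have ha1 : a ≤ 1 / 2 := ha.2.trans (by
                rw [div_le_div_iff₀ hL0 (by norm_num)]; linarith)
              refine mul_le_mul (half_pow_le_carryFactor ?_) (hc k _ ?_ ?_ ?_) hc0.le
                (carryFactor_nonneg _ _)
              · have h2 : ℓ + 2 ≤ ⌊1 / (R * a)⌋₊ := by
                  refine Nat.le_floor ?_
                  rw [le_div_iff₀ (by positivity)]
                  have h3 : R * a ≤ 1 / L :=
                    (mul_le_of_le_one_left ha0.le hR1).trans ha.2
                  rw [le_div_iff₀ hL0] at h3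
                  push_cast
                  linarith
                rw [carryLength]
                omega
              · exact mul_pos hR (by linarith)
              · exact mul_le_one₀ hR1 (by linarith) (by linarith)
              · refine le_trans ?_ h
                rw [pow_succ']
                have h4 : R * (1 - a) ≤ R * (1 - 1 / (2 * L)) :=
                  mul_le_mul_of_nonneg_left (by linarith [ha.1]) hR.le
                have h5 : 0 ≤ (1 - 1 / (2 * L)) ^ J := pow_nonneg hρ J
                have h6 := mul_le_mul_of_nonneg_right h4 h5
                rw [mul_assoc R (1 - 1 / (2 * L))] at h6
                gcongr
          _ ≤ _ := setIntegral_mono_set hint (Eventually.of_forall fun a =>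
              mul_nonneg (carryFactor_nonneg _ _) (hnonneg _)) hIsub.eventuallyLE

lemma exists_pos_le_meanProd (ℓ : ℕ) : ∃ c : ℝ, 0 < c ∧ ∀ k, c ≤ meanProd ℓ k := by
  have hL : (1 : ℝ) - 1 / (2 * (ℓ + 2)) < 1 := by
    rw [sub_lt_self_iff]; positivity
  have hL0 : (0 : ℝ) ≤ 1 - 1 / (2 * (ℓ + 2)) := by
    rw [sub_nonneg, div_le_one (by positivity)]
    linarith [Nat.cast_nonneg (α := ℝ) ℓ]
  obtain ⟨J, hJ⟩ := exists_pow_lt_of_lt_one (by positivity : (0 : ℝ) < 1 / 2 / (6 * 2 ^ ℓ)) hL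
  obtain ⟨c, hc0, -, hc⟩ := exists_pos_le_scaledMean ℓ J
  refine ⟨c, hc0, fun k => ?_⟩
  have h := hc k 1 one_pos le_rfl (by
    rw [one_mul]
    rw [lt_div_iff₀ (by positivity)] at hJ
    linarith)
  simpa [scaledMean, meanProd] using h

/-! ### The infinite product and its expectation. -/

/-- Finite products decrease along inclusion and are bounded below, so the unordered limit always
exists, possibly as 0. -/
lemma multipliable_of_mem_Icc {f : ℕ → ℝ} (hf : ∀ i, f i ∈ Set.Icc (0 : ℝ) 1) :
    Multipliable f := by
  have hanti : Antitone fun s : Finset ℕ => ∏ i ∈ s, f i := fun s t hst =>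
    Finset.prod_le_prod_of_subset_of_le_one hst (fun i _ => (hf i).1) fun i _ _ => (hf i).2
  refine ⟨⨅ s : Finset ℕ, ∏ i ∈ s, f i, ?_⟩
  rw [HasProd, SummationFilter.unconditional_filter]
  exact tendsto_atTop_ciInf hanti ⟨0, by
    rintro _ ⟨s, rfl⟩
    exact Finset.prod_nonneg fun i _ => (hf i).1⟩

lemma stick_extendZero {u : ℕ → ℝ} {k : ℕ} (i : Fin k) :
    stick u i = sticks (fun j : Fin k => u j) i := by
  have h : ∀ j : ℕ, j < k → extendZero (fun j : Fin k => u j) j = u j := fun j hj => by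
    rw [extendZero, dif_pos hj]
  rw [sticks, stick, stick, h i i.2]
  congr 1
  refine Finset.prod_congr rfl fun j hj => ?_
  rw [h j ((Finset.mem_range.mp hj).trans i.2)]

lemma carryFactor_mem (ℓ b : ℕ) : carryFactor ℓ b ∈ Set.Icc (0 : ℝ) 1 :=
  ⟨carryFactor_nonneg ℓ b, carryFactor_le_one ℓ b⟩

section Probability

variable {Ω : Type*} [MeasurableSpace Ω] {P : Measure Ω} [IsProbabilityMeasure P]
  {U : ℕ → Ω → ℝ}

lemma map_eq_cubeMeasure (hU : ∀ i, Measurable (U i))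
    (hunif : ∀ i, pdf.IsUniform (U i) (Set.Icc (0 : ℝ) 1) P volume) (hind : iIndepFun U P)
    (k : ℕ) : P.map (fun ω (i : Fin k) => U i ω) = cubeMeasure k := by
  have h := hind.precomp (g := fun i : Fin k => (i : ℕ)) Fin.val_injective
  have h2 := (iIndepFun_iff_map_fun_eq_pi_map
    (f := fun (i : Fin k) => U i) fun i => (hU i).aemeasurable).mp h
  rw [h2, cubeMeasure]
  congr 1
  funext i
  rw [(hunif i : P.map (U i) = _), ProbabilityTheory.cond]
  simp

lemma prod_range_eq (ℓ k : ℕ) (u : ℕ → ℝ) :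
    ∏ j ∈ Finset.range k, carryFactor ℓ (gIndex u j) =
      ∏ i : Fin k, carryFactor ℓ (carryLength (sticks (fun j : Fin k => u j) i)) := by
  rw [Finset.prod_range]
  refine Finset.prod_congr rfl fun i _ => ?_
  rw [gIndex, stick_extendZero, carryLength]

lemma measurable_prod_range (hU : ∀ i, Measurable (U i)) (ℓ k : ℕ) :
    Measurable fun ω => ∏ j ∈ Finset.range k, carryFactor ℓ (gIndex (fun i => U i ω) j) := by
  simp only [prod_range_eq]
  exact (measurable_prod_carryFactor ℓ k).comp (measurable_pi_lambda _ fun i => hU i)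

lemma integral_prod_range (hU : ∀ i, Measurable (U i))
    (hunif : ∀ i, pdf.IsUniform (U i) (Set.Icc (0 : ℝ) 1) P volume) (hind : iIndepFun U P)
    (ℓ k : ℕ) :
    ∫ ω, ∏ j ∈ Finset.range k, carryFactor ℓ (gIndex (fun i => U i ω) j) ∂P = meanProd ℓ k := by
  simp only [prod_range_eq]
  rw [meanProd, ← map_eq_cubeMeasure hU hunif hind k,
    integral_map (measurable_pi_lambda _ fun i : Fin k => hU i).aemeasurable
      (measurable_prod_carryFactor ℓ k).aestronglyMeasurable]

lemma tendsto_prod_range (ℓ : ℕ) (u : ℕ → ℝ) :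
    Tendsto (fun k => ∏ j ∈ Finset.range k, carryFactor ℓ (gIndex u j)) atTop
      (𝓝 (∏' j, carryFactor ℓ (gIndex u j))) :=
  (multipliable_of_mem_Icc fun _ => carryFactor_mem ℓ _).hasProd.tendsto_prod_nat

lemma norm_prod_range_le_one (ℓ k : ℕ) (u : ℕ → ℝ) :
    ‖∏ j ∈ Finset.range k, carryFactor ℓ (gIndex u j)‖ ≤ 1 := by
  rw [prod_range_eq]
  exact abs_prod_carryFactor_le_one ℓ _

lemma integrable_tprod (hU : ∀ i, Measurable (U i)) (ℓ : ℕ) :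
    Integrable (fun ω => ∏' j : ℕ, carryFactor ℓ (gIndex (fun i => U i ω) j)) P := by
  refine Integrable.of_bound (aestronglyMeasurable_of_tendsto_ae atTop
    (fun k => (measurable_prod_range hU ℓ k).aestronglyMeasurable)
    (Eventually.of_forall fun ω => tendsto_prod_range ℓ _)) 1 (Eventually.of_forall fun ω => ?_)
  exact le_of_tendsto (tendsto_prod_range ℓ _).norm
    (Eventually.of_forall fun k => norm_prod_range_le_one ℓ k _)

/-- The partial products have mean `meanProd ℓ k`, are bounded by 1 and converge pointwise, so
dominated convergence applies. -/
lemma tendsto_meanProd_integral (hU : ∀ i, Measurable (U i))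
    (hunif : ∀ i, pdf.IsUniform (U i) (Set.Icc (0 : ℝ) 1) P volume) (hind : iIndepFun U P)
    (ℓ : ℕ) : Tendsto (meanProd ℓ) atTop
      (𝓝 (∫ ω, ∏' j : ℕ, carryFactor ℓ (gIndex (fun i => U i ω) j) ∂P)) := by
  have h := tendsto_integral_of_dominated_convergence (μ := P) (fun _ => 1)
    (fun k => (measurable_prod_range hU ℓ k).aestronglyMeasurable) (integrable_const 1)
    (fun k => Eventually.of_forall fun ω => norm_prod_range_le_one ℓ k _)
    (Eventually.of_forall fun ω => tendsto_prod_range ℓ fun i => U i ω)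
  simpa only [integral_prod_range hU hunif hind] using h

end Probability

lemma hasAsymptoticDensity_of_tendsto_avg {A : Set ℕ} {c : ℝ}
    (h : Tendsto (fun x => avg x (A.indicator 1)) atTop (𝓝 c)) : HasAsymptoticDensity A c := by
  classical
  refine (h.comp tendsto_natCast_atTop_atTop).congr fun N => ?_
  rw [Function.comp_apply, avg_indicator, Nat.floor_natCast]
  congr 2
  rw [← Set.ncard_coe_finset]
  congr 1
  ext n
  simp only [Finset.coe_filter, Finset.mem_Icc, Set.mem_ofPred_eq, Set.mem_inter_iff, Set.mem_Icc]
  tauto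

end CentralBinomDensity

theorem theorem1 (ℓ : ℕ) :
    ∃ c : ℝ, 0 < c ∧
      CentralBinomDensity.HasAsymptoticDensity {n : ℕ | n ^ ℓ ∣ (2 * n).choose n} c ∧
      ∀ (Ω : Type*) [MeasurableSpace Ω] (P : Measure Ω) [IsProbabilityMeasure P]
        (U : ℕ → Ω → ℝ),
        (∀ i, Measurable (U i)) →
        (∀ i, pdf.IsUniform (U i) (Set.Icc (0 : ℝ) 1) P volume) →
        iIndepFun U P →
          (∀ᵐ ω ∂P, Multipliable fun j : ℕ =>
            CentralBinomDensity.carryFactor ℓ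
              (CentralBinomDensity.gIndex (fun i => U i ω) j)) ∧
          Integrable (fun ω => ∏' j : ℕ,
            CentralBinomDensity.carryFactor ℓ
              (CentralBinomDensity.gIndex (fun i => U i ω) j)) P ∧
          c = ∫ ω, ∏' j : ℕ,
            CentralBinomDensity.carryFactor ℓ
              (CentralBinomDensity.gIndex (fun i => U i ω) j) ∂P := by
  obtain ⟨c, hc, havg⟩ := CentralBinomDensity.exists_tendsto_meanProd ℓ
  obtain ⟨c₀, hc₀, hle⟩ := CentralBinomDensity.exists_pos_le_meanProd ℓ
  refine ⟨c, hc₀.trans_le (ge_of_tendsto' hc hle),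
    CentralBinomDensity.hasAsymptoticDensity_of_tendsto_avg havg, ?_⟩
  intro Ω _ P _ U hU hunif hind
  exact ⟨Eventually.of_forall fun ω =>
      CentralBinomDensity.multipliable_of_mem_Icc fun _ => CentralBinomDensity.carryFactor_mem ℓ _,
    CentralBinomDensity.integrable_tprod hU ℓ,
    tendsto_nhds_unique hc (CentralBinomDensity.tendsto_meanProd_integral hU hunif hind ℓ)⟩
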